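/- Let $n\ge 2$, let $(M,g)$ be a smooth connected $n$-dimensional Riemannian manifold without boundary (not necessarily complete), and let $\Omega\subset M$ be a connected open set with smooth boundary. Let $r$ be the signed distance to $\partial\Omega$, negative inside $\Omega$; put $\Omega_\delta=\{r<\delta\}$ and $\partial_r=\nabla r$. Let $r_0>0$ be such that $r$ is smooth in $\Omega\setminus\overline{\Omega_{-r_0}}$, and assume that there $$|\mathrm{Ric}|\le r_0^{-2},\qquad |\nabla^2 r|\le r_0^{-1},\qquad |\nabla^2\partial_r|\le r_0^{-2}$$ (Hilbert--Schmidt norms). Let $\{\Sigma_t\}$, $\Sigma_t\subset\Omega\setminus\overline{\Omega_{-r_0}}$, be a smooth family of hypersurfaces with unit normal $\nu$ and mean curvature $H>0$ (the trace of $A=\nabla\nu$) evolving under the inverse mean curvature flow $\partial_t\Sigma_t=\nu/H$. Write $\nabla_\Sigma,\Delta_\Sigma$ for the gradient and Laplacian of $\Sigma_t$, $\Box=\partial_t-H^{-2}\Delta_\Sigma$ with $\partial_t$ the derivative along the normal motion, and $p=\langle\nu,\partial_r\rangle$. Assume that $p\ge\frac12$ on all $\Sigma_t$. (1) There exist constants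 $\gamma\in(0,1/2)$ and $C_1,C_2>0$, depending only on $n$, such that for every such $M,\Omega,r_0,\{\Sigma_t\}$ and every $b\in(0,1]$ the function $F=(1-p)\,(b-r/r_0)^{-\gamma}$ satisfies $$(1-p)^{\frac2\gamma-1}H^2\,\Box F+\langle\nabla_\Sigma F,X\rangle\le \frac{C_1}{r_0^2}\Big(-F^{\frac{\gamma+2}{\gamma}}+C_2\Big)$$ on all $\Sigma_t$, for some smooth (time-dependent, tangential) vector field $X$ on the flow. (2) For every $C_3$ there exist constants $C_4,C_5>0$, depending only on $n$ and $C_3$, such that the following holds for every such $M,\Omega,r_0,\{\Sigma_t\}$ and all $b,\gamma\in(0,1/2)$. If in addition $1-p\le C_3(b-r/r_0)^\gamma$ on all $\Sigma_t$, then, with $$\eta(r)=(b-r/r_0)^{1-\gamma}-(2b)^{1-\gamma},\qquad G=r_0H\eta(r),$$ there is a smooth (time-dependent, tangential) vector field $X$ on the flow such that in $\Omega_{-br_0}\setminus\overline{\Omega_{-r_0}}$ $$\Box G+\langle\nabla_\Sigma G,X\rangle\le-\frac Gn+\frac{4n}{G}+C_4\,(b-r/r_0)^{-\gamma}\Big(\frac{C_5}{G}-1\Big).$$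 -/

import Mathlib

open Set Bundle Manifold FiberBundle
open scoped ContDiff Topology

namespace IMCF

noncomputable section

/-! ### Riemannian geometry on a manifold modelled on `ℝᵏ` -/

section Geometry

variable {k : ℕ} {M : Type*} [TopologicalSpace M] [ChartedSpace (EuclideanSpace ℝ (Fin k)) M]
  [IsManifold (𝓡 k) 1 M]

/-- A vector field on `M` (no regularity imposed). -/
abbrev VField (k : ℕ) (M : Type*) [TopologicalSpace M]
    [ChartedSpace (EuclideanSpace ℝ (Fin k)) M] : Type _ :=
  ∀ x : M, TangentSpace (𝓡 k) x

/-- A field of two-argument functions on the tangent spaces; used for Riemannian metrics. -/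
abbrev MetricField (k : ℕ) (M : Type*) [TopologicalSpace M]
    [ChartedSpace (EuclideanSpace ℝ (Fin k)) M] : Type _ :=
  ∀ x : M, TangentSpace (𝓡 k) x → TangentSpace (𝓡 k) x → ℝ

/-- The `i`-th vector of the coordinate basis of `T_x M`. -/
def tb (x : M) (i : Fin k) : TangentSpace (𝓡 k) x :=
  (EuclideanSpace.single i (1 : ℝ) : EuclideanSpace ℝ (Fin k))

/-- The vector field near `x`, constant in the preferred chart at `x`, with value `v` at `x`. -/
def extendVec {x : M} (v : TangentSpace (𝓡 k) x) : VField k M :=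
  extend (EuclideanSpace ℝ (Fin k)) v

/-- The coefficients `g^{ij}` of the inverse metric at `x` in the basis `tb x`. -/
def invGram (g : MetricField k M) (x : M) : Matrix (Fin k) (Fin k) ℝ :=
  (Matrix.of fun i j => g x (tb x i) (tb x j))⁻¹

/-- The trace `g^{ij} B_{ij}` of a bilinear form on `T_x M` with respect to `g`. -/
def traceForm (g : MetricField k M) (x : M)
    (B : TangentSpace (𝓡 k) x → TangentSpace (𝓡 k) x → ℝ) : ℝ :=
  ∑ i, ∑ j, invGram g x i j * B (tb x i) (tb x j)

/-- The Hilbert-Schmidt norm of a bilinear form on `T_x M`. -/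
def normForm (g : MetricField k M) (x : M)
    (B : TangentSpace (𝓡 k) x → TangentSpace (𝓡 k) x → ℝ) : ℝ :=
  √(∑ i, ∑ j, ∑ a, ∑ b, invGram g x i a * invGram g x j b *
    (B (tb x i) (tb x j) * B (tb x a) (tb x b)))

/-- The Hilbert-Schmidt norm of a bilinear map `T_x M × T_x M → T_x M`. -/
def normVForm (g : MetricField k M) (x : M)
    (B : TangentSpace (𝓡 k) x → TangentSpace (𝓡 k) x → TangentSpace (𝓡 k) x) : ℝ :=
  √(∑ i, ∑ j, ∑ a, ∑ b, invGram g x i a * invGram g x j b *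
    g x (B (tb x i) (tb x j)) (B (tb x a) (tb x b)))

/-- The gradient of a function with respect to `g`. -/
def grad (g : MetricField k M) (f : M → ℝ) : VField k M := fun x =>
  ∑ i, ∑ j, (invGram g x i j * mvfderiv (𝓡 k) f x (tb x j)) • tb x i

/-- The right-hand side of Koszul's formula for `g (∇_X Y, Z)` at `x`. -/
def koszul (g : MetricField k M) (X Y Z : VField k M) (x : M) : ℝ :=
  (mvfderiv (𝓡 k) (fun y => g y (Y y) (Z y)) x (X x)
    + mvfderiv (𝓡 k) (fun y => g y (Z y) (X y)) x (Y x)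
    - mvfderiv (𝓡 k) (fun y => g y (X y) (Y y)) x (Z x)
    + g x (VectorField.mlieBracket (𝓡 k) X Y x) (Z x)
    - g x (VectorField.mlieBracket (𝓡 k) X Z x) (Y x)
    - g x (VectorField.mlieBracket (𝓡 k) Y Z x) (X x)) / 2

open Classical in
/-- The Levi-Civita connection: `leviCivita g Y x v` is `(∇_v Y)(x)`, the linear endomorphism of
`T_x M` determined by Koszul's formula (and `0` if there is none, which does not happen when `g` is
a smooth Riemannian metric near `x` and `Y` is differentiable at `x`). -/
def leviCivita (g : MetricField k M) (Y : VField k M) (x : M) :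
    TangentSpace (𝓡 k) x →ₗ[ℝ] TangentSpace (𝓡 k) x :=
  if h : ∃ L : TangentSpace (𝓡 k) x →ₗ[ℝ] TangentSpace (𝓡 k) x,
      ∀ v z : TangentSpace (𝓡 k) x, g x (L v) z = koszul g (extendVec v) Y (extendVec z) x
  then h.choose else 0

/-- The covariant derivative `∇_X Y` as a vector field. -/
def covField (g : MetricField k M) (X Y : VField k M) : VField k M :=
  fun x => leviCivita g Y x (X x)

/-- The second covariant derivative `∇²_{u,v} Y = ∇_u ∇_V Y - ∇_{∇_u V} Y`, `V` extending `v`. -/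
def cov2 (g : MetricField k M) (Y : VField k M) (x : M) (u v : TangentSpace (𝓡 k) x) :
    TangentSpace (𝓡 k) x :=
  leviCivita g (covField g (extendVec v) Y) x u - leviCivita g Y x (leviCivita g (extendVec v) x u)

/-- The curvature `R(u,v)w = ∇_u ∇_V W - ∇_v ∇_U W - ∇_{[U,V]} W`. -/
def curv (g : MetricField k M) (x : M) (u v w : TangentSpace (𝓡 k) x) : TangentSpace (𝓡 k) x :=
  leviCivita g (covField g (extendVec v) (extendVec w)) x u
    - leviCivita g (covField g (extendVec u) (extendVec w)) x v
    - leviCivita g (extendVec w) x (VectorField.mlieBracket (𝓡 k) (extendVec u) (extendVec v) x)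

/-- The Ricci curvature `Ric(v,w) = tr (u ↦ R(u,v)w)`. -/
def ricci (g : MetricField k M) (x : M) (v w : TangentSpace (𝓡 k) x) : ℝ :=
  traceForm g x fun u z => g x (curv g x u v w) z

/-- The Hessian `∇²f (v,w) = v (W f) - (∇_v W) f`, with `W` extending `w`. -/
def hessian (g : MetricField k M) (f : M → ℝ) (x : M) (v w : TangentSpace (𝓡 k) x) : ℝ :=
  mvfderiv (𝓡 k) (fun y => mvfderiv (𝓡 k) f y (extendVec w y)) x v
    - mvfderiv (𝓡 k) f x (leviCivita g (extendVec w) x v)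

/-- The Laplace-Beltrami operator. -/
def laplacian (g : MetricField k M) (f : M → ℝ) (x : M) : ℝ :=
  traceForm g x (hessian g f x)

/-- A domain (connected open set) with smooth boundary: near each boundary point it is the
sublevel set `{ρ < 0}` of a smooth function with nonvanishing differential there. -/
def IsSmoothDomain (Ω : Set M) : Prop :=
  IsOpen Ω ∧ IsConnected Ω ∧ ∀ x ∈ frontier Ω, ∃ V : Set M, IsOpen V ∧ x ∈ V ∧ ∃ ρ : M → ℝ,
    ContMDiffOn (𝓡 k) 𝓘(ℝ, ℝ) ∞ ρ V ∧ mvfderiv (𝓡 k) ρ x ≠ 0 ∧ Ω ∩ V = {y ∈ V | ρ y < 0}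

end Geometry

/-! ### Submanifold geometry of an immersion `f : N → M` -/

section Immersed

variable {m k : ℕ} {N : Type*} [TopologicalSpace N] [ChartedSpace (EuclideanSpace ℝ (Fin m)) N]
  [IsManifold (𝓡 m) 1 N]
  {M : Type*} [TopologicalSpace M] [ChartedSpace (EuclideanSpace ℝ (Fin k)) M]
  [IsManifold (𝓡 k) 1 M]

/-- The induced metric `f^* g`. -/
def inducedMetric (g : MetricField k M) (f : N → M) : MetricField m N := fun x v w =>
  g (f x) (mfderiv (𝓡 m) (𝓡 k) f x v) (mfderiv (𝓡 m) (𝓡 k) f x w)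

/-- The covariant derivative `∇_v V` of a vector field `V` along a map `f`. In the frame of
coordinate vector fields `e_i` of the chart at `f x`, writing `V = ∑ Vⁱ (e_i ∘ f)`, this is
`∑ dVⁱ(v) e_i + ∑ Vⁱ(x) ∇_{df v} e_i`. -/
def covAlong (g : MetricField k M) (f : N → M) (V : ∀ x : N, TangentSpace (𝓡 k) (f x)) (x : N)
    (v : TangentSpace (𝓡 m) x) : TangentSpace (𝓡 k) (f x) :=
  (trivializationAt (EuclideanSpace ℝ (Fin k)) (TangentSpace (𝓡 k)) (f x)).symm (f x)
      (mvfderiv (𝓡 m) (fun y => (trivializationAt (EuclideanSpace ℝ (Fin k))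
        (TangentSpace (𝓡 k)) (f x) ⟨f y, V y⟩).2) x v)
    + leviCivita g (extendVec (V x)) (f x) (mfderiv (𝓡 m) (𝓡 k) f x v)

/-- The second fundamental form `A(v,w) = ⟨∇_v ν, df w⟩` with respect to the unit normal `ν`. -/
def secondFF (g : MetricField k M) (f : N → M) (ν : ∀ x : N, TangentSpace (𝓡 k) (f x)) (x : N)
    (v w : TangentSpace (𝓡 m) x) : ℝ :=
  g (f x) (covAlong g f ν x v) (mfderiv (𝓡 m) (𝓡 k) f x w)

/-- The mean curvature `H = tr A`; the unit sphere in `ℝⁿ` with its outer normal has `H = n - 1`. -/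
def meanCurv (g : MetricField k M) (f : N → M) (ν : ∀ x : N, TangentSpace (𝓡 k) (f x))
    (x : N) : ℝ :=
  traceForm (inducedMetric (m := m) g f) x (secondFF g f ν x)

end Immersed

/-! ### The Riemannian manifold `M`, the obstacle, and the flow -/

section Flow

variable {n : ℕ} {M : Type*} [MetricSpace M] [ChartedSpace (EuclideanSpace ℝ (Fin n)) M]
  [IsManifold (𝓡 n) ∞ M] [RiemannianBundle (fun x : M => TangentSpace (𝓡 n) x)]
  {N : Type*} [TopologicalSpace N] [ChartedSpace (EuclideanSpace ℝ (Fin (n - 1))) N]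
  [IsManifold (𝓡 (n - 1)) ∞ N]

variable (n M) in
/-- The Riemannian metric of `M`. -/
def ambientMetric : MetricField n M := fun _ v w => inner ℝ v w

open Classical in
/-- The signed distance to `∂Ω`, negative inside `Ω`. -/
def signedDist (Ω : Set M) (x : M) : ℝ :=
  if x ∈ Ω then -Metric.infDist x (frontier Ω) else Metric.infDist x (frontier Ω)

/-- The collar `Ω \ closure Ω_{-r₀}`, where `Ω_δ = {x | r x < δ}`. -/
def collar (Ω : Set M) (r₀ : ℝ) : Set M :=
  Ω \ closure {x | signedDist Ω x < -r₀}

variable (n) in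
/-- The outer radial vector field `∂_r = ∇ r`. -/
def radial (Ω : Set M) : VField n M := grad (ambientMetric n M) (signedDist Ω)

variable (n) in
/-- `Ω` is a smooth domain, `r` is smooth in the collar of width `r₀ > 0`, and there
`|Ric| ≤ r₀⁻²`, `|∇² r| ≤ r₀⁻¹`, `|∇² ∂_r| ≤ r₀⁻²`. -/
structure IsSmoothObstacle (Ω : Set M) (r₀ : ℝ) : Prop where
  domain : IsSmoothDomain (k := n) Ω
  pos : 0 < r₀
  smooth : ContMDiffOn (𝓡 n) 𝓘(ℝ, ℝ) ∞ (signedDist Ω) (collar Ω r₀)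
  ricci_le : ∀ y ∈ collar Ω r₀,
    normForm (ambientMetric n M) y (ricci (ambientMetric n M) y) ≤ (r₀ ^ 2)⁻¹
  hess_le : ∀ y ∈ collar Ω r₀,
    normForm (ambientMetric n M) y (hessian (ambientMetric n M) (signedDist Ω) y) ≤ r₀⁻¹
  cov2_le : ∀ y ∈ collar Ω r₀,
    normVForm (ambientMetric n M) y (cov2 (ambientMetric n M) (radial n Ω) y) ≤ (r₀ ^ 2)⁻¹

variable (n) in
/-- The metric `g_t` induced on the hypersurface at time `t`. -/
def flowMetric (Φ : ℝ → N → M) (t : ℝ) : MetricField (n - 1) N :=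
  inducedMetric (ambientMetric n M) (Φ t)

/-- The mean curvature of the hypersurface at time `t`. -/
def flowH (Φ : ℝ → N → M) (ν : ∀ t x, TangentSpace (𝓡 n) (Φ t x)) (t : ℝ) (x : N) : ℝ :=
  meanCurv (m := n - 1) (ambientMetric n M) (Φ t) (ν t) x

/-- A smooth family of (immersed) hypersurfaces `Σ_t`, with unit normal `ν` and `H > 0`, evolving
under the inverse mean curvature flow `∂_t Φ = ν / H`. The family is parametrized by an open subset
`U` of `ℝ × N`: `Σ_t` is the image under `Φ t` of the slice `{x | (t, x) ∈ U}`. Thus `U = J × N` is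
a flow of a fixed manifold, and a general `U` allows points to enter and leave the region. -/
structure IsSmoothIMCF (U : Set (ℝ × N)) (Φ : ℝ → N → M)
    (ν : ∀ t x, TangentSpace (𝓡 n) (Φ t x)) : Prop where
  isOpen : IsOpen U
  smooth : ContMDiffOn (𝓘(ℝ, ℝ).prod (𝓡 (n - 1))) (𝓡 n) ∞ (fun q : ℝ × N => Φ q.1 q.2) U
  smooth_normal : ContMDiffOn (𝓘(ℝ, ℝ).prod (𝓡 (n - 1))) (𝓡 n).tangent ∞
    (fun q : ℝ × N => (⟨Φ q.1 q.2, ν q.1 q.2⟩ : TangentBundle (𝓡 n) M)) U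
  immersion : ∀ t x, (t, x) ∈ U → Function.Injective (mfderiv (𝓡 (n - 1)) (𝓡 n) (Φ t) x)
  unit : ∀ t x, (t, x) ∈ U → ambientMetric n M (Φ t x) (ν t x) (ν t x) = 1
  normal : ∀ t x, (t, x) ∈ U → ∀ v : TangentSpace (𝓡 (n - 1)) x,
    ambientMetric n M (Φ t x) (ν t x) (mfderiv (𝓡 (n - 1)) (𝓡 n) (Φ t) x v) = 0
  meanConvex : ∀ t x, (t, x) ∈ U → 0 < flowH Φ ν t x
  evolution : ∀ t x, (t, x) ∈ U →
    mfderiv 𝓘(ℝ, ℝ) (𝓡 n) (fun s => Φ s x) t (1 : ℝ) = (flowH Φ ν t x)⁻¹ • ν t x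

/-- The heat operator `□ = ∂_t - H⁻² Δ_Σ` of the flow. -/
def box (Φ : ℝ → N → M) (ν : ∀ t x, TangentSpace (𝓡 n) (Φ t x)) (f : ℝ → N → ℝ)
    (t : ℝ) (x : N) : ℝ :=
  deriv (fun s => f s x) t - 1 / flowH Φ ν t x ^ 2 * laplacian (flowMetric n Φ t) (f t) x

variable (n) in
/-- `⟨∇_Σ f, X⟩` for a time-dependent tangent vector field `X` of the hypersurfaces. -/
def gradInner (Φ : ℝ → N → M) (f : ℝ → N → ℝ) (X : ℝ → VField (n - 1) N) (t : ℝ) (x : N) : ℝ :=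
  flowMetric n Φ t x (grad (flowMetric n Φ t) (f t) x) (X t x)

variable (n) in
/-- `X t` is a tangent vector field of the hypersurface at time `t`, smooth on the flow domain. -/
def IsSmoothTangent (U : Set (ℝ × N)) (X : ℝ → VField (n - 1) N) : Prop :=
  ContMDiffOn (𝓘(ℝ, ℝ).prod (𝓡 (n - 1))) (𝓡 (n - 1)).tangent ∞
    (fun q : ℝ × N => (⟨q.2, X q.1 q.2⟩ : TangentBundle (𝓡 (n - 1)) N)) U

/-- The function `p = ⟨ν, ∂_r⟩` on the flow. -/
def flowP (Ω : Set M) (Φ : ℝ → N → M) (ν : ∀ t x, TangentSpace (𝓡 n) (Φ t x))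
    (t : ℝ) (x : N) : ℝ :=
  ambientMetric n M (Φ t x) (ν t x) (radial n Ω (Φ t x))

/-- The function `r` restricted to the flow. -/
def flowR (Ω : Set M) (Φ : ℝ → N → M) (t : ℝ) (x : N) : ℝ := signedDist Ω (Φ t x)

variable (n) in
/-- `{Σ_t}` is a smooth solution of the inverse mean curvature flow inside the collar of the
smooth obstacle `∂Ω`, with `p ≥ 1/2` on all `Σ_t`. -/
structure IsObstacleFlow (Ω : Set M) (r₀ : ℝ) (U : Set (ℝ × N)) (Φ : ℝ → N → M)
    (ν : ∀ t x, TangentSpace (𝓡 n) (Φ t x)) : Prop where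
  obstacle : IsSmoothObstacle n Ω r₀
  flow : IsSmoothIMCF U Φ ν
  mem_collar : ∀ t x, (t, x) ∈ U → Φ t x ∈ collar Ω r₀
  half_le : ∀ t x, (t, x) ∈ U → 1 / 2 ≤ flowP Ω Φ ν t x

/-- `F = (1 - p) (b - r / r₀)^{-γ}`. -/
def flowF (Ω : Set M) (r₀ b γ : ℝ) (Φ : ℝ → N → M) (ν : ∀ t x, TangentSpace (𝓡 n) (Φ t x))
    (t : ℝ) (x : N) : ℝ :=
  (1 - flowP Ω Φ ν t x) * (b - flowR Ω Φ t x / r₀) ^ (-γ)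

/-- `G = r₀ H ((b - r / r₀)^{1 - γ} - (2 b)^{1 - γ})`. -/
def flowG (Ω : Set M) (r₀ b γ : ℝ) (Φ : ℝ → N → M) (ν : ∀ t x, TangentSpace (𝓡 n) (Φ t x))
    (t : ℝ) (x : N) : ℝ :=
  r₀ * flowH Φ ν t x * ((b - flowR Ω Φ t x / r₀) ^ (1 - γ) - (2 * b) ^ (1 - γ))

end Flow

end

end IMCF

open IMCF

set_option linter.unusedSectionVars false

/-! Both inequalities hold with `X = 0`, so each is a pointwise statement, proved by a computation
at one point. Write Y = ∂_r, N = n - 1, s = b - r/r₀, let A be the second fundamental form and Yᵀ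
the tangential part of Y. Three evolution equations carry everything (`boxE_P`, `boxE_R`, `boxE_H`):
H²□p = |A|²p - Ric(ν, Yᵀ) - 2⟨A, ∇Y⟩ - tr_Σ⟨ν, ∇²Y⟩ + 2H⟨ν, ∇_ν Y⟩, H²□r = 2Hp - tr_Σ ∇Y, □H =
-2|∇H|²/H³ - |A|²/H - Ric(ν, ν)/H. In the first, the derivatives of H cancel: along the flow ∂_t ν =
∇H/H², while Δν also contains ∇H.

For F, the bound p ≥ 1/2 makes |A|²p a good term worth |A|²/2, which absorbs everything linear in A,
including H itself, since H² ≤ N|A|². This also covers the cross term of the product rule, because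
∇p is expressed through A and ∇Y; no gradient term has to be moved into X. What remains to be beaten
is quadratic in γ(1 - p)/s, and it is beaten by the second derivative of s^(-γ), which enters with
|Yᵀ|² = (1 - p)(1 + p) ≥ (3/2)(1 - p) and is larger by a factor 1/γ; hence γ is a small multiple of
1/N (`reaction_F_le`). After multiplication by (1 - p)^(2/γ - 1) all terms are controlled by powers
of x = (1 - p)^(1/γ)/s, and F = x^γ (`power_F_le`).

For G, the term -2|∇H|²/H³ absorbs the cross term by completing a square (`cross_term_le`), the term
-|A|²/H gives -G/n, and the derivative of η along 2Hp gives the negative multiple of s^(-γ). The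
errors are of the form s^(-γ) times a constant over G, because |Yᵀ|² ≤ 2(1 - p) and (1 - p)s^(-γ) is
bounded by assumption (`reaction_G_le`).

The identity |Yᵀ|² + p² = 1 requires |∇r| = 1. Since M need not be complete, there are no minimizing
geodesics to use; `norm_grad_le_one` follows coordinate lines, and `one_le_norm_grad` follows an
almost minimizing path until it leaves a small ball.

The evolution equations are derived in coordinates (`CoreFlow`), with constant coordinate directions
chosen orthonormal at the single point of interest. They commute, so no frame field has to be
differentiated; the price is the correction by the tangential part of D_i ∂_i f in `lapE`. The link
with the intrinsic definitions is made in the charts centred at x and at Φ t x (`exists_localFlow`):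
Koszul's formula gives the connection in a chart (`kap_leviCivita`), curvature and second covariant
derivatives are read off at the centre, where extended vectors have constant coordinates, and
`kap_covAlong` handles the mean curvature at the neighbouring points. -/

namespace IMCF

noncomputable section

/-! ### Calculus of directional derivatives of smooth maps -/

section DirectionalDerivative

variable {P E A B C F : Type*} [NormedAddCommGroup P] [NormedSpace ℝ P]
  [NormedAddCommGroup E] [NormedSpace ℝ E] [NormedAddCommGroup A] [NormedSpace ℝ A]
  [NormedAddCommGroup B] [NormedSpace ℝ B] [NormedAddCommGroup C] [NormedSpace ℝ C]
  [NormedAddCommGroup F] [NormedSpace ℝ F]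

/-- The directional derivative of `u` in the constant direction `a`. -/
def dd (a : P) (u : P → F) : P → F := fun p => fderiv ℝ u p a

/-- `u` is smooth at every point of `O`. -/
def Sm (O : Set P) (u : P → F) : Prop := ∀ p ∈ O, ContDiffAt ℝ ∞ u p

variable {O : Set P} {a b : P}

lemma Sm.diff {u : P → F} (hu : Sm O u) {p : P} (hp : p ∈ O) : DifferentiableAt ℝ u p :=
  (hu p hp).differentiableAt (by simp)

lemma Sm.fderiv {u : P → F} (hu : Sm O u) : Sm O (fderiv ℝ u) := fun p hp =>
  (hu p hp).fderiv_right (by simp)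

lemma Sm.dd {u : P → F} (hu : Sm O u) (a : P) : Sm O (dd a u) := fun p hp =>
  (hu.fderiv p hp).clm_apply contDiffAt_const

lemma Sm.comp {V : Set E} {T : E → F} {f : P → E} (hT : Sm V T) (hf : Sm O f)
    (hV : ∀ p ∈ O, f p ∈ V) : Sm O (fun p => T (f p)) := fun p hp =>
  ContDiffAt.comp p (hT _ (hV p hp)) (hf p hp)

lemma Sm.clm_apply {T : P → A →L[ℝ] F} {u : P → A} (hT : Sm O T) (hu : Sm O u) :
    Sm O (fun p => T p (u p)) := fun p hp => (hT p hp).clm_apply (hu p hp)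

lemma Sm.add {u v : P → F} (hu : Sm O u) (hv : Sm O v) : Sm O (fun p => u p + v p) :=
  fun p hp => (hu p hp).add (hv p hp)

lemma Sm.sub {u v : P → F} (hu : Sm O u) (hv : Sm O v) : Sm O (fun p => u p - v p) :=
  fun p hp => (hu p hp).sub (hv p hp)

lemma Sm.mul {u v : P → ℝ} (hu : Sm O u) (hv : Sm O v) : Sm O (fun p => u p * v p) :=
  fun p hp => (hu p hp).mul (hv p hp)

lemma Sm.inv {u : P → ℝ} (hu : Sm O u) (h : ∀ p ∈ O, u p ≠ 0) : Sm O (fun p => (u p)⁻¹) :=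
  fun p hp => (hu p hp).inv (h p hp)

lemma Sm.smul {u : P → ℝ} {v : P → F} (hu : Sm O u) (hv : Sm O v) : Sm O (fun p => u p • v p) :=
  fun p hp => (hu p hp).smul (hv p hp)

lemma Sm.sum {κ : Type*} {s : Finset κ} {u : κ → P → F} (hu : ∀ k ∈ s, Sm O (u k)) :
    Sm O (fun p => ∑ k ∈ s, u k p) :=
  fun p hp => ContDiffAt.sum fun k hk => hu k hk p hp

lemma Sm.congr {u v : P → F} (hO : IsOpen O) (hu : Sm O u) (h : ∀ p ∈ O, v p = u p) : Sm O v :=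
  fun p hp => (hu p hp).congr_of_eventuallyEq (Filter.eventuallyEq_of_mem (hO.mem_nhds hp) h)

lemma Sm.mono {O' : Set P} {u : P → F} (hu : Sm O u) (h : O' ⊆ O) : Sm O' u :=
  fun p hp => hu p (h hp)

lemma dd_congr (hO : IsOpen O) {u v : P → F} (h : ∀ p ∈ O, u p = v p) {p : P} (hp : p ∈ O) :
    dd a u p = dd a v p := by
  unfold dd
  rw [Filter.EventuallyEq.fderiv_eq (Filter.eventuallyEq_of_mem (hO.mem_nhds hp) h)]

lemma dd_add {u v : P → F} {p : P} (hu : DifferentiableAt ℝ u p) (hv : DifferentiableAt ℝ v p) :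
    dd a (fun p => u p + v p) p = dd a u p + dd a v p := by
  unfold dd; rw [fderiv_fun_add hu hv]; rfl

lemma dd_sub {u v : P → F} {p : P} (hu : DifferentiableAt ℝ u p) (hv : DifferentiableAt ℝ v p) :
    dd a (fun p => u p - v p) p = dd a u p - dd a v p := by
  unfold dd; rw [fderiv_fun_sub hu hv]; rfl

lemma dd_neg {u : P → F} {p : P} : dd a (fun p => - u p) p = - dd a u p := by
  unfold dd; rw [fderiv_fun_neg]; rfl

lemma dd_const (c : F) (p : P) : dd a (fun _ => c) p = 0 := by
  unfold dd; simp

lemma dd_smul {u : P → ℝ} {v : P → F} {p : P} (hu : DifferentiableAt ℝ u p)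
    (hv : DifferentiableAt ℝ v p) :
    dd a (fun p => u p • v p) p = dd a u p • v p + u p • dd a v p := by
  unfold dd; rw [fderiv_fun_smul hu hv]; simp [add_comm]

lemma dd_mul {u v : P → ℝ} {p : P} (hu : DifferentiableAt ℝ u p)
    (hv : DifferentiableAt ℝ v p) :
    dd a (fun p => u p * v p) p = dd a u p * v p + u p * dd a v p := by
  unfold dd; rw [fderiv_fun_mul hu hv]; simp; ring

lemma dd_sum {κ : Type*} {s : Finset κ} {u : κ → P → F} {p : P}
    (hu : ∀ k ∈ s, DifferentiableAt ℝ (u k) p) :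
    dd a (fun p => ∑ k ∈ s, u k p) p = ∑ k ∈ s, dd a (u k) p := by
  unfold dd; rw [fderiv_fun_sum hu]; simp

lemma dd_comp {T : E → F} {f : P → E} {p : P} (hT : DifferentiableAt ℝ T (f p))
    (hf : DifferentiableAt ℝ f p) : dd a (fun p => T (f p)) p = fderiv ℝ T (f p) (dd a f p) := by
  unfold dd
  rw [show (fun p => T (f p)) = T ∘ f from rfl, fderiv_comp p hT hf]; rfl

lemma dd_inv {u : P → ℝ} {p : P} (hu : DifferentiableAt ℝ u p) (h : u p ≠ 0) :
    dd a (fun p => (u p)⁻¹) p = - dd a u p / u p ^ 2 := by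
  rw [dd_comp (T := fun x : ℝ => x⁻¹) (differentiableAt_inv h) hu, fderiv_inv]
  simp [div_eq_mul_inv]

lemma dd_clm_apply {T : P → A →L[ℝ] F} {u : P → A} {p : P} (hT : DifferentiableAt ℝ T p)
    (hu : DifferentiableAt ℝ u p) :
    dd a (fun p => T p (u p)) p = dd a T p (u p) + T p (dd a u p) := by
  unfold dd; rw [fderiv_clm_apply hT hu]; simp [add_comm]

lemma dd_comp_apply {T : E → A →L[ℝ] F} {f : P → E} {u : P → A} {p : P}
    (hT : DifferentiableAt ℝ T (f p)) (hf : DifferentiableAt ℝ f p) (hu : DifferentiableAt ℝ u p) :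
    dd a (fun p => T (f p) (u p)) p = fderiv ℝ T (f p) (dd a f p) (u p) + T (f p) (dd a u p) := by
  rw [dd_clm_apply (T := fun p => T (f p)) (hT.comp p hf) hu, dd_comp hT hf]

set_option synthInstance.maxHeartbeats 100000 in
lemma dd_comp_apply₂ {T : E → A →L[ℝ] B →L[ℝ] F} {f : P → E} {u : P → A} {v : P → B} {p : P}
    (hT : DifferentiableAt ℝ T (f p)) (hf : DifferentiableAt ℝ f p) (hu : DifferentiableAt ℝ u p)
    (hv : DifferentiableAt ℝ v p) :
    dd a (fun p => T (f p) (u p) (v p)) p = fderiv ℝ T (f p) (dd a f p) (u p) (v p)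
      + T (f p) (dd a u p) (v p) + T (f p) (u p) (dd a v p) := by
  rw [dd_clm_apply (T := fun p => T (f p) (u p)) ((hT.comp p hf).clm_apply hu) hv,
    dd_comp_apply hT hf hu]
  simp

lemma dd_comm {u : P → F} (hu : Sm O u) {p : P} (hp : p ∈ O) :
    dd a (dd b u) p = dd b (dd a u) p := by
  have h2 : IsSymmSndFDerivAt ℝ u p := (hu p hp).isSymmSndFDerivAt (by simpa using ENat.LEInfty.out)
  have key : ∀ a b : P, dd a (dd b u) p = fderiv ℝ (fderiv ℝ u) p a b := fun a b => by
    have := dd_clm_apply (a := a) (T := fderiv ℝ u) (u := fun _ => b) (hu.fderiv.diff hp)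
      (differentiableAt_const _)
    rw [dd_const, map_zero, add_zero] at this
    exact this
  rw [key, key]; exact h2 a b

end DirectionalDerivative

/-! ### Levi-Civita connections and covariant derivatives along maps, in coordinates -/

section Connection

variable {P E : Type*} [NormedAddCommGroup P] [NormedSpace ℝ P]
  [NormedAddCommGroup E] [NormedSpace ℝ E]

/-- `Γ` is the Christoffel symbol of the Levi-Civita connection of the metric `G` on the open
set `V` of a vector space. -/
structure IsLC (V : Set E) (G : E → E →L[ℝ] E →L[ℝ] ℝ) (Γ : E → E →L[ℝ] E →L[ℝ] E) : Prop where
  isOpen : IsOpen V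
  smG : Sm V G
  smΓ : Sm V Γ
  symmG : ∀ z ∈ V, ∀ u v, G z u v = G z v u
  symmΓ : ∀ z ∈ V, ∀ u v, Γ z u v = Γ z v u
  compat : ∀ z ∈ V, ∀ u v w, fderiv ℝ G z u v w = G z (Γ z u v) w + G z v (Γ z u w)

/-- The covariant derivative of the vector field `V` along the map `f`. -/
def covD (Γ : E → E →L[ℝ] E →L[ℝ] E) (f : P → E) (a : P) (V : P → E) : P → E :=
  fun p => dd a V p + Γ (f p) (dd a f p) (V p)

/-- The curvature tensor in terms of Christoffel symbols. -/
def Rm (Γ : E → E →L[ℝ] E →L[ℝ] E) (z u v w : E) : E :=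
  fderiv ℝ Γ z u v w - fderiv ℝ Γ z v u w + Γ z u (Γ z v w) - Γ z v (Γ z u w)

/-- The covariant derivative of a vector field. -/
def nab (Γ : E → E →L[ℝ] E →L[ℝ] E) (Y : E → E) (z : E) : E →L[ℝ] E :=
  fderiv ℝ Y z + (Γ z).flip (Y z)

lemma nab_apply (Γ : E → E →L[ℝ] E →L[ℝ] E) (Y : E → E) (z u : E) :
    nab Γ Y z u = fderiv ℝ Y z u + Γ z u (Y z) := rfl

/-- The second covariant derivative of a vector field. -/
def nab2 (Γ : E → E →L[ℝ] E →L[ℝ] E) (Y : E → E) (z u v : E) : E :=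
  fderiv ℝ (nab Γ Y) z u v + Γ z u (nab Γ Y z v) - nab Γ Y z (Γ z u v)

set_option synthInstance.maxHeartbeats 200000 in
lemma Rm_smul_left (Γ : E → E →L[ℝ] E →L[ℝ] E) (c : ℝ) (z u v w : E) :
    Rm Γ z (c • u) v w = c • Rm Γ z u v w := by
  simp only [Rm, map_smul, smul_apply, smul_sub, smul_add]

lemma Rm_antisymm (Γ : E → E →L[ℝ] E →L[ℝ] E) (z u v w : E) :
    Rm Γ z u v w = - Rm Γ z v u w := by
  simp only [Rm]; abel

variable {V : Set E} {G : E → E →L[ℝ] E →L[ℝ] ℝ} {Γ : E → E →L[ℝ] E →L[ℝ] E}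
  {O : Set P} {f : P → E} {X Y : P → E} {Z : E → E} {a b : P} {p : P}

lemma IsLC.sm_covD (h : IsLC V G Γ) (hf : Sm O f) (hV : ∀ p ∈ O, f p ∈ V) (hX : Sm O X) (a : P) :
    Sm O (covD Γ f a X) :=
  (hX.dd a).add (((h.smΓ.comp hf hV).clm_apply (hf.dd a)).clm_apply hX)

lemma IsLC.sm_ip (h : IsLC V G Γ) (hf : Sm O f) (hV : ∀ p ∈ O, f p ∈ V) (hX : Sm O X)
    (hY : Sm O Y) : Sm O (fun p => G (f p) (X p) (Y p)) :=
  ((h.smG.comp hf hV).clm_apply hX).clm_apply hY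

lemma IsLC.sm_nab (h : IsLC V G Γ) (hZ : Sm V Z) : Sm V (nab Γ Z) := by
  refine hZ.fderiv.add (Sm.clm_apply (T := fun z => (Γ z).flip) ?_ hZ)
  intro z hz
  exact (ContinuousLinearMap.flipₗᵢ ℝ E E E).contDiff.contDiffAt.comp z (h.smΓ z hz)

lemma IsLC.dd_ip (h : IsLC V G Γ) (hV : f p ∈ V) (hf : DifferentiableAt ℝ f p)
    (hX : DifferentiableAt ℝ X p) (hY : DifferentiableAt ℝ Y p) :
    dd a (fun p => G (f p) (X p) (Y p)) p
      = G (f p) (covD Γ f a X p) (Y p) + G (f p) (X p) (covD Γ f a Y p) := by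
  rw [dd_comp_apply₂ (h.smG.diff hV) hf hX hY, h.compat _ hV]
  simp only [covD, map_add, add_apply]
  ring

/-- Mixed partial derivatives of `f` commute and `Γ` is symmetric. -/
lemma IsLC.torsion (h : IsLC V G Γ) (hf : Sm O f) (hV : ∀ p ∈ O, f p ∈ V) (hp : p ∈ O) :
    covD Γ f a (dd b f) p = covD Γ f b (dd a f) p := by
  simp only [covD]
  rw [dd_comm hf hp, h.symmΓ _ (hV p hp)]

/-- Expanding both orders by the chain rule, the second derivatives of `X` and `f` are symmetric and
cancel; only derivatives and products of `Γ`, that is `Rm`, survive. -/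
lemma IsLC.curvature (h : IsLC V G Γ) (hf : Sm O f) (hV : ∀ p ∈ O, f p ∈ V) (hX : Sm O X)
    (hp : p ∈ O) : covD Γ f a (covD Γ f b X) p = covD Γ f b (covD Γ f a X) p
      + Rm Γ (f p) (dd a f p) (dd b f p) (X p) := by
  have key : ∀ a b : P, covD Γ f a (covD Γ f b X) p = dd a (dd b X) p
      + (fderiv ℝ Γ (f p) (dd a f p) (dd b f p) (X p) + Γ (f p) (dd a (dd b f) p) (X p)
        + Γ (f p) (dd b f p) (dd a X p))
      + Γ (f p) (dd a f p) (dd b X p + Γ (f p) (dd b f p) (X p)) := fun a b => by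
    unfold covD
    rw [dd_add ((hX.dd b).diff hp)
      ((((h.smΓ.comp hf hV).clm_apply (hf.dd b)).clm_apply hX).diff hp),
      dd_comp_apply₂ (h.smΓ.diff (hV p hp)) (hf.diff hp) ((hf.dd b).diff hp) (hX.diff hp)]
  rw [key, key, dd_comm hX hp (a := a), dd_comm hf hp (a := a), Rm]
  simp only [map_add]
  abel

lemma covD_smul {s : P → ℝ} (hs : DifferentiableAt ℝ s p) (hX : DifferentiableAt ℝ X p) :
    covD Γ f a (fun p => s p • X p) p = dd a s p • X p + s p • covD Γ f a X p := by
  simp only [covD]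
  rw [dd_smul hs hX]
  simp only [map_smul, smul_add]
  abel

lemma covD_sum {κ : Type*} {s : Finset κ} {X : κ → P → E}
    (hX : ∀ k ∈ s, DifferentiableAt ℝ (X k) p) :
    covD Γ f a (fun p => ∑ k ∈ s, X k p) p = ∑ k ∈ s, covD Γ f a (X k) p := by
  simp only [covD]
  rw [dd_sum hX, map_sum, Finset.sum_add_distrib]

lemma covD_congr (hO : IsOpen O) (h : ∀ p ∈ O, X p = Y p) (hp : p ∈ O) :
    covD Γ f a X p = covD Γ f a Y p := by
  simp only [covD]
  rw [dd_congr hO h hp, h p hp]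

lemma covD_comp (hZ : DifferentiableAt ℝ Z (f p)) (hf : DifferentiableAt ℝ f p) :
    covD Γ f a (fun p => Z (f p)) p = nab Γ Z (f p) (dd a f p) := by
  simp only [covD, nab_apply]
  rw [dd_comp hZ hf]

lemma IsLC.covD_nab (h : IsLC V G Γ) (hZ : Sm V Z) (hV : f p ∈ V) (hf : DifferentiableAt ℝ f p)
    (hX : DifferentiableAt ℝ X p) :
    covD Γ f a (fun p => nab Γ Z (f p) (X p)) p
      = nab2 Γ Z (f p) (dd a f p) (X p) + nab Γ Z (f p) (covD Γ f a X p) := by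
  simp only [covD, nab2]
  rw [dd_comp_apply ((h.sm_nab hZ).diff hV) hf hX]
  simp only [map_add]
  abel

/-- Two derivatives of z ↦ |w|² for constant `w` commute; written out by metric compatibility, their
commutator is twice this expression. With `w = ν` it allows the normal summand to be dropped from a
Ricci trace, so that traces over the hypersurface become Ricci curvatures. -/
lemma IsLC.Rm_self (h : IsLC V G Γ) {z : E} (hz : z ∈ V) (u v w : E) :
    G z (Rm Γ z u v w) w = 0 := by
  have hG := h.smG
  have key : ∀ u v : E, dd u (dd v G) z w w
      = 2 * (G z (Γ z u (Γ z v w)) w + G z (Γ z v w) (Γ z u w)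
        + G z (fderiv ℝ Γ z u v w) w) := fun u v => by
    have e1 : dd u (fun z => fderiv ℝ G z v w w) z = dd u (dd v G) z w w := by
      rw [dd_clm_apply (T := fun z => fderiv ℝ G z v w)
        (((hG.dd v).diff hz).clm_apply (differentiableAt_const _)) (differentiableAt_const _),
        dd_clm_apply (T := fun z => fderiv ℝ G z v) ((hG.dd v).diff hz)
          (differentiableAt_const _), dd_const]
      simp
      rfl
    have e2 : dd u (fun z => fderiv ℝ G z v w w) z
        = dd u (fun z => 2 * G z (Γ z v w) w) z := by
      refine dd_congr h.isOpen (fun y hy => ?_) hz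
      rw [h.compat y hy, h.symmG y hy w]; ring
    have hid : DifferentiableAt ℝ (fun z : E => z) z := differentiableAt_id
    have hΓ : DifferentiableAt ℝ (fun z => Γ z v w) z :=
      ((h.smΓ.diff hz).clm_apply (differentiableAt_const _)).clm_apply (differentiableAt_const _)
    have did : dd u (fun z : E => z) z = u := by simp [dd]
    rw [← e1, e2, dd_mul (differentiableAt_const _)
      (((hG.diff hz).clm_apply hΓ).clm_apply (differentiableAt_const _)), dd_const,
      dd_comp_apply₂ (T := G) (f := fun z => z) (hG.diff hz) hid hΓ (differentiableAt_const _),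
      dd_comp_apply₂ (T := Γ) (f := fun z => z) (h.smΓ.diff hz) hid (differentiableAt_const _)
        (differentiableAt_const _), did, dd_const, dd_const, h.compat z hz]
    simp
  have h1 := key u v
  rw [dd_comm hG hz, key v u] at h1
  simp only [Rm, map_add, map_sub, add_apply, sub_apply]
  rw [h.symmG z hz (Γ z u w)] at h1
  linarith

end Connection

/-! ### Evolution equations of the inverse mean curvature flow at one point -/

section CoreFlow

variable {P E : Type*} [NormedAddCommGroup P] [NormedSpace ℝ P]
  [NormedAddCommGroup E] [NormedSpace ℝ E] {ι : Type*} [Fintype ι] [DecidableEq ι]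

/-- An inverse mean curvature flow `f` in coordinates: `e i` are the coordinate directions of the
hypersurfaces, `τ` is the time direction, and `S k j` are the entries of the shape operator. -/
structure CoreFlow (V : Set E) (G : E → E →L[ℝ] E →L[ℝ] ℝ) (Γ : E → E →L[ℝ] E →L[ℝ] E)
    (O : Set P) (f ν : P → E) (e : ι → P) (τ : P) (S : ι → ι → P → ℝ) (H : P → ℝ) : Prop where
  lc : IsLC V G Γ
  isOpen : IsOpen O
  smf : Sm O f
  smν : Sm O ν
  smS : ∀ k j, Sm O (S k j)
  mem : ∀ p ∈ O, f p ∈ V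
  weingarten : ∀ p ∈ O, ∀ j, covD Γ f (e j) ν p = ∑ k, S k j p • dd (e k) f p
  unit : ∀ p ∈ O, G (f p) (ν p) (ν p) = 1
  normal : ∀ p ∈ O, ∀ j, G (f p) (ν p) (dd (e j) f p) = 0
  trace : ∀ p ∈ O, H p = ∑ k, S k k p
  pos : ∀ p ∈ O, 0 < H p
  evol : ∀ p ∈ O, dd τ f p = (H p)⁻¹ • ν p

/-- `f` is orthonormal at `p` in the directions `e`, and together with the unit normal `ν` the
vectors `∂_i f` span. -/
structure OrthoAt (G : E → E →L[ℝ] E →L[ℝ] ℝ) (f ν : P → E) (e : ι → P) (p : P) : Prop where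
  ortho : ∀ i j, G (f p) (dd (e i) f p) (dd (e j) f p) = if i = j then 1 else 0
  span : ∀ v, v = ∑ i, G (f p) (dd (e i) f p) v • dd (e i) f p + G (f p) (ν p) v • ν p

variable {V : Set E} {G : E → E →L[ℝ] E →L[ℝ] ℝ} {Γ : E → E →L[ℝ] E →L[ℝ] E}
  {O : Set P} {f ν : P → E} {e : ι → P} {τ : P} {S : ι → ι → P → ℝ} {H : P → ℝ} {p : P}
  {Y : E → E}

namespace CoreFlow

variable (h : CoreFlow V G Γ O f ν e τ S H)
include h

lemma smH : Sm O H := (Sm.sum fun k _ => h.smS k k).congr h.isOpen h.trace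

lemma smDν (a : P) : Sm O (covD Γ f a ν) := h.lc.sm_covD h.smf h.mem h.smν a

lemma ne_zero (hp : p ∈ O) : H p ≠ 0 := (h.pos p hp).ne'

lemma ip_Dν_ν (a : P) (hp : p ∈ O) : G (f p) (covD Γ f a ν p) (ν p) = 0 := by
  have h1 := h.lc.dd_ip (a := a) (h.mem p hp) (h.smf.diff hp) (h.smν.diff hp) (h.smν.diff hp)
  rw [dd_congr h.isOpen h.unit hp, dd_const, h.lc.symmG _ (h.mem p hp) (ν p)] at h1
  linarith

/-- The derivative of ⟨ν, ∂_j f⟩ = 0: this exchanges a derivative of the normal for the normal part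
of a derivative of a tangent vector, and, with torsion-freeness, makes the second fundamental form
symmetric. -/
lemma ip_Dν (a : P) (j : ι) (hp : p ∈ O) : G (f p) (covD Γ f a ν p) (dd (e j) f p)
    = - G (f p) (ν p) (covD Γ f a (dd (e j) f) p) := by
  have h1 := h.lc.dd_ip (a := a) (h.mem p hp) (h.smf.diff hp) (h.smν.diff hp)
    ((h.smf.dd (e j)).diff hp)
  rw [dd_congr h.isOpen (fun p hp => h.normal p hp j) hp, dd_const] at h1
  linarith

lemma secondFF_symm (i j : ι) (hp : p ∈ O) : G (f p) (covD Γ f (e i) ν p) (dd (e j) f p)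
    = G (f p) (covD Γ f (e j) ν p) (dd (e i) f p) := by
  rw [h.ip_Dν _ _ hp, h.ip_Dν _ _ hp, h.lc.torsion h.smf h.mem hp]

lemma ip_DDν_ν (a b : P) (hp : p ∈ O) : G (f p) (covD Γ f a (covD Γ f b ν) p) (ν p)
    = - G (f p) (covD Γ f b ν p) (covD Γ f a ν p) := by
  have h1 := h.lc.dd_ip (a := a) (h.mem p hp) (h.smf.diff hp) ((h.smDν b).diff hp)
    (h.smν.diff hp)
  rw [dd_congr h.isOpen (fun p hp => h.ip_Dν_ν b hp) hp, dd_const] at h1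
  linarith

lemma dd_ip_Dν (a b : P) (j : ι) (hp : p ∈ O) :
    dd a (fun p => G (f p) (covD Γ f b ν p) (dd (e j) f p)) p
      = G (f p) (covD Γ f a (covD Γ f b ν) p) (dd (e j) f p)
        + G (f p) (covD Γ f b ν p) (covD Γ f a (dd (e j) f) p) :=
  h.lc.dd_ip (h.mem p hp) (h.smf.diff hp) ((h.smDν b).diff hp) ((h.smf.dd (e j)).diff hp)

/-- `D_t ∂_i f = D_i (ν / H)`. -/
lemma covD_time_dd (i : ι) (hp : p ∈ O) :
    covD Γ f τ (dd (e i) f) p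
      = dd (e i) (fun p => (H p)⁻¹) p • ν p + (H p)⁻¹ • covD Γ f (e i) ν p := by
  rw [h.lc.torsion h.smf h.mem hp, covD_congr h.isOpen h.evol hp,
    covD_smul ((h.smH.inv fun p hp => h.ne_zero hp).diff hp) (h.smν.diff hp)]

/-- The normal part of D_t ∂_i f = D_i(ν/H) is ∂_i(1/H), and ν stays orthogonal to ∂_i f. Thus D_t ν
is the tangential gradient of -1/H, that is ∇H/H². -/
lemma ip_Dtν (i : ι) (hp : p ∈ O) :
    G (f p) (covD Γ f τ ν p) (dd (e i) f p) = - dd (e i) (fun p => (H p)⁻¹) p := by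
  rw [h.ip_Dν _ _ hp, h.covD_time_dd i hp]
  simp only [map_add, map_smul, h.unit p hp, smul_eq_mul, mul_one]
  rw [h.lc.symmG _ (h.mem p hp), h.ip_Dν_ν _ hp]
  ring

section Point

variable (ho : OrthoAt G f ν e p) (hp : p ∈ O)
include ho hp

lemma ip_expand (u v : E) : G (f p) u v
    = ∑ i, G (f p) (dd (e i) f p) u * G (f p) (dd (e i) f p) v
      + G (f p) (ν p) u * G (f p) (ν p) v := by
  conv_lhs => rw [ho.span v]
  simp only [map_add, map_sum, map_smul, smul_eq_mul]
  rw [h.lc.symmG _ (h.mem p hp) u (ν p)]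
  congr 1
  · exact Finset.sum_congr rfl fun i _ => by rw [h.lc.symmG _ (h.mem p hp) u]; ring
  · ring

lemma shape_eq (k j : ι) : G (f p) (dd (e k) f p) (covD Γ f (e j) ν p) = S k j p := by
  rw [h.weingarten p hp]
  simp [map_sum, ho.ortho]

lemma shape_symm (k j : ι) : S k j p = S j k p := by
  rw [← h.shape_eq ho hp, ← h.shape_eq ho hp, h.lc.symmG _ (h.mem p hp), h.secondFF_symm j k hp,
    h.lc.symmG _ (h.mem p hp)]

/-- Differentiate the Weingarten equation D_i ν = ∑ S_ki ∂_k f and pair it with ∂_i f. Since H is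
the trace of the mixed entries of the shape operator, no inverse metric has to be differentiated. -/
lemma dd_H (a : P) : dd a H p = ∑ i, G (f p) (dd (e i) f p) (covD Γ f a (covD Γ f (e i) ν) p)
    - ∑ i, ∑ k, S k i p * G (f p) (dd (e i) f p) (covD Γ f a (dd (e k) f) p) := by
  rw [dd_congr h.isOpen h.trace hp, dd_sum fun k _ => (h.smS k k).diff hp,
    ← Finset.sum_sub_distrib]
  refine Finset.sum_congr rfl fun i _ => ?_
  rw [covD_congr h.isOpen (fun p hp => h.weingarten p hp i) hp,
    covD_sum fun k _ => ((h.smS k i).smul (h.smf.dd (e k))).diff hp]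
  rw [Finset.sum_congr rfl fun k _ => covD_smul ((h.smS k i).diff hp) ((h.smf.dd (e k)).diff hp)]
  simp [map_sum, ho.ortho, Finset.sum_add_distrib]

/-- The traced Codazzi equation. -/
lemma codazzi (l : ι) :
    ∑ i, (G (f p) (dd (e l) f p) (covD Γ f (e i) (covD Γ f (e i) ν) p)
      - ∑ k, G (f p) (dd (e k) f p) (covD Γ f (e i) (dd (e i) f) p)
          * G (f p) (dd (e l) f p) (covD Γ f (e k) ν p))
    = dd (e l) H p + ∑ i, G (f p) (dd (e i) f p)
        (Rm Γ (f p) (dd (e i) f p) (dd (e l) f p) (ν p)) := by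
  have sG := h.lc.symmG _ (h.mem p hp)
  rw [h.dd_H ho hp, Finset.sum_comm (f := fun i k => S k i p * _), sub_add_eq_add_sub,
    ← Finset.sum_add_distrib, ← Finset.sum_sub_distrib]
  refine Finset.sum_congr rfl fun i _ => ?_
  -- The symmetric second fundamental form is differentiated along `e i` in both of its forms (`c2`,
  -- `c3`); commuting D_i and D_l on ν produces the curvature term.
  have c1 := h.lc.curvature (a := e i) (b := e l) h.smf h.mem h.smν hp
  have c2 := h.dd_ip_Dν (e i) (e l) i hp
  have c3 := h.dd_ip_Dν (e i) (e i) l hp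
  rw [dd_congr h.isOpen (fun p hp => h.secondFF_symm l i hp) hp, c3, c1] at c2
  have c4 : G (f p) (covD Γ f (e i) ν p) (covD Γ f (e i) (dd (e l) f) p)
      = ∑ k, S i k p * G (f p) (dd (e k) f p) (covD Γ f (e l) (dd (e i) f) p) := by
    rw [h.ip_expand ho hp, sG (ν p), h.ip_Dν_ν _ hp, zero_mul, add_zero]
    refine Finset.sum_congr rfl fun k _ => ?_
    rw [h.shape_eq ho hp, h.shape_symm ho hp, h.lc.torsion h.smf h.mem hp]
  have c5 : G (f p) (covD Γ f (e l) ν p) (covD Γ f (e i) (dd (e i) f) p)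
      = ∑ k, G (f p) (dd (e k) f p) (covD Γ f (e i) (dd (e i) f) p)
          * G (f p) (dd (e l) f p) (covD Γ f (e k) ν p) := by
    rw [h.ip_expand ho hp, sG (ν p), h.ip_Dν_ν _ hp, zero_mul, add_zero]
    refine Finset.sum_congr rfl fun k _ => ?_
    rw [h.shape_eq ho hp, h.shape_symm ho hp, h.shape_eq ho hp, mul_comm]
  rw [← c4, ← c5, sG (dd (e l) f p), sG (dd (e i) f p), sG (dd (e i) f p)]
  simp only [map_add, add_apply] at c2
  linarith

/-- The Laplacian of `u` along the hypersurface at `p`, in orthonormal directions `e`. -/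
def _root_.IMCF.lapE (G : E → E →L[ℝ] E →L[ℝ] ℝ) (Γ : E → E →L[ℝ] E →L[ℝ] E) (f : P → E)
    (e : ι → P) (u : P → ℝ) (p : P) : ℝ :=
  ∑ i, (dd (e i) (dd (e i) u) p
    - ∑ k, G (f p) (dd (e k) f p) (covD Γ f (e i) (dd (e i) f) p) * dd (e k) u p)

/-- `Δν = ∇H + Ric(ν, ·)ᵀ - |A|² ν`, paired with an arbitrary vector. -/
lemma lap_normal (y : E) :
    ∑ i, (G (f p) (covD Γ f (e i) (covD Γ f (e i) ν) p) y
      - ∑ k, G (f p) (dd (e k) f p) (covD Γ f (e i) (dd (e i) f) p)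
          * G (f p) (covD Γ f (e k) ν p) y)
    = ∑ l, (dd (e l) H p + ∑ i, G (f p) (dd (e i) f p)
        (Rm Γ (f p) (dd (e i) f p) (dd (e l) f p) (ν p))) * G (f p) (dd (e l) f p) y
      - (∑ i, ∑ k, S k i p ^ 2) * G (f p) (ν p) y := by
  have sG := h.lc.symmG _ (h.mem p hp)
  have e1 : ∀ i, G (f p) (covD Γ f (e i) (covD Γ f (e i) ν) p) y
      - ∑ k, G (f p) (dd (e k) f p) (covD Γ f (e i) (dd (e i) f) p)
          * G (f p) (covD Γ f (e k) ν p) y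
      = ∑ l, (G (f p) (dd (e l) f p) (covD Γ f (e i) (covD Γ f (e i) ν) p)
        - ∑ k, G (f p) (dd (e k) f p) (covD Γ f (e i) (dd (e i) f) p)
          * G (f p) (dd (e l) f p) (covD Γ f (e k) ν p)) * G (f p) (dd (e l) f p) y
        - (∑ k, S k i p ^ 2) * G (f p) (ν p) y := fun i => by
    -- The tangential components of the Laplacian of ν come from `codazzi`; the normal one is `e3`,
    -- and equals -|A|² because |ν| = 1 has been differentiated twice.
    have e2 : ∑ k, G (f p) (dd (e k) f p) (covD Γ f (e i) (dd (e i) f) p)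
          * G (f p) (covD Γ f (e k) ν p) y
        = ∑ l, (∑ k, G (f p) (dd (e k) f p) (covD Γ f (e i) (dd (e i) f) p)
          * G (f p) (dd (e l) f p) (covD Γ f (e k) ν p)) * G (f p) (dd (e l) f p) y := by
      simp_rw [Finset.sum_mul]
      rw [Finset.sum_comm]
      refine Finset.sum_congr rfl fun k _ => ?_
      rw [h.ip_expand ho hp _ y, sG (ν p), h.ip_Dν_ν _ hp, zero_mul, add_zero, Finset.mul_sum]
      exact Finset.sum_congr rfl fun l _ => by ring
    have e3 : G (f p) (covD Γ f (e i) ν p) (covD Γ f (e i) ν p) = ∑ k, S k i p ^ 2 := by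
      rw [h.ip_expand ho hp, sG (ν p), h.ip_Dν_ν _ hp, zero_mul, add_zero]
      exact Finset.sum_congr rfl fun k _ => by rw [h.shape_eq ho hp]; ring
    rw [e2, h.ip_expand ho hp _ y, sG (ν p), h.ip_DDν_ν _ _ hp, e3]
    simp_rw [sub_mul]
    rw [Finset.sum_sub_distrib]
    ring
  rw [Finset.sum_congr rfl fun i _ => e1 i, Finset.sum_sub_distrib, Finset.sum_comm,
    ← Finset.sum_mul]
  congr 1
  refine Finset.sum_congr rfl fun l _ => ?_
  rw [← Finset.sum_mul, h.codazzi ho hp]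

/-- The Laplacian of `1 / H`. -/
lemma lap_inv_H : lapE G Γ f e (fun p => (H p)⁻¹) p
    = - lapE G Γ f e H p / H p ^ 2 + 2 * (∑ i, dd (e i) H p ^ 2) / H p ^ 3 := by
  have h0 := h.ne_zero hp
  have e1 : ∀ i, ∀ q ∈ O, dd (e i) (fun p => (H p)⁻¹) q = - dd (e i) H q / H q ^ 2 :=
    fun i q hq => dd_inv (h.smH.diff hq) (h.ne_zero hq)
  have e2 : ∀ i, dd (e i) (dd (e i) (fun p => (H p)⁻¹)) p
      = - dd (e i) (dd (e i) H) p / H p ^ 2 + 2 * dd (e i) H p ^ 2 / H p ^ 3 := fun i => by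
    have d1 := (h.smH.inv fun p hp => h.ne_zero hp).diff hp
    have d2 := (h.smH.dd (e i)).diff hp
    have : ∀ q ∈ O, dd (e i) (fun p => (H p)⁻¹) q = -(dd (e i) H q * ((H q)⁻¹ * (H q)⁻¹)) :=
      fun q hq => by rw [e1 i q hq]; have := h.ne_zero hq; field_simp
    rw [dd_congr h.isOpen this hp, dd_neg, dd_mul (v := fun p => (H p)⁻¹ * (H p)⁻¹) d2 (d1.mul d1),
      dd_mul d1 d1, e1 i p hp]
    field_simp
    ring
  unfold lapE
  rw [neg_div, Finset.sum_div, Finset.mul_sum, Finset.sum_div, ← Finset.sum_neg_distrib,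
    ← Finset.sum_add_distrib]
  refine Finset.sum_congr rfl fun i _ => ?_
  rw [e2, Finset.sum_congr rfl fun k _ => by rw [e1 k p hp]]
  have : ∑ k, G (f p) (dd (e k) f p) (covD Γ f (e i) (dd (e i) f) p) * (- dd (e k) H p / H p ^ 2)
      = - (∑ k, G (f p) (dd (e k) f p) (covD Γ f (e i) (dd (e i) f) p) * dd (e k) H p)
        / H p ^ 2 := by
    rw [neg_div, Finset.sum_div, ← Finset.sum_neg_distrib]
    exact Finset.sum_congr rfl fun k _ => by ring
  rw [this]
  ring

/-- The evolution of the mean curvature. -/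
lemma dt_H : dd τ H p = - lapE G Γ f e (fun p => (H p)⁻¹) p
    - (∑ i, ∑ k, S k i p ^ 2) / H p
    - (∑ i, G (f p) (dd (e i) f p) (Rm Γ (f p) (dd (e i) f p) (ν p) (ν p))) / H p := by
  have sG := h.lc.symmG _ (h.mem p hp)
  rw [h.dd_H ho hp, lapE, Finset.sum_div, Finset.sum_div, ← Finset.sum_neg_distrib,
    ← Finset.sum_sub_distrib, ← Finset.sum_sub_distrib, ← Finset.sum_sub_distrib]
  refine Finset.sum_congr rfl fun i _ => ?_
  have c1 := h.lc.curvature (a := τ) (b := e i) h.smf h.mem h.smν hp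
  have c2 := h.dd_ip_Dν (e i) τ i hp
  -- Differentiating ⟨D_t ν, ∂_i f⟩ = -∂_i(1/H) once more along `e i` brings in the second
  -- derivatives of 1/H, which `c3` completes to the Laplacian.
  rw [dd_congr h.isOpen (fun p hp => h.ip_Dtν i hp) hp, dd_neg] at c2
  have c3 : G (f p) (covD Γ f τ ν p) (covD Γ f (e i) (dd (e i) f) p)
      = - ∑ k, G (f p) (dd (e k) f p) (covD Γ f (e i) (dd (e i) f) p)
        * dd (e k) (fun p => (H p)⁻¹) p := by
    rw [h.ip_expand ho hp, sG (ν p), h.ip_Dν_ν _ hp, zero_mul, add_zero,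
      ← Finset.sum_neg_distrib]
    refine Finset.sum_congr rfl fun k _ => ?_
    rw [sG, h.ip_Dtν k hp]; ring
  -- The time derivative of the tangent vectors contributes |A|²/H; only the part D_k ν / H of D_t
  -- ∂_k f is tangential.
  have c4 : ∑ k, S k i p * G (f p) (dd (e i) f p) (covD Γ f τ (dd (e k) f) p)
      = (∑ k, S k i p ^ 2) / H p := by
    rw [Finset.sum_div]
    refine Finset.sum_congr rfl fun k _ => ?_
    rw [h.covD_time_dd k hp]
    simp only [map_add, map_smul, smul_eq_mul]
    rw [h.shape_eq ho hp, sG _ (ν p), h.normal p hp, h.shape_symm ho hp i k]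
    ring
  have c5 : G (f p) (dd (e i) f p) (Rm Γ (f p) (dd τ f p) (dd (e i) f p) (ν p))
      = - G (f p) (dd (e i) f p) (Rm Γ (f p) (dd (e i) f p) (ν p) (ν p)) / H p := by
    have : Rm Γ (f p) (dd τ f p) (dd (e i) f p) (ν p)
        = - (H p)⁻¹ • Rm Γ (f p) (dd (e i) f p) (ν p) (ν p) := by
      rw [h.evol p hp, Rm_smul_left, Rm_antisymm, smul_neg, neg_smul]
    rw [this]
    simp only [map_smul, smul_eq_mul]
    ring
  rw [c4, c1, map_add, c5, sG, ← sub_eq_zero]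
  rw [c3] at c2
  linear_combination -c2

/-- The first derivatives of `⟨ν, Y⟩`. -/
lemma dd_P (hY : Sm V Y) (a : P) : dd a (fun p => G (f p) (ν p) (Y (f p))) p
    = ∑ k, G (f p) (dd (e k) f p) (covD Γ f a ν p) * G (f p) (dd (e k) f p) (Y (f p))
      + G (f p) (ν p) (nab Γ Y (f p) (dd a f p)) := by
  rw [h.lc.dd_ip (h.mem p hp) (h.smf.diff hp) (h.smν.diff hp)
    (Y := fun p => Y (f p)) ((hY.comp h.smf h.mem).diff hp),
    covD_comp (hY.diff (h.mem p hp)) (h.smf.diff hp), h.ip_expand ho hp (covD Γ f a ν p),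
    h.lc.symmG _ (h.mem p hp) (ν p) (covD Γ f a ν p), h.ip_Dν_ν _ hp, zero_mul, add_zero]

/-- The Laplacian of `⟨ν, Y⟩`. -/
lemma lap_P (hY : Sm V Y) : lapE G Γ f e (fun p => G (f p) (ν p) (Y (f p))) p
    = ∑ l, (dd (e l) H p + ∑ i, G (f p) (dd (e i) f p)
        (Rm Γ (f p) (dd (e i) f p) (dd (e l) f p) (ν p))) * G (f p) (dd (e l) f p) (Y (f p))
      - (∑ i, ∑ k, S k i p ^ 2) * G (f p) (ν p) (Y (f p))
      + 2 * ∑ i, ∑ k, S k i p * G (f p) (dd (e k) f p) (nab Γ Y (f p) (dd (e i) f p))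
      + ∑ i, G (f p) (ν p) (nab2 Γ Y (f p) (dd (e i) f p) (dd (e i) f p))
      - H p * G (f p) (ν p) (nab Γ Y (f p) (ν p)) := by
  have sG := h.lc.symmG _ (h.mem p hp)
  have dY : ∀ q ∈ O, ∀ i, dd (e i) (fun p => G (f p) (ν p) (Y (f p))) q
      = G (f q) (covD Γ f (e i) ν q) (Y (f q)) + G (f q) (ν q) (nab Γ Y (f q) (dd (e i) f q)) :=
    fun q hq i => by
      rw [h.lc.dd_ip (h.mem q hq) (h.smf.diff hq) (h.smν.diff hq)
        (Y := fun p => Y (f p)) ((hY.comp h.smf h.mem).diff hq),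
        covD_comp (hY.diff (h.mem q hq)) (h.smf.diff hq)]
  have sY := hY.comp h.smf h.mem
  have sN : ∀ i, Sm O (fun p => nab Γ Y (f p) (dd (e i) f p)) := fun i =>
    ((h.lc.sm_nab hY).comp h.smf h.mem).clm_apply (h.smf.dd (e i))
  -- The Gauss formula: the normal component -S_ii of D_i ∂_i f sums to -H and produces the last
  -- term of the statement.
  have gauss : ∀ i, covD Γ f (e i) (dd (e i) f) p
      = ∑ k, G (f p) (dd (e k) f p) (covD Γ f (e i) (dd (e i) f) p) • dd (e k) f p
        - S i i p • ν p := fun i => by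
    conv_lhs => rw [ho.span (covD Γ f (e i) (dd (e i) f) p)]
    rw [sub_eq_add_neg, ← neg_smul, ← h.shape_eq ho hp, sG (dd (e i) f p) (covD Γ f (e i) ν p),
      h.ip_Dν _ _ hp, neg_neg]
  have dd2 : ∀ i, dd (e i) (dd (e i) (fun p => G (f p) (ν p) (Y (f p)))) p
      - ∑ k, G (f p) (dd (e k) f p) (covD Γ f (e i) (dd (e i) f) p)
        * dd (e k) (fun p => G (f p) (ν p) (Y (f p))) p
      = (G (f p) (covD Γ f (e i) (covD Γ f (e i) ν) p) (Y (f p))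
        - ∑ k, G (f p) (dd (e k) f p) (covD Γ f (e i) (dd (e i) f) p)
          * G (f p) (covD Γ f (e k) ν p) (Y (f p)))
        + 2 * (∑ k, S k i p * G (f p) (dd (e k) f p) (nab Γ Y (f p) (dd (e i) f p)))
        + G (f p) (ν p) (nab2 Γ Y (f p) (dd (e i) f p) (dd (e i) f p))
        - S i i p * G (f p) (ν p) (nab Γ Y (f p) (ν p)) := fun i => by
    have e1 : G (f p) (covD Γ f (e i) ν p) (nab Γ Y (f p) (dd (e i) f p))
        = ∑ k, S k i p * G (f p) (dd (e k) f p) (nab Γ Y (f p) (dd (e i) f p)) := by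
      rw [h.ip_expand ho hp, sG (ν p), h.ip_Dν_ν _ hp, zero_mul, add_zero]
      exact Finset.sum_congr rfl fun k _ => by rw [h.shape_eq ho hp]
    have e2 : G (f p) (ν p) (nab Γ Y (f p) (covD Γ f (e i) (dd (e i) f) p))
        = ∑ k, G (f p) (dd (e k) f p) (covD Γ f (e i) (dd (e i) f) p)
          * G (f p) (ν p) (nab Γ Y (f p) (dd (e k) f p))
          - S i i p * G (f p) (ν p) (nab Γ Y (f p) (ν p)) := by
      conv_lhs => rw [gauss i]
      simp only [map_sub, map_sum, map_smul, smul_eq_mul]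
    have e3 : ∑ k, G (f p) (dd (e k) f p) (covD Γ f (e i) (dd (e i) f) p)
          * dd (e k) (fun p => G (f p) (ν p) (Y (f p))) p
        = ∑ k, G (f p) (dd (e k) f p) (covD Γ f (e i) (dd (e i) f) p)
            * G (f p) (covD Γ f (e k) ν p) (Y (f p))
          + ∑ k, G (f p) (dd (e k) f p) (covD Γ f (e i) (dd (e i) f) p)
            * G (f p) (ν p) (nab Γ Y (f p) (dd (e k) f p)) := by
      rw [← Finset.sum_add_distrib]
      exact Finset.sum_congr rfl fun k _ => by rw [dY p hp k, mul_add]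
    rw [e3, dd_congr h.isOpen (fun q hq => dY q hq i) hp,
      dd_add ((h.lc.sm_ip h.smf h.mem (h.smDν _) sY).diff hp)
        ((h.lc.sm_ip h.smf h.mem h.smν (sN i)).diff hp),
      h.lc.dd_ip (h.mem p hp) (h.smf.diff hp) ((h.smDν _).diff hp) (sY.diff hp),
      h.lc.dd_ip (h.mem p hp) (h.smf.diff hp) (h.smν.diff hp) ((sN i).diff hp),
      covD_comp (hY.diff (h.mem p hp)) (h.smf.diff hp),
      h.lc.covD_nab hY (h.mem p hp) (h.smf.diff hp) ((h.smf.dd (e i)).diff hp), map_add, e1, e2]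
    ring
  rw [lapE, Finset.sum_congr rfl fun i _ => dd2 i, Finset.sum_sub_distrib, Finset.sum_add_distrib,
    Finset.sum_add_distrib, h.lap_normal ho hp, ← Finset.mul_sum, ← Finset.sum_mul, h.trace p hp]

section Potential

variable {r : E → ℝ} (hr : Sm V r) (hY : Sm V Y) (hrY : ∀ z ∈ V, ∀ v, fderiv ℝ r z v = G z v (Y z))
include hr hY hrY

lemma dd_R (a : P) : dd a (fun p => r (f p)) p = G (f p) (dd a f p) (Y (f p)) := by
  rw [dd_comp (hr.diff (h.mem p hp)) (h.smf.diff hp), hrY _ (h.mem p hp)]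

lemma dt_R : dd τ (fun p => r (f p)) p = G (f p) (ν p) (Y (f p)) / H p := by
  rw [h.dd_R ho hp hr hY hrY, h.evol p hp]
  simp [div_eq_inv_mul]

/-- The derivative of ⟨∂_i f, Y⟩ splits into the Hessian of `r` and ⟨D_i ∂_i f, Y⟩. The tangential
part of the latter is removed by the correction in `lapE`, and its normal part -S_ii ν gives -H⟨ν,
Y⟩. -/
lemma lap_R : lapE G Γ f e (fun p => r (f p)) p
    = ∑ i, G (f p) (dd (e i) f p) (nab Γ Y (f p) (dd (e i) f p))
      - H p * G (f p) (ν p) (Y (f p)) := by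
  have d1 : ∀ q ∈ O, ∀ i, dd (e i) (fun p => r (f p)) q = G (f q) (dd (e i) f q) (Y (f q)) :=
    fun q hq i => by
      rw [dd_comp (hr.diff (h.mem q hq)) (h.smf.diff hq), hrY _ (h.mem q hq)]
  have sG := h.lc.symmG _ (h.mem p hp)
  rw [h.trace p hp, Finset.sum_mul, ← Finset.sum_sub_distrib, lapE]
  refine Finset.sum_congr rfl fun i _ => ?_
  have e3 : ∑ k, G (f p) (dd (e k) f p) (covD Γ f (e i) (dd (e i) f) p)
        * dd (e k) (fun p => r (f p)) p
      = ∑ k, G (f p) (dd (e k) f p) (covD Γ f (e i) (dd (e i) f) p)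
        * G (f p) (dd (e k) f p) (Y (f p)) :=
    Finset.sum_congr rfl fun k _ => by rw [d1 p hp k]
  rw [e3, dd_congr h.isOpen (fun q hq => d1 q hq i) hp,
    h.lc.dd_ip (h.mem p hp) (h.smf.diff hp) ((h.smf.dd (e i)).diff hp)
      (Y := fun p => Y (f p)) ((hY.comp h.smf h.mem).diff hp),
    covD_comp (hY.diff (h.mem p hp)) (h.smf.diff hp), h.ip_expand ho hp _ (Y (f p)), ← h.shape_eq ho hp i i,
    sG (dd (e i) f p) (covD Γ f (e i) ν p), h.ip_Dν _ _ hp]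
  ring

end Potential

/-- The second order operator `∂_t - H⁻² Δ`. -/
def _root_.IMCF.boxE (G : E → E →L[ℝ] E →L[ℝ] ℝ) (Γ : E → E →L[ℝ] E →L[ℝ] E) (f : P → E)
    (e : ι → P) (τ : P) (H : P → ℝ) (u : P → ℝ) (p : P) : ℝ :=
  dd τ u p - 1 / H p ^ 2 * lapE G Γ f e u p

omit ho in
lemma lapE_mul {u v : P → ℝ} (hu : Sm O u) (hv : Sm O v) :
    lapE G Γ f e (fun p => u p * v p) p = u p * lapE G Γ f e v p + v p * lapE G Γ f e u p
      + 2 * ∑ i, dd (e i) u p * dd (e i) v p := by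
  unfold lapE
  simp_rw [Finset.mul_sum, ← Finset.sum_add_distrib]
  refine Finset.sum_congr rfl fun i _ => ?_
  have d1 : ∀ q ∈ O, ∀ i, dd (e i) (fun p => u p * v p) q
      = dd (e i) u q * v q + u q * dd (e i) v q := fun q hq i => dd_mul (hu.diff hq) (hv.diff hq)
  have e1 : ∑ k, G (f p) (dd (e k) f p) (covD Γ f (e i) (dd (e i) f) p)
        * dd (e k) (fun p => u p * v p) p
      = v p * (∑ k, G (f p) (dd (e k) f p) (covD Γ f (e i) (dd (e i) f) p) * dd (e k) u p)
        + u p * (∑ k, G (f p) (dd (e k) f p) (covD Γ f (e i) (dd (e i) f) p) * dd (e k) v p) := by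
    rw [Finset.mul_sum, Finset.mul_sum, ← Finset.sum_add_distrib]
    exact Finset.sum_congr rfl fun k _ => by rw [d1 p hp k]; ring
  rw [dd_congr h.isOpen (fun q hq => d1 q hq i) hp,
    dd_add (((hu.dd _).mul hv).diff hp) ((hu.mul (hv.dd _)).diff hp),
    dd_mul ((hu.dd _).diff hp) (hv.diff hp), dd_mul (hu.diff hp) ((hv.dd _).diff hp), e1]
  ring

omit ho in
lemma boxE_mul {u v : P → ℝ} (hu : Sm O u) (hv : Sm O v) :
    boxE G Γ f e τ H (fun p => u p * v p) p = u p * boxE G Γ f e τ H v p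
      + v p * boxE G Γ f e τ H u p - 2 / H p ^ 2 * ∑ i, dd (e i) u p * dd (e i) v p := by
  rw [boxE, boxE, boxE, h.lapE_mul hp hu hv, dd_mul (hu.diff hp) (hv.diff hp)]
  ring

-- The time derivative is of first order, so only the Laplacian leaves a correction. Since the
-- identity is needed at `p` alone, `φ''` enters as a number.
omit ho in
lemma boxE_comp {u : P → ℝ} {φ φ' : ℝ → ℝ} {φ'' : ℝ} (hu : Sm O u)
    (hφ : ∀ p ∈ O, HasDerivAt φ (φ' (u p)) (u p)) (hφ' : HasDerivAt φ' φ'' (u p)) :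
    boxE G Γ f e τ H (fun p => φ (u p)) p = φ' (u p) * boxE G Γ f e τ H u p
      - φ'' / H p ^ 2 * ∑ i, dd (e i) u p ^ 2 := by
  have d1 : ∀ q ∈ O, ∀ a, dd a (fun p => φ (u p)) q = φ' (u q) * dd a u q := fun q hq a => by
    rw [dd_comp (hφ q hq).differentiableAt (hu.diff hq), (hφ q hq).hasFDerivAt.fderiv]
    simp [mul_comm]
  have d2 : ∀ i, dd (e i) (fun p => φ' (u p)) p = φ'' * dd (e i) u p := fun i => by
    rw [dd_comp hφ'.differentiableAt (hu.diff hp), hφ'.hasFDerivAt.fderiv]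
    simp [mul_comm]
  have e0 : lapE G Γ f e (fun p => φ (u p)) p = φ' (u p) * lapE G Γ f e u p
      + φ'' * ∑ i, dd (e i) u p ^ 2 := by
    unfold lapE
    simp_rw [Finset.mul_sum, ← Finset.sum_add_distrib]
    refine Finset.sum_congr rfl fun i _ => ?_
    have e1 : ∑ k, G (f p) (dd (e k) f p) (covD Γ f (e i) (dd (e i) f) p)
          * dd (e k) (fun p => φ (u p)) p
        = φ' (u p) * (∑ k, G (f p) (dd (e k) f p) (covD Γ f (e i) (dd (e i) f) p)
          * dd (e k) u p) := by
      rw [Finset.mul_sum]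
      exact Finset.sum_congr rfl fun k _ => by rw [d1 p hp]; ring
    rw [dd_congr h.isOpen (fun q hq => d1 q hq (e i)) hp,
      dd_mul (u := fun p => φ' (u p)) (hφ'.differentiableAt.comp p (hu.diff hp))
        ((hu.dd _).diff hp), d2, e1]
    ring
  rw [boxE, boxE, e0, d1 p hp]
  ring

/-- Evolution of the mean curvature under the flow. -/
lemma boxE_H : boxE G Γ f e τ H H p = - 2 * (∑ i, dd (e i) H p ^ 2) / H p ^ 3
    - (∑ i, ∑ k, S k i p ^ 2) / H p
    - (∑ i, G (f p) (dd (e i) f p) (Rm Γ (f p) (dd (e i) f p) (ν p) (ν p))) / H p := by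
  rw [boxE, h.dt_H ho hp, h.lap_inv_H ho hp]
  ring

/-- Evolution of `⟨ν, Y⟩` under the flow. -/
lemma boxE_P (hY : Sm V Y) :
    H p ^ 2 * boxE G Γ f e τ H (fun p => G (f p) (ν p) (Y (f p))) p
      = (∑ i, ∑ k, S k i p ^ 2) * G (f p) (ν p) (Y (f p))
        - ∑ l, (∑ i, G (f p) (dd (e i) f p)
          (Rm Γ (f p) (dd (e i) f p) (dd (e l) f p) (ν p))) * G (f p) (dd (e l) f p) (Y (f p))
        - 2 * ∑ i, ∑ k, S k i p * G (f p) (dd (e k) f p) (nab Γ Y (f p) (dd (e i) f p))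
        - ∑ i, G (f p) (ν p) (nab2 Γ Y (f p) (dd (e i) f p) (dd (e i) f p))
        + 2 * H p * G (f p) (ν p) (nab Γ Y (f p) (ν p)) := by
  have sG := h.lc.symmG _ (h.mem p hp)
  have h0 := h.ne_zero hp
  -- The time derivative contains ⟨∇H, Y⟩/H² because D_t ν = ∇H/H². The same term in `lap_P`,
  -- divided by H², cancels it.
  have e1 : dd τ (fun p => G (f p) (ν p) (Y (f p))) p
      = (∑ l, dd (e l) H p * G (f p) (dd (e l) f p) (Y (f p))) / H p ^ 2
        + G (f p) (ν p) (nab Γ Y (f p) (ν p)) / H p := by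
    rw [h.dd_P ho hp hY, h.evol p hp, Finset.sum_div]
    congr 1
    · refine Finset.sum_congr rfl fun k _ => ?_
      rw [sG, h.ip_Dtν k hp, dd_inv (h.smH.diff hp) h0]
      ring
    · simp [div_eq_inv_mul]
  rw [boxE, e1, h.lap_P ho hp hY]
  simp_rw [add_mul]
  rw [Finset.sum_add_distrib]
  field_simp
  ring

/-- Evolution of the potential under the flow. -/
lemma boxE_R {r : E → ℝ} (hr : Sm V r) (hY : Sm V Y)
    (hrY : ∀ z ∈ V, ∀ v, fderiv ℝ r z v = G z v (Y z)) :
    H p ^ 2 * boxE G Γ f e τ H (fun p => r (f p)) p = 2 * H p * G (f p) (ν p) (Y (f p))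
      - ∑ i, G (f p) (dd (e i) f p) (nab Γ Y (f p) (dd (e i) f p)) := by
  have h0 := h.ne_zero hp
  rw [boxE, h.dt_R ho hp hr hY hrY, h.lap_R ho hp hr hY hrY]
  field_simp
  ring

end Point
end CoreFlow
end CoreFlow

/-! ### Elementary inequalities for the reaction terms -/

section RealInequalities

variable {ι : Type*} [Fintype ι]

/-- Cauchy-Schwarz on the diagonal, then the off-diagonal squares are added. This is H² ≤ (n -
1)|A|². -/
lemma sq_trace_le (S : ι → ι → ℝ) :
    (∑ k, S k k) ^ 2 ≤ Fintype.card ι * ∑ i, ∑ k, S k i ^ 2 := by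
  refine (sq_sum_le_card_mul_sum_sq (s := Finset.univ) (f := fun k => S k k)).trans ?_
  rw [Finset.card_univ]
  gcongr with i
  exact Finset.single_le_sum (f := fun k => S k i ^ 2) (fun k _ => sq_nonneg _)
    (Finset.mem_univ i)

/-- Young's inequality entry by entry; the weight `c` decides how much of |A|² is spent. -/
lemma two_mul_sum_le (S b : ι → ι → ℝ) {c : ℝ} (hc : 0 < c) :
    2 * ∑ i, ∑ k, S k i * b k i ≤ (∑ i, ∑ k, S k i ^ 2) / c + c * ∑ i, ∑ k, b k i ^ 2 := by
  simp_rw [Finset.mul_sum, Finset.sum_div, ← Finset.sum_add_distrib]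
  refine Finset.sum_le_sum fun i _ => Finset.sum_le_sum fun k _ => ?_
  have : 0 ≤ (S k i - c * b k i) ^ 2 / c := by positivity
  have e : (S k i - c * b k i) ^ 2 / c = S k i ^ 2 / c + c * b k i ^ 2 - 2 * (S k i * b k i) := by
    field_simp; ring
  linarith

lemma abs_sum_le_card {u : ι → ℝ} {c : ℝ} (h : ∀ i, |u i| ≤ c) :
    |∑ i, u i| ≤ Fintype.card ι * c := by
  refine (Finset.abs_sum_le_sum_abs _ _).trans ((Finset.sum_le_sum fun i _ => h i).trans ?_)
  simp

lemma two_mul_le_div_add {a b c : ℝ} (hc : 0 < c) : 2 * (a * b) ≤ a ^ 2 / c + c * b ^ 2 := by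
  have : 0 ≤ (a - c * b) ^ 2 / c := by positivity
  have e : (a - c * b) ^ 2 / c = a ^ 2 / c + c * b ^ 2 - 2 * (a * b) := by
    field_simp; ring
  linarith

lemma abs_coord_le_one {y : ι → ℝ} {P : ℝ} (hy : ∑ l, y l ^ 2 + P ^ 2 = 1) (l : ι) :
    |y l| ≤ 1 := by
  rw [abs_le_one_iff_mul_self_le_one]
  have : y l ^ 2 ≤ ∑ k, y k ^ 2 := Finset.single_le_sum (f := fun k => y k ^ 2)
    (fun k _ => sq_nonneg _) (Finset.mem_univ l)
  nlinarith [sq_nonneg P]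

/-- The lower bound for `H² □ p`. -/
lemma evolution_p_lower {S b : ι → ι → ℝ} {y ρ c : ι → ℝ} {H P β ε : ℝ}
    (hN : 1 ≤ Fintype.card ι)
    (hH : H = ∑ k, S k k) (hP : 1 / 2 ≤ P) (hy : ∑ l, y l ^ 2 + P ^ 2 = 1)
    (hρ : ∀ l, |ρ l| ≤ ε ^ 2) (hb : ∀ k i, |b k i| ≤ ε) (hc : ∀ i, |c i| ≤ ε ^ 2) (hβ : |β| ≤ ε) :
    3 / 8 * (∑ i, ∑ k, S k i ^ 2) - 34 * Fintype.card ι ^ 2 * ε ^ 2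
      ≤ (∑ i, ∑ k, S k i ^ 2) * P - ∑ l, ρ l * y l - 2 * ∑ i, ∑ k, S k i * b k i - ∑ i, c i
        + 2 * H * β := by
  set N : ℝ := (Fintype.card ι : ℝ) with hNdef
  set A := ∑ i, ∑ k, S k i ^ 2 with hA
  have hN1 : (1 : ℝ) ≤ N := by rw [hNdef]; exact_mod_cast hN
  have hA0 : 0 ≤ A := Finset.sum_nonneg fun i _ => Finset.sum_nonneg fun k _ => sq_nonneg _
  have hy1 : ∀ l, |y l| ≤ 1 := abs_coord_le_one hy
  have h1 : |∑ l, ρ l * y l| ≤ N * ε ^ 2 := abs_sum_le_card fun l => by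
    rw [abs_mul]
    exact (mul_le_mul (hρ l) (hy1 l) (abs_nonneg _) (by positivity)).trans_eq (mul_one _)
  -- The weights 16 here and 16N in `h5` each cost |A|²/16, which leaves 1/2 - 1/8 = 3/8 of |A|². In
  -- units of N²ε² the error terms contribute at most 16 + 16 + 1 + 1 = 34.
  have h2 := two_mul_sum_le S b (c := 16) (by norm_num)
  have h3 : ∑ i, ∑ k, b k i ^ 2 ≤ N * (N * ε ^ 2) := by
    refine (Finset.sum_le_sum fun i _ => Finset.sum_le_sum fun k _ =>
      (sq_le_sq' (abs_le.1 (hb k i)).1 (abs_le.1 (hb k i)).2)).trans ?_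
    simp [hNdef]
  have h4 : |∑ i, c i| ≤ N * ε ^ 2 := abs_sum_le_card hc
  have h5 := two_mul_le_div_add (a := -H) (b := β) (c := 16 * N) (by positivity)
  have h6 : H ^ 2 ≤ N * A := by rw [hH]; exact sq_trace_le S
  have h7 : (-H) ^ 2 / (16 * N) ≤ A / 16 := by
    rw [div_le_div_iff₀ (by positivity) (by norm_num), neg_sq]
    linarith
  have h8 : β ^ 2 ≤ ε ^ 2 := sq_le_sq' (abs_le.1 hβ).1 (abs_le.1 hβ).2
  have h9 : 16 * N * β ^ 2 ≤ 16 * N * ε ^ 2 := by gcongr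
  have h10 : A * (1 / 2) ≤ A * P := by gcongr
  have h11 : N * ε ^ 2 ≤ N ^ 2 * ε ^ 2 := by
    gcongr; nlinarith
  have := (abs_le.1 h1).2
  have := (abs_le.1 h4).2
  have h12 : N * (N * ε ^ 2) = N ^ 2 * ε ^ 2 := by ring
  rw [neg_mul] at h5
  linarith

/-- The reaction terms in the evolution of `F`. -/
lemma reaction_F_le {S b : ι → ι → ℝ} {y d : ι → ℝ} {H P T ε γ s Lp : ℝ} (hε : 0 ≤ ε)
    (hN : 1 ≤ Fintype.card ι) (hs : 0 < s) (hγ : 0 < γ)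
    (hγN : 100 * (Fintype.card ι : ℝ) ≤ 1 / γ)
    (hH : H = ∑ k, S k k) (hP : 1 / 2 ≤ P) (hy : ∑ l, y l ^ 2 + P ^ 2 = 1)
    (hd : ∀ i, |d i| ≤ ε) (hb : ∀ k i, |b k i| ≤ ε) (hT : T = ∑ i, b i i)
    (hLp : 3 / 8 * (∑ i, ∑ k, S k i ^ 2) - 34 * Fintype.card ι ^ 2 * ε ^ 2 ≤ Lp) :
    - Lp + (1 - P) * (γ * ε / s * (2 * H * P - T) - γ * (γ + 1) * ε ^ 2 / s ^ 2 * ∑ i, y i ^ 2)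
      + 2 * (γ * ε / s) * ∑ i, (∑ k, S k i * y k + d i) * y i
    ≤ ε ^ 2 * (34 * Fintype.card ι ^ 2 + 3 * Fintype.card ι * γ / s - γ * (1 - P) ^ 2 / s ^ 2) := by
  set N : ℝ := (Fintype.card ι : ℝ) with hNdef
  set A := ∑ i, ∑ k, S k i ^ 2 with hA
  set D := ∑ i, y i ^ 2 with hD
  set β := γ * ε / s with hβ
  have hN1 : (1 : ℝ) ≤ N := by rw [hNdef]; exact_mod_cast hN
  have hA0 : 0 ≤ A := Finset.sum_nonneg fun i _ => Finset.sum_nonneg fun k _ => sq_nonneg _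
  have hD0 : 0 ≤ D := Finset.sum_nonneg fun i _ => sq_nonneg _
  have hβ0 : 0 ≤ β := by positivity
  have hy1 : ∀ l, |y l| ≤ 1 := abs_coord_le_one hy
  have hP1 : P ≤ 1 := by nlinarith
  set Q := 1 - P with hQ
  have hQ0 : 0 ≤ Q := by linarith
  have hDQ : D = Q * (1 + P) := by rw [hQ]; linarith
  have h6 : H ^ 2 ≤ N * A := by rw [hH]; exact sq_trace_le S
  -- The two terms linear in `S` (this one and `h3`) are charged |A|²/8 each against the available
  -- 3/8 |A|², with weights 8N and 8. Their other halves are multiples of β²Q².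
  have h1 : 2 * (H * (β * Q * P)) ≤ A / 8 + 8 * N * (β ^ 2 * Q ^ 2) := by
    have := two_mul_le_div_add (a := H) (b := β * Q * P) (c := 8 * N) (by positivity)
    have h7 : H ^ 2 / (8 * N) ≤ A / 8 := by
      rw [div_le_div_iff₀ (by positivity) (by norm_num)]
      linarith
    have h8 : (β * Q * P) ^ 2 ≤ β ^ 2 * Q ^ 2 := by
      rw [mul_pow, mul_pow]
      exact mul_le_of_le_one_right (by positivity)
        (pow_le_one₀ (by linarith) hP1)
    have h9 : 8 * N * (β * Q * P) ^ 2 ≤ 8 * N * (β ^ 2 * Q ^ 2) := by gcongr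
    linarith
  have hTb : |T| ≤ N * ε := by rw [hT]; exact abs_sum_le_card fun i => hb i i
  have h2 : Q * (β * (-T)) ≤ N * (β * ε) := by
    have e1 : β * (-T) ≤ β * (N * ε) := by gcongr; linarith [(abs_le.1 hTb).1]
    have e2 : Q * (β * (-T)) ≤ Q * (β * (N * ε)) := by gcongr
    have e3 : Q * (β * (N * ε)) ≤ 1 * (β * (N * ε)) := by gcongr; linarith
    linarith
  have h3 : 2 * β * ∑ i, (∑ k, S k i * y k) * y i ≤ A / 8 + 8 * (β ^ 2 * D ^ 2) := by
    have := two_mul_sum_le S (fun k i => β * (y k * y i)) (c := 8) (by norm_num)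
    have e1 : ∑ i, ∑ k, (β * (y k * y i)) ^ 2 = β ^ 2 * D ^ 2 := by
      rw [hD, sq (∑ i, y i ^ 2), Finset.sum_mul_sum, Finset.mul_sum]
      refine Finset.sum_congr rfl fun i _ => ?_
      rw [Finset.mul_sum]
      exact Finset.sum_congr rfl fun k _ => by ring
    have e2 : 2 * β * ∑ i, (∑ k, S k i * y k) * y i
        = 2 * ∑ i, ∑ k, S k i * (β * (y k * y i)) := by
      rw [mul_assoc, Finset.mul_sum]
      congr 1
      refine Finset.sum_congr rfl fun i _ => ?_
      rw [Finset.sum_mul, Finset.mul_sum]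
      exact Finset.sum_congr rfl fun k _ => by ring
    rw [e2, ← e1]; exact this
  have h4 : 2 * β * ∑ i, d i * y i ≤ 2 * (N * (β * ε)) := by
    have : |∑ i, d i * y i| ≤ N * ε := abs_sum_le_card fun i => by
      rw [abs_mul]
      exact (mul_le_mul (hd i) (hy1 i) (abs_nonneg _) hε).trans_eq (mul_one _)
    have h' : β * ∑ i, d i * y i ≤ β * (N * ε) := by gcongr; exact (abs_le.1 this).2
    linarith
  have h5 : γ * (γ + 1) * ε ^ 2 / s ^ 2 = (γ + 1) / γ * β ^ 2 := by
    rw [hβ]; field_simp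
  have h7 : γ * Q ^ 2 / s ^ 2 * ε ^ 2 = 1 / γ * (β ^ 2 * Q ^ 2) := by
    rw [hβ]; field_simp
  have h8 : 3 * N * γ / s * ε ^ 2 = 3 * (N * (β * ε)) := by rw [hβ]; field_simp
  have hD2 : D ^ 2 ≤ 4 * Q ^ 2 := by
    rw [hDQ, mul_pow, mul_comm]
    exact mul_le_mul_of_nonneg_right (by nlinarith) (sq_nonneg Q)
  have hQD : 3 / 2 * Q ^ 2 ≤ Q * D := by
    rw [hDQ, show Q * (Q * (1 + P)) = (1 + P) * Q ^ 2 by ring]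
    exact mul_le_mul_of_nonneg_right (by linarith) (sq_nonneg Q)
  -- The good term has coefficient (γ + 1)/γ ≥ 1/γ and QD ≥ (3/2)Q². A part (1/γ)β²Q² is kept as the
  -- final negative term; the other half of 1/γ must dominate 8N + 32, and 1/γ ≥ 100N is ample for
  -- this.
  have h9 : (8 * N + 32) * (β ^ 2 * Q ^ 2) + 1 / γ * (β ^ 2 * Q ^ 2)
      ≤ (γ + 1) / γ * β ^ 2 * (Q * D) := by
    have e0 : 1 / γ ≤ (γ + 1) / γ := by gcongr; linarith
    have e1 : (8 * N + 32) + 1 / γ ≤ (1 / γ) * (3 / 2) := by linarith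
    calc _ = ((8 * N + 32) + 1 / γ) * (β ^ 2 * Q ^ 2) := by ring
      _ ≤ (1 / γ) * (3 / 2) * (β ^ 2 * Q ^ 2) := by gcongr
      _ = (1 / γ) * β ^ 2 * (3 / 2 * Q ^ 2) := by ring
      _ ≤ (γ + 1) / γ * β ^ 2 * (Q * D) := by gcongr
  have e3 : ∑ i, (∑ k, S k i * y k + d i) * y i
      = ∑ i, (∑ k, S k i * y k) * y i + ∑ i, d i * y i := by
    rw [← Finset.sum_add_distrib]; exact Finset.sum_congr rfl fun i _ => by ring
  have h10 : 8 * (β ^ 2 * D ^ 2) ≤ 32 * (β ^ 2 * Q ^ 2) := by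
    have : β ^ 2 * D ^ 2 ≤ β ^ 2 * (4 * Q ^ 2) := by gcongr
    linarith
  rw [e3, h5]
  have e4 : ε ^ 2 * (34 * N ^ 2 + 3 * N * γ / s - γ * Q ^ 2 / s ^ 2)
      = 34 * N ^ 2 * ε ^ 2 + 3 * N * γ / s * ε ^ 2 - γ * Q ^ 2 / s ^ 2 * ε ^ 2 := by ring
  rw [e4, h7, h8]
  have e5 : Q * (β * (2 * H * P - T) - (γ + 1) / γ * β ^ 2 * D)
      = 2 * (H * (β * Q * P)) + Q * (β * (-T)) - (γ + 1) / γ * β ^ 2 * (Q * D) := by ring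
  rw [e5, mul_add]
  linarith

/-- The elementary inequality which turns the reaction terms into a power of `F`. -/
lemma power_F_le {N γ Q s : ℝ} (hN : 1 ≤ N) (hγ : 0 < γ) (hγ2 : γ < 1 / 2) (hQ0 : 0 ≤ Q)
    (hQ1 : Q ≤ 1) (hs : 0 < s) :
    Q ^ (2 / γ - 1) * (s ^ (-γ) * (34 * N ^ 2 + 3 * N * γ / s - γ * Q ^ 2 / s ^ 2))
      ≤ γ / 2 * (-((Q * s ^ (-γ)) ^ ((γ + 2) / γ))
        + 2 / γ * ((34 * N ^ 2 + 5 * N ^ 2 * γ) * (2 + 6 * N + 68 * N ^ 2 / γ))) := by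
  have h2γ : 2 ≤ 1 / γ := by rw [le_div_iff₀ hγ]; linarith
  have h2γ' : 2 / γ = 2 * (1 / γ) := by ring
  set C := 34 * N ^ 2 with hC
  -- In this variable F = x^γ and the leading term is exactly x^(γ+2) = F^((γ+2)/γ); the weight
  -- Q^(2/γ - 1) is what makes the powers of Q match.
  set x := Q ^ (1 / γ) / s with hx
  have hx0 : 0 ≤ x := by positivity
  have hsg : ∀ a : ℝ, s ^ a = (s⁻¹) ^ (-a) := fun a => by
    rw [Real.inv_rpow hs.le, Real.rpow_neg hs.le, inv_inv]
  have hxp : ∀ a : ℝ, x ^ a = Q ^ (a / γ) * s ^ (-a) := fun a => by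
    rw [hx, Real.div_rpow (by positivity) hs.le, ← Real.rpow_mul hQ0, Real.rpow_neg hs.le,
      div_eq_mul_inv]
    congr 2; ring
  have hF : Q * s ^ (-γ) = x ^ γ := by rw [hxp, div_self hγ.ne', Real.rpow_one]
  have hT : (Q * s ^ (-γ)) ^ ((γ + 2) / γ) = x ^ γ * x ^ 2 := by
    rw [hF, ← Real.rpow_mul hx0, mul_div_cancel₀ _ hγ.ne', Real.rpow_add' hx0 (by linarith)]
    norm_num
  have hpw : ∀ a c : ℝ, c ≤ a → Q ^ a ≤ Q ^ c ∨ Q = 0 := fun a c hac => by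
    rcases eq_or_lt_of_le hQ0 with h | h
    · right; exact h.symm
    · left; exact Real.rpow_le_rpow_of_exponent_ge h hQ1 hac
  have hpw' : ∀ a c : ℝ, 0 < c → c ≤ a → Q ^ a ≤ Q ^ c := fun a c hc hac => by
    rcases hpw a c hac with h | h
    · exact h
    · rw [h, Real.zero_rpow (by linarith), Real.zero_rpow hc.ne']
  have t1 : Q ^ (2 / γ - 1) * s ^ (-γ) ≤ x ^ γ := by
    rw [hxp, div_self hγ.ne']
    exact mul_le_mul_of_nonneg_right (hpw' _ _ one_pos (by linarith)) (by positivity)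
  -- Lowering the exponent of Q from 2/γ - 1 to 1 + 1/γ is permitted because Q ≤ 1 and 1/γ ≥ 2,
  -- which is the role of γ < 1/2.
  have t2 : Q ^ (2 / γ - 1) * s ^ (-γ) / s ≤ x ^ γ * x := by
    have : x ^ γ * x = Q ^ ((γ + 1) / γ) * s ^ (-γ) / s := by
      rw [← Real.rpow_add_one' hx0 (by linarith), hxp, neg_add, ← sub_eq_add_neg,
        Real.rpow_sub_one hs.ne']
      ring
    rw [this]
    refine div_le_div_of_nonneg_right (mul_le_mul_of_nonneg_right
      (hpw' _ _ (by positivity) ?_) (by positivity)) hs.le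
    rw [add_div, div_self hγ.ne']; linarith
  have t3 : Q ^ (2 / γ - 1) * s ^ (-γ) * Q ^ 2 / s ^ 2 = x ^ γ * x ^ 2 := by
    rw [← hF, hx, div_pow, ← Real.rpow_natCast (Q ^ (1 / γ)), ← Real.rpow_mul hQ0]
    have e : Q ^ (2 / γ - 1) * Q ^ 2 = Q * Q ^ (1 / γ * ((2 : ℕ) : ℝ)) := by
      rw [← Real.rpow_natCast Q 2, ← Real.rpow_add' hQ0 (by push_cast; linarith),
        ← Real.rpow_one_add' hQ0 (by positivity)]
      congr 1; push_cast; ring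
    calc _ = (Q ^ (2 / γ - 1) * Q ^ 2) * s ^ (-γ) / s ^ 2 := by ring
      _ = _ := by rw [e]; ring
  have hN0 : 0 < N := by linarith
  -- Half of the negative term, γ/2 · x^(γ+2), is set aside for the conclusion. The bracket with the
  -- other half is at most its value C + (9/2)N²γ at x = 3N.
  have main : x ^ γ * (C + 3 * N * γ * x - γ / 2 * x ^ 2)
      ≤ (C + 5 * N ^ 2 * γ) * (2 + 6 * N + 68 * N ^ 2 / γ) := by
    have hM : C + 3 * N * γ * x - γ / 2 * x ^ 2 ≤ C + 5 * N ^ 2 * γ := by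
      nlinarith [mul_nonneg hγ.le (sq_nonneg (x - 3 * N)), mul_pos hγ (sq_pos_of_pos hN0)]
    have hC0 : 0 ≤ C := by positivity
    -- Beyond this threshold γx exceeds 6Nγ + 2C, so the bracket is negative; note that 68N² = 2C.
    -- Below it, x^γ is bounded because γ ≤ 1.
    by_cases hk : x ≤ 1 + 6 * N + 68 * N ^ 2 / γ
    · have hxg : x ^ γ ≤ 2 + 6 * N + 68 * N ^ 2 / γ := by
        rcases le_total x 1 with h | h
        · exact (Real.rpow_le_one hx0 h hγ.le).trans
            (by have : 0 ≤ 68 * N ^ 2 / γ := by positivity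
                linarith)
        · have := Real.rpow_le_rpow_of_exponent_le h (show γ ≤ 1 by linarith)
          rw [Real.rpow_one] at this
          linarith
      calc _ ≤ x ^ γ * (C + 5 * N ^ 2 * γ) := by gcongr
        _ ≤ (2 + 6 * N + 68 * N ^ 2 / γ) * (C + 5 * N ^ 2 * γ) := by gcongr
        _ = _ := mul_comm _ _
    · push Not at hk
      have h68 : γ * (68 * N ^ 2 / γ) = 2 * C := by rw [hC]; field_simp; norm_num
      have hx1 : 1 ≤ x := by
        have : 0 ≤ 68 * N ^ 2 / γ := by positivity
        linarith
      have hneg : C + 3 * N * γ * x - γ / 2 * x ^ 2 ≤ 0 := by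
        have h1 : γ * (1 + 6 * N + 68 * N ^ 2 / γ) ≤ γ * x := by gcongr
        have h2 : γ + 6 * N * γ + 2 * C ≤ γ * x := by
          calc _ = γ * (1 + 6 * N + 68 * N ^ 2 / γ) := by rw [mul_add, mul_add, h68]; ring
            _ ≤ _ := h1
        have h3 : (γ + 6 * N * γ + 2 * C) * x ≤ γ * x * x := by gcongr
        nlinarith
      have h0 : x ^ γ * (C + 3 * N * γ * x - γ / 2 * x ^ 2) ≤ 0 :=
        mul_nonpos_of_nonneg_of_nonpos (by positivity) hneg
      refine h0.trans (by positivity)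
  rw [hT]
  have e1 : Q ^ (2 / γ - 1) * (s ^ (-γ) * (C + 3 * N * γ / s - γ * Q ^ 2 / s ^ 2))
      = C * (Q ^ (2 / γ - 1) * s ^ (-γ)) + 3 * N * γ * (Q ^ (2 / γ - 1) * s ^ (-γ) / s)
        - γ * (Q ^ (2 / γ - 1) * s ^ (-γ) * Q ^ 2 / s ^ 2) := by ring
  have e2 : γ / 2 * (-(x ^ γ * x ^ 2) + 2 / γ * ((C + 5 * N ^ 2 * γ)
      * (2 + 6 * N + 68 * N ^ 2 / γ))) = - (γ / 2 * (x ^ γ * x ^ 2))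
        + (C + 5 * N ^ 2 * γ) * (2 + 6 * N + 68 * N ^ 2 / γ) := by
    field_simp
  rw [e1, e2, t3]
  have i1 : C * (Q ^ (2 / γ - 1) * s ^ (-γ)) ≤ C * x ^ γ := by gcongr
  have i2 : 3 * N * γ * (Q ^ (2 / γ - 1) * s ^ (-γ) / s) ≤ 3 * N * γ * (x ^ γ * x) := by gcongr
  nlinarith

/-- Complete the square in each `h i` with weight 2ηr₀/H³: the negative |∇H|² term pays for the
cross term and leaves |∇η|² divided by G. This is why no first order term has to be collected in a
vector field. -/
lemma cross_term_le {y h : ι → ℝ} {H r₀ γ u η : ℝ} (hη : 0 < η) (hr : 0 < r₀) (hH0 : 0 < H)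
    (hγ : 0 ≤ γ) (hγ1 : γ ≤ 1) :
    - 2 * η * r₀ * (∑ i, h i ^ 2) / H ^ 3 + 2 / H ^ 2 * ∑ i, h i * ((1 - γ) * u * y i)
      ≤ ∑ i, u ^ 2 * y i ^ 2 / (2 * (r₀ * H * η)) := by
  rw [Finset.mul_sum, Finset.sum_div, Finset.mul_sum, ← Finset.sum_add_distrib]
  refine Finset.sum_le_sum fun i _ => ?_
  have e1 : 0 ≤ 2 * η * r₀ / H ^ 3 * (h i - H * ((1 - γ) * u * y i) / (2 * η * r₀)) ^ 2 := by
    positivity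
  have e2 : 2 * η * r₀ / H ^ 3 * (h i - H * ((1 - γ) * u * y i) / (2 * η * r₀)) ^ 2
      = 2 * η * r₀ * h i ^ 2 / H ^ 3 - 2 / H ^ 2 * (h i * ((1 - γ) * u * y i))
        + (1 - γ) ^ 2 * (u ^ 2 * y i ^ 2) / (2 * (r₀ * H * η)) := by
    field_simp
    ring
  have e3 : (1 - γ) ^ 2 * (u ^ 2 * y i ^ 2) / (2 * (r₀ * H * η))
      ≤ u ^ 2 * y i ^ 2 / (2 * (r₀ * H * η)) := by
    refine div_le_div_of_nonneg_right (mul_le_of_le_one_left (by positivity) ?_) (by positivity)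
    exact pow_le_one₀ (by linarith) (by linarith)
  have e4 : -2 * η * r₀ * h i ^ 2 / H ^ 3 = - (2 * η * r₀ * h i ^ 2 / H ^ 3) := by ring
  linarith

/-- The inequality behind the evolution of `G`, with `u = s ^ (-γ)` and `h i = ∂_i H`. -/
lemma reaction_G_le {S b : ι → ι → ℝ} {y h : ι → ℝ} {H P T R A r₀ γ s u η K C : ℝ} {n : ℕ}
    (hn : Fintype.card ι + 1 = n) (hN : 1 ≤ Fintype.card ι)
    (hr : 0 < r₀) (hs : 0 < s) (hγ : 0 < γ) (hγ2 : γ < 1 / 2) (hu : 0 < u)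
    (hη : 0 < η) (hηs : η ≤ s * u) (hη2 : η ≤ 2) (hH0 : 0 < H)
    (hH : H = ∑ k, S k k) (hA : A = ∑ i, ∑ k, S k i ^ 2)
    (hP : 1 / 2 ≤ P) (hy : ∑ l, y l ^ 2 + P ^ 2 = 1)
    (hb : ∀ k i, |b k i| ≤ r₀⁻¹) (hT : T = ∑ i, b i i) (hR : |R| ≤ (r₀ ^ 2)⁻¹)
    (hK : (1 - P) * u ≤ K) (hC : 4 * n + 6 * K ≤ C) :
    r₀ * H * (-((1 - γ) * u / r₀) * ((2 * H * P - T) / H ^ 2)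
        - -(γ * (1 - γ) * (u / s) / r₀ ^ 2) / H ^ 2 * ∑ i, y i ^ 2)
      + η * (r₀ * (-2 * (∑ i, h i ^ 2) / H ^ 3 - A / H - R / H))
      - 2 / H ^ 2 * ∑ i, (r₀ * h i) * (-((1 - γ) * u / r₀) * y i)
    ≤ -(r₀ * H * η) / n + 4 * n / (r₀ * H * η) + 1 / 2 * u * (C / (r₀ * H * η) - 1) := by
  set N : ℝ := (Fintype.card ι : ℝ) with hNdef
  set D := ∑ i, y i ^ 2 with hD
  have hN1 : (1 : ℝ) ≤ N := by rw [hNdef]; exact_mod_cast hN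
  have hnN : (n : ℝ) = N + 1 := by rw [← hn]; push_cast; rfl
  have hD0 : 0 ≤ D := Finset.sum_nonneg fun i _ => sq_nonneg _
  have hP1 : P ≤ 1 := by nlinarith
  have hDQ : D ≤ 2 * (1 - P) := by nlinarith
  set g := r₀ * H * η with hg
  have hg0 : 0 < g := by positivity
  have hA2 : H ^ 2 ≤ N * A := by rw [hH, hA]; exact sq_trace_le S
  -- `Fintype.card ι` is n - 1, so -|A|²/H is at most -H/(n - 1), which is better than the stated
  -- -H/n.
  have t1 : - (η * r₀ * A / H) ≤ - g / n := by
    rw [neg_div, neg_le_neg_iff, hg, div_le_div_iff₀ (by rw [hnN]; positivity) hH0, hnN]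
    have : r₀ * η * (H ^ 2) ≤ r₀ * η * (N * A) := by gcongr
    have hA0 : 0 ≤ A := by
      rw [hA]; exact Finset.sum_nonneg fun i _ => Finset.sum_nonneg fun k _ => sq_nonneg _
    have : 0 ≤ r₀ * η * A := by positivity
    linarith
  -- After the power of r₀ is cancelled, this is η²/G, and η ≤ 2.
  have t2 : - (η * r₀ * R / H) ≤ 4 * n / g := by
    have e1 : - R ≤ (r₀ ^ 2)⁻¹ := by linarith [(abs_le.1 hR).1]
    have e2 : η * r₀ * (-R) / H ≤ η * r₀ * (r₀ ^ 2)⁻¹ / H := by gcongr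
    have e3 : η * r₀ * (r₀ ^ 2)⁻¹ / H = η ^ 2 / g := by rw [hg]; field_simp
    have e4 : η ^ 2 / g ≤ 4 * n / g := by
      gcongr; rw [hnN]; nlinarith
    calc _ = η * r₀ * (-R) / H := by ring
      _ ≤ _ := e2
      _ ≤ _ := e3 ▸ e4
  have hTb : |T| ≤ N * r₀⁻¹ := by rw [hT]; exact abs_sum_le_card fun i => hb i i
  have t3 : (1 - γ) * u * T / H ≤ u * (2 * N) / g := by
    have e1 : (1 - γ) * u * T / H ≤ (1 - γ) * u * (N * r₀⁻¹) / H := by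
      have : 0 ≤ (1 - γ) := by linarith
      gcongr; exact (abs_le.1 hTb).2
    have e2 : (1 - γ) * u * (N * r₀⁻¹) / H = (1 - γ) * (u * N * η) / g := by
      rw [hg]; field_simp
    have e3 : (1 - γ) * (u * N * η) ≤ 1 * (u * N * 2) := by
      gcongr
      linarith
    rw [e2] at e1
    refine e1.trans ?_
    rw [show u * (2 * N) = 1 * (u * N * 2) by ring]
    gcongr
  -- The factor 1/s in the second derivative of s^(1-γ) is harmless because η/s ≤ u; then u²D ≤ 2u(1
  -- - P)u ≤ 2uK. The same bound is used in `t5`.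
  have t4 : γ * (1 - γ) * (u / s) / r₀ * D / H ≤ u * (2 * K) / g := by
    have e1 : γ * (1 - γ) * (u / s) / r₀ * D / H = γ * (1 - γ) * (u * D * (η / s)) / g := by
      rw [hg]; field_simp
    rw [e1]
    have e2 : η / s ≤ u := by rw [div_le_iff₀ hs]; linarith
    have e3 : γ * (1 - γ) * (u * D * (η / s)) ≤ 1 * (u * (2 * (1 - P)) * u) := by
      gcongr
      nlinarith
    have e4 : 1 * (u * (2 * (1 - P)) * u) ≤ u * (2 * K) := by
      have := mul_le_mul_of_nonneg_left hK hu.le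
      linarith
    exact div_le_div_of_nonneg_right (e3.trans e4) hg0.le
  have t5 : - 2 * η * r₀ * (∑ i, h i ^ 2) / H ^ 3 + 2 / H ^ 2 * ∑ i, h i * ((1 - γ) * u * y i)
      ≤ u * K / g := by
    have e0 := cross_term_le (y := y) (h := h) hη hr hH0 hγ.le (by linarith : γ ≤ 1) (u := u)
    rw [← hg] at e0
    refine e0.trans ?_
    rw [← Finset.sum_div, ← Finset.mul_sum, ← hD, div_le_div_iff₀ (by positivity) hg0]
    have e5 : u ^ 2 * D ≤ u * (2 * K) := by
      have h1 : u * (u * D) ≤ u * (u * (2 * (1 - P))) := by gcongr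
      have h2 := mul_le_mul_of_nonneg_left hK hu.le
      linarith
    have := mul_le_mul_of_nonneg_right e5 hg0.le
    linarith
  -- The good term: 1 - γ ≥ 1/2 and P ≥ 1/2 give the factor 1/2 in front of s^(-γ).
  have t6 : - (2 * (1 - γ) * u * P) ≤ - (1 / 2 * u) := by
    have : (1 / 2) * u * (1 / 2) ≤ (1 - γ) * u * P :=
      mul_le_mul (mul_le_mul_of_nonneg_right (by linarith) hu.le) hP (by norm_num)
        (mul_nonneg (by linarith) hu.le)
    linarith
  -- Since N ≤ n, the hypothesis on C gives 2N + 2K + K ≤ C/2.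
  have t7 : u * (2 * N) / g + u * (2 * K) / g + u * K / g ≤ 1 / 2 * u * (C / g) := by
    rw [← add_div, ← add_div, mul_div_assoc', div_le_div_iff_of_pos_right hg0]
    rw [hnN] at hC
    have := mul_le_mul_of_nonneg_left hC hu.le
    linarith
  have e1 : r₀ * H * (-((1 - γ) * u / r₀) * ((2 * H * P - T) / H ^ 2)
        - -(γ * (1 - γ) * (u / s) / r₀ ^ 2) / H ^ 2 * D)
      = - (2 * (1 - γ) * u * P) + (1 - γ) * u * T / H
        + γ * (1 - γ) * (u / s) / r₀ * D / H := by
    field_simp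
    ring
  have e2 : η * (r₀ * (-2 * (∑ i, h i ^ 2) / H ^ 3 - A / H - R / H))
      = - 2 * η * r₀ * (∑ i, h i ^ 2) / H ^ 3 - η * r₀ * A / H - η * r₀ * R / H := by
    ring
  have e3 : 2 / H ^ 2 * ∑ i, (r₀ * h i) * (-((1 - γ) * u / r₀) * y i)
      = - (2 / H ^ 2 * ∑ i, h i * ((1 - γ) * u * y i)) := by
    rw [← mul_neg, ← Finset.sum_neg_distrib]
    congr 1
    refine Finset.sum_congr rfl fun i _ => ?_
    field_simp
  rw [e1, e2, e3]
  linarith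

end RealInequalities

/-! ### The differential inequalities for F and G in coordinates -/

section CoreInequalities

variable {P E : Type*} [NormedAddCommGroup P] [NormedSpace ℝ P]
  [NormedAddCommGroup E] [NormedSpace ℝ E] {ι : Type*} [Fintype ι] [DecidableEq ι]
  {V : Set E} {G : E → E →L[ℝ] E →L[ℝ] ℝ} {Γ : E → E →L[ℝ] E →L[ℝ] E}
  {O : Set P} {f ν : P → E} {e : ι → P} {τ : P} {S : ι → ι → P → ℝ} {H : P → ℝ} {p : P}
  {Y : E → E} {r : E → ℝ} {r₀ b γ : ℝ}

/-- The bounds on the ambient geometry, in the frame `∂_i f`, `ν`. -/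
structure FlowBounds (G : E → E →L[ℝ] E →L[ℝ] ℝ) (Γ : E → E →L[ℝ] E →L[ℝ] E) (f ν : P → E)
    (e : ι → P) (Y : E → E) (r₀ : ℝ) (p : P) : Prop where
  pos : 0 < r₀
  half_le : 1 / 2 ≤ G (f p) (ν p) (Y (f p))
  unit : ∑ i, G (f p) (dd (e i) f p) (Y (f p)) ^ 2 + G (f p) (ν p) (Y (f p)) ^ 2 = 1
  ric : ∀ l, |∑ i, G (f p) (dd (e i) f p) (Rm Γ (f p) (dd (e i) f p) (dd (e l) f p) (ν p))|
    ≤ (r₀ ^ 2)⁻¹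
  ric_normal : |∑ i, G (f p) (dd (e i) f p) (Rm Γ (f p) (dd (e i) f p) (ν p) (ν p))| ≤ (r₀ ^ 2)⁻¹
  hess : ∀ k i, |G (f p) (dd (e k) f p) (nab Γ Y (f p) (dd (e i) f p))| ≤ r₀⁻¹
  hess_tangent : ∀ i, |G (f p) (ν p) (nab Γ Y (f p) (dd (e i) f p))| ≤ r₀⁻¹
  hess_normal : |G (f p) (ν p) (nab Γ Y (f p) (ν p))| ≤ r₀⁻¹
  cov2 : ∀ i, |G (f p) (ν p) (nab2 Γ Y (f p) (dd (e i) f p) (dd (e i) f p))| ≤ (r₀ ^ 2)⁻¹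

lemma hasDerivAt_rpow_affine {x a : ℝ} (hs : 0 < b - x / r₀) :
    HasDerivAt (fun x => (b - x / r₀) ^ a) (-(a / r₀) * (b - x / r₀) ^ (a - 1)) x := by
  have h1 : HasDerivAt (fun x => b - x / r₀) (-(1 / r₀)) x := by
    simpa using ((hasDerivAt_id x).div_const r₀).const_sub b
  convert h1.rpow_const (p := a) (Or.inl hs.ne') using 1
  ring

variable (h : CoreFlow V G Γ O f ν e τ S H) (ho : OrthoAt G f ν e p) (hp : p ∈ O)
  (hB : FlowBounds G Γ f ν e Y r₀ p) (hr : Sm V r) (hY : Sm V Y)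
  (hrY : ∀ z ∈ V, ∀ v, fderiv ℝ r z v = G z v (Y z)) (hr0 : ∀ q ∈ O, r (f q) ≤ 0)
  (hb : 0 < b)
include h ho hp hB hr hY hrY hr0 hb

/-- The product and chain rules reduce H²□F to s^(-γ) times the left side of `reaction_F_le` with ε
= 1/r₀. Multiplying by the nonnegative weight (1 - p)^(2/γ - 1) then leaves exactly `power_F_le`. -/
lemma CoreFlow.boxE_F_le (hN : 1 ≤ Fintype.card ι) (hγ : 0 < γ) (hγ2 : γ < 1 / 2)
    (hγN : 100 * (Fintype.card ι : ℝ) ≤ 1 / γ) :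
    (1 - G (f p) (ν p) (Y (f p))) ^ (2 / γ - 1) * H p ^ 2 * boxE G Γ f e τ H
        (fun q => (1 - G (f q) (ν q) (Y (f q))) * (b - r (f q) / r₀) ^ (-γ)) p
      ≤ γ / 2 / r₀ ^ 2 * (-(((1 - G (f p) (ν p) (Y (f p))) * (b - r (f p) / r₀) ^ (-γ))
          ^ ((γ + 2) / γ)) + 2 / γ * ((34 * (Fintype.card ι : ℝ) ^ 2
            + 5 * (Fintype.card ι : ℝ) ^ 2 * γ)
              * (2 + 6 * (Fintype.card ι : ℝ) + 68 * (Fintype.card ι : ℝ) ^ 2 / γ))) := by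
  have hr₀ := hB.pos
  have hε : 0 ≤ r₀⁻¹ := by positivity
  have h0 := h.ne_zero hp
  have spos : ∀ q ∈ O, 0 < b - r (f q) / r₀ := fun q hq => by
    have : r (f q) / r₀ ≤ 0 := div_nonpos_of_nonpos_of_nonneg (hr0 q hq) hr₀.le
    linarith
  have sR : Sm O (fun q => r (f q)) := hr.comp h.smf h.mem
  have sP : Sm O (fun q => G (f q) (ν q) (Y (f q))) :=
    h.lc.sm_ip h.smf h.mem h.smν (hY.comp h.smf h.mem)
  have s1P : Sm O (fun q => 1 - G (f q) (ν q) (Y (f q))) :=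
    Sm.sub (fun _ _ => contDiffAt_const) sP
  have sφ : Sm O (fun q => (b - r (f q) / r₀) ^ (-γ)) := fun q hq =>
    (contDiffAt_const.sub ((sR q hq).div_const _)).rpow_const_of_ne (spos q hq).ne'
  set s := b - r (f p) / r₀ with hs
  have hs0 : 0 < s := spos p hp
  set Pp := G (f p) (ν p) (Y (f p)) with hPp
  have ddP : ∀ i, dd (e i) (fun q => 1 - G (f q) (ν q) (Y (f q))) p
      = - (∑ k, S k i p * G (f p) (dd (e k) f p) (Y (f p))
        + G (f p) (ν p) (nab Γ Y (f p) (dd (e i) f p))) := fun i => by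
    rw [dd_sub (differentiableAt_const _) (sP.diff hp), dd_const, zero_sub, h.dd_P ho hp hY]
    simp_rw [h.shape_eq ho hp]
  have ddφ : ∀ i, dd (e i) (fun q => (b - r (f q) / r₀) ^ (-γ)) p
      = γ / r₀ * s ^ (-γ - 1) * G (f p) (dd (e i) f p) (Y (f p)) := fun i => by
    have hd := hasDerivAt_rpow_affine (a := -γ) hs0
    rw [dd_comp (T := fun x => (b - x / r₀) ^ (-γ)) (f := fun q => r (f q)) hd.differentiableAt (sR.diff hp),
      hd.hasFDerivAt.fderiv, h.dd_R ho hp hr hY hrY, ← hs]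
    simp [neg_div]
    ring
  have b1P : boxE G Γ f e τ H (fun q => 1 - G (f q) (ν q) (Y (f q))) p
      = - boxE G Γ f e τ H (fun q => G (f q) (ν q) (Y (f q))) p := by
    have := h.boxE_comp hp (φ := fun x => 1 - x) (φ' := fun _ => -1) (φ'' := 0) sP
      (fun q _ => by simpa using (hasDerivAt_id _).const_sub 1) (hasDerivAt_const _ _)
    rw [this]; ring
  have bφ : boxE G Γ f e τ H (fun q => (b - r (f q) / r₀) ^ (-γ)) p
      = γ / r₀ * s ^ (-γ - 1) * boxE G Γ f e τ H (fun q => r (f q)) p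
        - γ * (γ + 1) / r₀ ^ 2 * s ^ (-γ - 2) / H p ^ 2
          * ∑ i, G (f p) (dd (e i) f p) (Y (f p)) ^ 2 := by
    have := h.boxE_comp hp (φ := fun x => (b - x / r₀) ^ (-γ))
      (φ' := fun x => -(-γ / r₀) * (b - x / r₀) ^ (-γ - 1)) sR
      (fun q hq => hasDerivAt_rpow_affine (spos q hq))
      ((hasDerivAt_rpow_affine hs0).const_mul _)
    rw [this]
    simp_rw [h.dd_R ho hp hr hY hrY]
    rw [← hs, show -γ - 1 - 1 = -γ - 2 by ring]
    ring
  have eP := h.boxE_P ho hp hY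
  have eR := h.boxE_R ho hp hr hY hrY
  have hl := evolution_p_lower (ι := ι) (S := fun k i => S k i p)
    (b := fun k i => G (f p) (dd (e k) f p) (nab Γ Y (f p) (dd (e i) f p)))
    (y := fun i => G (f p) (dd (e i) f p) (Y (f p))) (ε := r₀⁻¹) hN (h.trace p hp) hB.half_le
    hB.unit (by simpa using hB.ric) hB.hess (by simpa using hB.cov2) hB.hess_normal
  rw [← eP] at hl
  have hre := reaction_F_le hε hN hs0 hγ hγN (h.trace p hp) hB.half_le hB.unit
    hB.hess_tangent hB.hess rfl hl
  rw [← eR, ← hPp] at hre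
  have e1 : s ^ (-γ - 1) = s ^ (-γ) / s := Real.rpow_sub_one hs0.ne' _
  have e2 : s ^ (-γ - 2) = s ^ (-γ) / s ^ 2 := by
    rw [show -γ - 2 = -γ - 1 - 1 by ring, Real.rpow_sub_one hs0.ne', e1]; field_simp
  have hbox : H p ^ 2 * boxE G Γ f e τ H
        (fun q => (1 - G (f q) (ν q) (Y (f q))) * (b - r (f q) / r₀) ^ (-γ)) p
      ≤ s ^ (-γ) * (r₀⁻¹ ^ 2 * (34 * (Fintype.card ι : ℝ) ^ 2 + 3 * (Fintype.card ι : ℝ) * γ / s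
        - γ * (1 - Pp) ^ 2 / s ^ 2)) := by
    refine le_trans (le_of_eq ?_) (mul_le_mul_of_nonneg_left hre (by positivity))
    rw [h.boxE_mul hp s1P sφ, b1P, bφ]
    simp_rw [ddP, ddφ]
    rw [e1, e2, ← hPp, ← hs]
    have e3 : ∑ i, -(∑ k, S k i p * G (f p) (dd (e k) f p) (Y (f p))
          + G (f p) (ν p) (nab Γ Y (f p) (dd (e i) f p)))
          * (γ / r₀ * (s ^ (-γ) / s) * G (f p) (dd (e i) f p) (Y (f p)))
        = - (γ / r₀ * (s ^ (-γ) / s)) * ∑ i, (∑ k, S k i p * G (f p) (dd (e k) f p) (Y (f p))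
          + G (f p) (ν p) (nab Γ Y (f p) (dd (e i) f p))) * G (f p) (dd (e i) f p) (Y (f p)) := by
      rw [Finset.mul_sum]
      exact Finset.sum_congr rfl fun i _ => by ring
    rw [e3]
    field_simp
    ring
  have hP1 : Pp ≤ 1 := by
    have := hB.unit
    have h2 : 0 ≤ ∑ i, G (f p) (dd (e i) f p) (Y (f p)) ^ 2 :=
      Finset.sum_nonneg fun i _ => sq_nonneg _
    nlinarith
  have hpow := power_F_le (N := (Fintype.card ι : ℝ)) (Q := 1 - Pp) (by exact_mod_cast hN) hγ hγ2
    (by linarith) (by linarith [hB.half_le]) hs0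
  have hQ : 0 ≤ (1 - Pp) ^ (2 / γ - 1) := Real.rpow_nonneg (by linarith) _
  calc _ = (1 - Pp) ^ (2 / γ - 1) * (H p ^ 2 * boxE G Γ f e τ H
        (fun q => (1 - G (f q) (ν q) (Y (f q))) * (b - r (f q) / r₀) ^ (-γ)) p) := by ring
    _ ≤ (1 - Pp) ^ (2 / γ - 1) * _ := mul_le_mul_of_nonneg_left hbox hQ
    _ = (r₀ ^ 2)⁻¹ * ((1 - Pp) ^ (2 / γ - 1) * (s ^ (-γ) * (34 * (Fintype.card ι : ℝ) ^ 2
        + 3 * (Fintype.card ι : ℝ) * γ / s - γ * (1 - Pp) ^ 2 / s ^ 2))) := by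
      rw [inv_pow]; ring
    _ ≤ (r₀ ^ 2)⁻¹ * _ := mul_le_mul_of_nonneg_left hpow (by positivity)
    _ = _ := by ring

/-- The product and chain rules turn □G into the left side of `reaction_G_le` with u = s^(-γ); the
work lies in checking the range of s and η. -/
lemma CoreFlow.boxE_G_le (hN : 1 ≤ Fintype.card ι) {n : ℕ} (hn : Fintype.card ι + 1 = n)
    {K C : ℝ} (hγ : 0 < γ) (hγ2 : γ < 1 / 2) (hb2 : b < 1 / 2)
    (hlow : -r₀ ≤ r (f p)) (hrb : r (f p) < -(b * r₀))
    (hK : 1 - G (f p) (ν p) (Y (f p)) ≤ K * (b - r (f p) / r₀) ^ γ)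
    (hC : 4 * n + 6 * K ≤ C) :
    boxE G Γ f e τ H (fun q => r₀ * H q
        * ((b - r (f q) / r₀) ^ (1 - γ) - (2 * b) ^ (1 - γ))) p
      ≤ -(r₀ * H p * ((b - r (f p) / r₀) ^ (1 - γ) - (2 * b) ^ (1 - γ))) / n
        + 4 * n / (r₀ * H p * ((b - r (f p) / r₀) ^ (1 - γ) - (2 * b) ^ (1 - γ)))
        + 1 / 2 * (b - r (f p) / r₀) ^ (-γ)
          * (C / (r₀ * H p * ((b - r (f p) / r₀) ^ (1 - γ) - (2 * b) ^ (1 - γ))) - 1) := by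
  have hr₀ := hB.pos
  have h0 := h.ne_zero hp
  have spos : ∀ q ∈ O, 0 < b - r (f q) / r₀ := fun q hq => by
    have : r (f q) / r₀ ≤ 0 := div_nonpos_of_nonpos_of_nonneg (hr0 q hq) hr₀.le
    linarith
  have sR : Sm O (fun q => r (f q)) := hr.comp h.smf h.mem
  have sφ : Sm O (fun q => (b - r (f q) / r₀) ^ (1 - γ) - (2 * b) ^ (1 - γ)) := fun q hq =>
    ((contDiffAt_const.sub ((sR q hq).div_const _)).rpow_const_of_ne (spos q hq).ne').sub
      contDiffAt_const
  have sH : Sm O (fun q => r₀ * H q) := Sm.mul (fun _ _ => contDiffAt_const) h.smH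
  set s := b - r (f p) / r₀ with hs
  have hs0 : 0 < s := spos p hp
  -- Being at depth more than b r₀ means s > 2b, hence η > 0 and division by G is legitimate.
  -- Together with r ≥ -r₀ and b < 1/2 it also places s below 2.
  have hs2b : 2 * b < s := by
    have : r (f p) / r₀ < -b := by rw [div_lt_iff₀ hr₀]; linarith
    linarith
  have hs2 : s ≤ 2 := by
    have : -1 ≤ r (f p) / r₀ := by rw [le_div_iff₀ hr₀]; linarith
    linarith
  have hs1γ : s ^ (1 - γ) = s * s ^ (-γ) := by
    rw [sub_eq_add_neg, Real.rpow_add hs0, Real.rpow_one]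
  have h2b : 0 < (2 * b) ^ (1 - γ) := by positivity
  have hη : 0 < s ^ (1 - γ) - (2 * b) ^ (1 - γ) :=
    sub_pos.2 (Real.rpow_lt_rpow (by positivity) hs2b (by linarith))
  have hη2 : s ^ (1 - γ) ≤ 2 := by
    rcases le_total s 1 with h | h
    · exact (Real.rpow_le_one hs0.le h (by linarith)).trans (by norm_num)
    · have := Real.rpow_le_rpow_of_exponent_le h (show 1 - γ ≤ 1 by linarith)
      rw [Real.rpow_one] at this
      linarith
  have hd : ∀ x, 0 < b - x / r₀ → HasDerivAt (fun x => (b - x / r₀) ^ (1 - γ) - (2 * b) ^ (1 - γ))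
      (-((1 - γ) / r₀) * (b - x / r₀) ^ (1 - γ - 1)) x := fun x hx =>
    (hasDerivAt_rpow_affine (a := 1 - γ) hx).sub_const _
  have e1 : s ^ (1 - γ - 1) = s ^ (-γ) := by congr 1; ring
  have e2 : s ^ (1 - γ - 1 - 1) = s ^ (-γ) / s := by rw [Real.rpow_sub_one hs0.ne', e1]
  have ddφ : ∀ i, dd (e i) (fun q => (b - r (f q) / r₀) ^ (1 - γ) - (2 * b) ^ (1 - γ)) p
      = -((1 - γ) * s ^ (-γ) / r₀) * G (f p) (dd (e i) f p) (Y (f p)) := fun i => by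
    rw [dd_comp (T := fun x => (b - x / r₀) ^ (1 - γ) - (2 * b) ^ (1 - γ))
      (f := fun q => r (f q)) (hd _ hs0).differentiableAt (sR.diff hp), (hd _ hs0).hasFDerivAt.fderiv,
      h.dd_R ho hp hr hY hrY, ← hs, e1]
    simp
    ring
  have ddH : ∀ i, dd (e i) (fun q => r₀ * H q) p = r₀ * dd (e i) H p := fun i => by
    rw [dd_mul (differentiableAt_const _) (h.smH.diff hp), dd_const]; ring
  have bH : boxE G Γ f e τ H (fun q => r₀ * H q) p = r₀ * boxE G Γ f e τ H H p := by
    have := h.boxE_comp hp (φ := fun x => r₀ * x) (φ' := fun _ => r₀) (φ'' := 0) h.smH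
      (fun q _ => by simpa using (hasDerivAt_id _).const_mul r₀) (hasDerivAt_const _ _)
    rw [this]; ring
  have bφ : boxE G Γ f e τ H (fun q => (b - r (f q) / r₀) ^ (1 - γ) - (2 * b) ^ (1 - γ)) p
      = -((1 - γ) * s ^ (-γ) / r₀) * boxE G Γ f e τ H (fun q => r (f q)) p
        - -(γ * (1 - γ) * (s ^ (-γ) / s) / r₀ ^ 2) / H p ^ 2
          * ∑ i, G (f p) (dd (e i) f p) (Y (f p)) ^ 2 := by
    have := h.boxE_comp hp (φ := fun x => (b - x / r₀) ^ (1 - γ) - (2 * b) ^ (1 - γ))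
      (φ' := fun x => -((1 - γ) / r₀) * (b - x / r₀) ^ (1 - γ - 1)) sR
      (fun q hq => hd _ (spos q hq)) ((hasDerivAt_rpow_affine hs0).const_mul _)
    rw [this]
    simp_rw [h.dd_R ho hp hr hY hrY]
    rw [← hs, e1, e2]
    ring
  have eR : boxE G Γ f e τ H (fun q => r (f q)) p = (2 * H p * G (f p) (ν p) (Y (f p))
      - ∑ i, G (f p) (dd (e i) f p) (nab Γ Y (f p) (dd (e i) f p))) / H p ^ 2 := by
    rw [← h.boxE_R ho hp hr hY hrY]; field_simp
  have key := reaction_G_le (S := fun k i => S k i p)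
    (b := fun k i => G (f p) (dd (e k) f p) (nab Γ Y (f p) (dd (e i) f p)))
    (y := fun i => G (f p) (dd (e i) f p) (Y (f p))) (h := fun i => dd (e i) H p) hn hN hr₀ hs0
    hγ hγ2 (u := s ^ (-γ)) (by positivity) hη (by rw [hs1γ] at *; linarith) (by linarith)
    (h.pos p hp) (h.trace p hp) rfl hB.half_le hB.unit hB.hess rfl hB.ric_normal (K := K)
    (by
      have := mul_le_mul_of_nonneg_right hK (show 0 ≤ s ^ (-γ) by positivity)
      rwa [mul_assoc, ← Real.rpow_add hs0, add_neg_cancel, Real.rpow_zero, mul_one] at this) hC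
  refine le_trans (le_of_eq ?_) key
  rw [h.boxE_mul hp sH sφ, bH, bφ, eR, h.boxE_H ho hp]
  simp_rw [ddH, ddφ]
  rw [← hs]

end CoreInequalities

/-! ### Tangent vectors, vector fields and Lie brackets read in a chart -/

section Charts

variable {k : ℕ} {M : Type*} [TopologicalSpace M] [ChartedSpace (EuclideanSpace ℝ (Fin k)) M]
  [IsManifold (𝓡 k) ∞ M] {F : Type*} [NormedAddCommGroup F] [NormedSpace ℝ F]

/-- The coordinates of tangent vectors at `y` in the preferred chart at `q`. -/
def kap (q y : M) : TangentSpace (𝓡 k) y →L[ℝ] EuclideanSpace ℝ (Fin k) :=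
  (trivializationAt (EuclideanSpace ℝ (Fin k)) (TangentSpace (𝓡 k)) q).continuousLinearMapAt ℝ y

/-- The tangent vector at `y` with given coordinates in the preferred chart at `q`. -/
def lam (q y : M) : EuclideanSpace ℝ (Fin k) →L[ℝ] TangentSpace (𝓡 k) y :=
  (trivializationAt (EuclideanSpace ℝ (Fin k)) (TangentSpace (𝓡 k)) q).symmL ℝ y

/-- The vector field `Y` in the preferred chart at `q`. -/
def vhat (q : M) (Y : VField k M) (z : EuclideanSpace ℝ (Fin k)) : EuclideanSpace ℝ (Fin k) :=
  kap q ((extChartAt (𝓡 k) q).symm z) (Y ((extChartAt (𝓡 k) q).symm z))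

variable {q y : M}

lemma kap_lam (hy : y ∈ (extChartAt (𝓡 k) q).source) (u : EuclideanSpace ℝ (Fin k)) :
    kap q y (lam q y u) = u := by
  refine Trivialization.continuousLinearMapAt_symmL _ ?_ u
  simpa using hy

lemma lam_kap (hy : y ∈ (extChartAt (𝓡 k) q).source) (v : TangentSpace (𝓡 k) y) :
    lam q y (kap q y v) = v := by
  refine Trivialization.symmL_continuousLinearMapAt _ ?_ v
  simpa using hy

lemma kap_eq_snd (hy : y ∈ (extChartAt (𝓡 k) q).source) (v : TangentSpace (𝓡 k) y) :
    kap q y v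
      = (trivializationAt (EuclideanSpace ℝ (Fin k)) (TangentSpace (𝓡 k)) q ⟨y, v⟩).2 := by
  rw [kap, Trivialization.continuousLinearMapAt_apply, Trivialization.linearMapAt_apply,
    if_pos (by simpa using hy)]

lemma kap_eq_mfderiv (hy : y ∈ (extChartAt (𝓡 k) q).source) :
    kap q y = mfderiv (𝓡 k) 𝓘(ℝ, EuclideanSpace ℝ (Fin k)) (extChartAt (𝓡 k) q) y :=
  TangentBundle.continuousLinearMapAt_trivializationAt (by simpa using hy)

lemma kap_self (v : TangentSpace (𝓡 k) q) : kap q q v = v := by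
  rw [kap_eq_mfderiv (mem_extChartAt_source q), mfderiv_extChartAt_self]
  rfl

lemma hasMFDerivAt_chart (hy : y ∈ (extChartAt (𝓡 k) q).source) :
    HasMFDerivAt (𝓡 k) 𝓘(ℝ, EuclideanSpace ℝ (Fin k)) (extChartAt (𝓡 k) q) y (kap q y) := by
  rw [kap_eq_mfderiv hy]
  exact (mdifferentiableAt_extChartAt (by simpa using hy)).hasMFDerivAt

lemma extendVec_eq_lam {x y : M} (hy : y ∈ (extChartAt (𝓡 k) x).source)
    (v : TangentSpace (𝓡 k) x) : extendVec v y = lam x y (kap x x v) := by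
  rw [kap_eq_snd (mem_extChartAt_source x), extendVec, extend, lam]
  exact (Trivialization.symmL_apply (R := ℝ) _ (by simpa using hy) _).symm

lemma extendVec_self {x : M} (v : TangentSpace (𝓡 k) x) : extendVec v x = v :=
  extend_apply_self _ v

/-- At the centre of its own chart the extension has constant coordinates. In a chart centred
elsewhere it does not, which is why second order quantities are computed at chart centres. -/
lemma vhat_extendVec {z : EuclideanSpace ℝ (Fin k)} (hz : z ∈ (extChartAt (𝓡 k) q).target)
    (v : TangentSpace (𝓡 k) q) : vhat q (extendVec v) z = v := by
  have hs := (extChartAt (𝓡 k) q).map_target hz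
  rw [vhat, extendVec_eq_lam hs, kap_lam hs, kap_self]

lemma vhat_chart (hy : y ∈ (extChartAt (𝓡 k) q).source) (Y : VField k M) :
    vhat q Y (extChartAt (𝓡 k) q y) = kap q y (Y y) := by
  rw [vhat, (extChartAt (𝓡 k) q).left_inv hy]

lemma mvfderiv_eq {u : M → F} (hy : y ∈ (extChartAt (𝓡 k) q).source)
    (hu : DifferentiableAt ℝ (fun z => u ((extChartAt (𝓡 k) q).symm z)) (extChartAt (𝓡 k) q y))
    (v : TangentSpace (𝓡 k) y) :
    mvfderiv (𝓡 k) u y v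
      = fderiv ℝ (fun z => u ((extChartAt (𝓡 k) q).symm z)) (extChartAt (𝓡 k) q y)
          (kap q y v) := by
  have h1 := (hu.hasFDerivAt.hasMFDerivAt).comp y (hasMFDerivAt_chart hy)
  have h2 : u =ᶠ[𝓝 y] (fun z => u ((extChartAt (𝓡 k) q).symm z)) ∘ extChartAt (𝓡 k) q := by
    filter_upwards [(isOpen_extChartAt_source q).mem_nhds hy] with x hx
    rw [Function.comp_apply, (extChartAt (𝓡 k) q).left_inv hx]
  have h3 := (h1.congr_of_eventuallyEq h2).mfderiv
  rw [mvfderiv, h3]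
  rfl

lemma mdifferentiableAt_iff_chart {u : M → F} (hy : y ∈ (extChartAt (𝓡 k) q).source) :
    MDifferentiableAt (𝓡 k) 𝓘(ℝ, F) u y ↔
      DifferentiableAt ℝ (fun z => u ((extChartAt (𝓡 k) q).symm z)) (extChartAt (𝓡 k) q y) := by
  constructor
  · intro h
    have hz : extChartAt (𝓡 k) q y ∈ (extChartAt (𝓡 k) q).target :=
      (extChartAt (𝓡 k) q).map_source hy
    have h1 := (mdifferentiableOn_extChartAt_symm (I := 𝓡 k) (x := q) _ hz).mdifferentiableAt
      ((isOpen_extChartAt_target q).mem_nhds hz)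
    rw [← mdifferentiableAt_iff_differentiableAt]
    refine MDifferentiableAt.comp (I' := 𝓡 k) (extChartAt (𝓡 k) q y) (g := u) ?_ h1
    rwa [(extChartAt (𝓡 k) q).left_inv hy]
  · intro h
    have h1 := (h.hasFDerivAt.hasMFDerivAt).comp y (hasMFDerivAt_chart hy)
    refine (h1.congr_of_eventuallyEq ?_).mdifferentiableAt
    filter_upwards [(isOpen_extChartAt_source q).mem_nhds hy] with x hx
    rw [Function.comp_apply, (extChartAt (𝓡 k) q).left_inv hx]

lemma mdifferentiableAt_section_iff_vhat (hy : y ∈ (extChartAt (𝓡 k) q).source)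
    {Y : VField k M} :
    MDifferentiableAt (𝓡 k) ((𝓡 k).prod 𝓘(ℝ, EuclideanSpace ℝ (Fin k)))
      (fun x => (⟨x, Y x⟩ : TangentBundle (𝓡 k) M)) y
      ↔ DifferentiableAt ℝ (vhat q Y) (extChartAt (𝓡 k) q y) := by
  have := (trivializationAt (EuclideanSpace ℝ (Fin k)) (TangentSpace (𝓡 k) (M := M))
    q).mdifferentiableAt_section_iff (𝓡 k) (s := Y) (b₀ := y) (by simpa using hy)
  rw [this, mdifferentiableAt_iff_chart hy]
  have hz : extChartAt (𝓡 k) q y ∈ (extChartAt (𝓡 k) q).target :=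
      (extChartAt (𝓡 k) q).map_source hy
  refine Filter.EventuallyEq.differentiableAt_iff ?_
  filter_upwards [(isOpen_extChartAt_target q).mem_nhds hz] with z hz
  rw [vhat, kap_eq_snd ((extChartAt (𝓡 k) q).map_target hz)]

lemma differentiableAt_vhat_extendVec (hy : y ∈ (extChartAt (𝓡 k) q).source)
    (v : TangentSpace (𝓡 k) y) :
    DifferentiableAt ℝ (vhat q (extendVec v)) (extChartAt (𝓡 k) q y) :=
  (mdifferentiableAt_section_iff_vhat hy).1 (mdifferentiableAt_extend (𝓡 k) _ v)

lemma mfderiv_chart_symm {z : EuclideanSpace ℝ (Fin k)} (hz : z ∈ (extChartAt (𝓡 k) q).target) :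
    mfderiv 𝓘(ℝ, EuclideanSpace ℝ (Fin k)) (𝓡 k) (extChartAt (𝓡 k) q).symm z
      = lam q ((extChartAt (𝓡 k) q).symm z) := by
  have hs := (extChartAt (𝓡 k) q).map_target hz
  have := TangentBundle.symmL_trivializationAt (I := 𝓡 k) (x₀ := q)
    (x := (extChartAt (𝓡 k) q).symm z) (by simpa using hs)
  rw [lam, this, (extChartAt (𝓡 k) q).right_inv hz, ModelWithCorners.range_eq_univ, mfderivWithin_univ]

lemma mlieBracket_vectorSpace {E : Type*} [NormedAddCommGroup E] [NormedSpace ℝ E]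
    (X Y : ∀ x : E, TangentSpace 𝓘(ℝ, E) x) (x : E) :
    VectorField.mlieBracket 𝓘(ℝ, E) X Y x = VectorField.lieBracket ℝ X Y x := by
  rw [← VectorField.mlieBracketWithin_univ, VectorField.mlieBracketWithin_eq_lieBracketWithin]
  exact congrFun VectorField.lieBracketWithin_univ x

/-- The bracket is natural under pullback by the inverse chart, and the pullback of a field is its
coordinate expression `vhat`. -/
lemma kap_mlieBracket (hy : y ∈ (extChartAt (𝓡 k) q).source) {X Y : VField k M}
    (hX : DifferentiableAt ℝ (vhat q X) (extChartAt (𝓡 k) q y))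
    (hY : DifferentiableAt ℝ (vhat q Y) (extChartAt (𝓡 k) q y)) :
    kap q y (VectorField.mlieBracket (𝓡 k) X Y y)
      = fderiv ℝ (vhat q Y) (extChartAt (𝓡 k) q y) (kap q y (X y))
        - fderiv ℝ (vhat q X) (extChartAt (𝓡 k) q y) (kap q y (Y y)) := by
  have hz : extChartAt (𝓡 k) q y ∈ (extChartAt (𝓡 k) q).target :=
    (extChartAt (𝓡 k) q).map_source hy
  have hinv : ∀ z ∈ (extChartAt (𝓡 k) q).target,
      (mfderiv 𝓘(ℝ, EuclideanSpace ℝ (Fin k)) (𝓡 k) (extChartAt (𝓡 k) q).symm z).inverse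
        = kap q ((extChartAt (𝓡 k) q).symm z) := fun z hz => by
    rw [mfderiv_chart_symm hz]
    have hs := (extChartAt (𝓡 k) q).map_target hz
    exact ContinuousLinearMap.inverse_eq (by ext1 v; exact lam_kap hs v)
      (by ext1 v; exact kap_lam hs v)
  have hpull : ∀ X : VField k M, VectorField.mpullback 𝓘(ℝ, EuclideanSpace ℝ (Fin k)) (𝓡 k)
      (extChartAt (𝓡 k) q).symm X =ᶠ[𝓝 (extChartAt (𝓡 k) q y)] vhat q X := fun X => by
    filter_upwards [(isOpen_extChartAt_target q).mem_nhds hz] with z hz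
    rw [VectorField.mpullback_apply, hinv z hz]
    rfl
  have : IsManifold (𝓡 k) (minSmoothness ℝ 2) M := by
    rw [minSmoothness_of_isRCLikeNormedField]; infer_instance
  have e := VectorField.mpullback_mlieBracket (I := 𝓘(ℝ, EuclideanSpace ℝ (Fin k))) (I' := 𝓡 k)
    (f := (extChartAt (𝓡 k) q).symm) (V := X) (W := Y) (x₀ := extChartAt (𝓡 k) q y) (n := 2)
    (by rw [(extChartAt (𝓡 k) q).left_inv hy]
        exact (mdifferentiableAt_section_iff_vhat hy).2 hX)
    (by rw [(extChartAt (𝓡 k) q).left_inv hy]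
        exact (mdifferentiableAt_section_iff_vhat hy).2 hY)
    ((contMDiffOn_extChartAt_symm (I := 𝓡 k) (n := 2) q).contMDiffAt
      ((isOpen_extChartAt_target q).mem_nhds hz))
    (by simp)
  rw [VectorField.mpullback_apply, hinv _ hz,
    (hpull X).mlieBracket_vectorField_eq (hpull Y)] at e
  have e2 := mlieBracket_vectorSpace (E := EuclideanSpace ℝ (Fin k)) (vhat q X) (vhat q Y)
    (extChartAt (𝓡 k) q y)
  have e4 : kap q ((extChartAt (𝓡 k) q).symm (extChartAt (𝓡 k) q y))
      (VectorField.mlieBracket (𝓡 k) X Y ((extChartAt (𝓡 k) q).symm (extChartAt (𝓡 k) q y)))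
      = kap q y (VectorField.mlieBracket (𝓡 k) X Y y) := by
    have h : ∀ y', y' = y → kap q y' (VectorField.mlieBracket (𝓡 k) X Y y')
        = kap q y (VectorField.mlieBracket (𝓡 k) X Y y) := fun y' h => by rw [h]
    exact h _ ((extChartAt (𝓡 k) q).left_inv hy)
  refine e4.symm.trans (e.trans (e2.trans ?_))
  rw [VectorField.lieBracket, vhat_chart hy, vhat_chart hy]

end Charts

/-! ### Connection, curvature and Hessian of a metric read in a chart -/

section MetricCoord

variable {k : ℕ} {M : Type*} [TopologicalSpace M] [ChartedSpace (EuclideanSpace ℝ (Fin k)) M]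
  [IsManifold (𝓡 k) ∞ M]

/-- In the preferred chart at `q` and over `V`, the metric `g` is given by the smooth positive
definite metric `G`, with Christoffel symbol `Γ`. -/
structure MetricCoord (g : MetricField k M) (q : M) (V : Set (EuclideanSpace ℝ (Fin k)))
    (G : EuclideanSpace ℝ (Fin k) →
      EuclideanSpace ℝ (Fin k) →L[ℝ] EuclideanSpace ℝ (Fin k) →L[ℝ] ℝ)
    (Γ : EuclideanSpace ℝ (Fin k) →
      EuclideanSpace ℝ (Fin k) →L[ℝ] EuclideanSpace ℝ (Fin k) →L[ℝ] EuclideanSpace ℝ (Fin k)) :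
    Prop where
  lc : IsLC V G Γ
  sub : V ⊆ (extChartAt (𝓡 k) q).target
  posG : ∀ z ∈ V, ∀ u, u ≠ 0 → 0 < G z u u
  eq : ∀ y ∈ (extChartAt (𝓡 k) q).source, extChartAt (𝓡 k) q y ∈ V →
    ∀ u v : TangentSpace (𝓡 k) y, g y u v = G (extChartAt (𝓡 k) q y) (kap q y u) (kap q y v)

namespace MetricCoord

variable {g : MetricField k M} {q y : M} {V : Set (EuclideanSpace ℝ (Fin k))}
  {G : EuclideanSpace ℝ (Fin k) →
      EuclideanSpace ℝ (Fin k) →L[ℝ] EuclideanSpace ℝ (Fin k) →L[ℝ] ℝ}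
  {Γ : EuclideanSpace ℝ (Fin k) →
      EuclideanSpace ℝ (Fin k) →L[ℝ] EuclideanSpace ℝ (Fin k) →L[ℝ] EuclideanSpace ℝ (Fin k)}
  {X Y Z : VField k M}

lemma nondeg (h : MetricCoord g q V G Γ) {z u v : EuclideanSpace ℝ (Fin k)} (hz : z ∈ V)
    (huv : ∀ w, G z u w = G z v w) : u = v := by
  by_contra hne
  have h1 := h.posG z hz (u - v) (sub_ne_zero.2 hne)
  have h2 : G z (u - v) = 0 := by
    ext w
    rw [map_sub, sub_apply, huv, sub_self, zero_apply]
  rw [h2] at h1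
  exact lt_irrefl _ h1

lemma eq_symm (h : MetricCoord g q V G Γ) {z : EuclideanSpace ℝ (Fin k)} (hz : z ∈ V) :
    g ((extChartAt (𝓡 k) q).symm z) (X ((extChartAt (𝓡 k) q).symm z))
      (Y ((extChartAt (𝓡 k) q).symm z)) = G z (vhat q X z) (vhat q Y z) := by
  have e := (extChartAt (𝓡 k) q).right_inv (h.sub hz)
  rw [h.eq _ ((extChartAt (𝓡 k) q).map_target (h.sub hz)) (by rwa [e]), e]
  rfl

lemma mvfderiv_ip (h : MetricCoord g q V G Γ) (hy : y ∈ (extChartAt (𝓡 k) q).source)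
    (hV : extChartAt (𝓡 k) q y ∈ V)
    (hX : DifferentiableAt ℝ (vhat q X) (extChartAt (𝓡 k) q y))
    (hY : DifferentiableAt ℝ (vhat q Y) (extChartAt (𝓡 k) q y)) (v : TangentSpace (𝓡 k) y) :
    mvfderiv (𝓡 k) (fun y => g y (X y) (Y y)) y v
      = G (extChartAt (𝓡 k) q y)
          (nab Γ (vhat q X) (extChartAt (𝓡 k) q y) (kap q y v)) (kap q y (Y y))
        + G (extChartAt (𝓡 k) q y) (kap q y (X y))
          (nab Γ (vhat q Y) (extChartAt (𝓡 k) q y) (kap q y v)) := by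
  have e : (fun z => g ((extChartAt (𝓡 k) q).symm z) (X ((extChartAt (𝓡 k) q).symm z))
      (Y ((extChartAt (𝓡 k) q).symm z))) =ᶠ[𝓝 (extChartAt (𝓡 k) q y)]
      fun z => G z (vhat q X z) (vhat q Y z) := by
    filter_upwards [h.lc.isOpen.mem_nhds hV] with z hz using h.eq_symm hz
  rw [mvfderiv_eq hy (e.differentiableAt_iff.2
    (((h.lc.smG.diff hV).clm_apply hX).clm_apply hY)), e.fderiv_eq]
  have h1 := h.lc.dd_ip (a := kap q y v) (f := fun z => z) (p := extChartAt (𝓡 k) q y) hV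
    differentiableAt_id hX hY
  have did : dd (kap q y v) (fun z : EuclideanSpace ℝ (Fin k) => z) (extChartAt (𝓡 k) q y)
    = kap q y v := by simp [dd]
  simp only [covD, did] at h1
  rw [vhat_chart hy, vhat_chart hy] at h1
  simp only [nab_apply, vhat_chart hy]
  exact h1

lemma kap_mlieBracket' (h : MetricCoord g q V G Γ) (hy : y ∈ (extChartAt (𝓡 k) q).source)
    (hV : extChartAt (𝓡 k) q y ∈ V)
    (hX : DifferentiableAt ℝ (vhat q X) (extChartAt (𝓡 k) q y))
    (hY : DifferentiableAt ℝ (vhat q Y) (extChartAt (𝓡 k) q y)) :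
    kap q y (VectorField.mlieBracket (𝓡 k) X Y y)
      = nab Γ (vhat q Y) (extChartAt (𝓡 k) q y) (kap q y (X y))
        - nab Γ (vhat q X) (extChartAt (𝓡 k) q y) (kap q y (Y y)) := by
  rw [kap_mlieBracket hy hX hY, nab_apply, nab_apply, vhat_chart hy, vhat_chart hy,
    h.lc.symmΓ _ hV (kap q y (Y y))]
  abel

/-- Metric compatibility expands the three derivatives and torsion-freeness the three brackets; all
terms but one, occurring twice, cancel. -/
lemma koszul_eq (h : MetricCoord g q V G Γ) (hy : y ∈ (extChartAt (𝓡 k) q).source)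
    (hV : extChartAt (𝓡 k) q y ∈ V)
    (hX : DifferentiableAt ℝ (vhat q X) (extChartAt (𝓡 k) q y))
    (hY : DifferentiableAt ℝ (vhat q Y) (extChartAt (𝓡 k) q y))
    (hZ : DifferentiableAt ℝ (vhat q Z) (extChartAt (𝓡 k) q y)) :
    koszul g X Y Z y = G (extChartAt (𝓡 k) q y)
      (nab Γ (vhat q Y) (extChartAt (𝓡 k) q y) (kap q y (X y))) (kap q y (Z y)) := by
  have hs := h.lc.symmG _ hV
  rw [koszul, h.mvfderiv_ip hy hV hY hZ, h.mvfderiv_ip hy hV hZ hX, h.mvfderiv_ip hy hV hX hY,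
    h.eq y hy hV, h.eq y hy hV, h.eq y hy hV, h.kap_mlieBracket' hy hV hX hY,
    h.kap_mlieBracket' hy hV hX hZ, h.kap_mlieBracket' hy hV hY hZ]
  simp only [map_sub, sub_apply]
  rw [hs (kap q y (Y y)), hs (kap q y (Z y)), hs (kap q y (X y))]
  ring

/-- The coordinate connection solves Koszul's equation, so the existential in the definition holds,
and nondegeneracy of `G` identifies the chosen solution with it. The point `y` need not be the
centre of the chart. -/
theorem kap_leviCivita (h : MetricCoord g q V G Γ) (hy : y ∈ (extChartAt (𝓡 k) q).source)
    (hV : extChartAt (𝓡 k) q y ∈ V)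
    (hY : DifferentiableAt ℝ (vhat q Y) (extChartAt (𝓡 k) q y)) (v : TangentSpace (𝓡 k) y) :
    kap q y (leviCivita g Y y v) = nab Γ (vhat q Y) (extChartAt (𝓡 k) q y) (kap q y v) := by
  have key : ∀ v z : TangentSpace (𝓡 k) y, koszul g (extendVec v) Y (extendVec z) y
      = G (extChartAt (𝓡 k) q y) (nab Γ (vhat q Y) (extChartAt (𝓡 k) q y) (kap q y v))
        (kap q y z) := fun v z => by
    rw [h.koszul_eq hy hV (differentiableAt_vhat_extendVec hy v) hY
      (differentiableAt_vhat_extendVec hy z), extendVec_self, extendVec_self]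
  have hex : ∃ L : TangentSpace (𝓡 k) y →ₗ[ℝ] TangentSpace (𝓡 k) y,
      ∀ v z : TangentSpace (𝓡 k) y, g y (L v) z = koszul g (extendVec v) Y (extendVec z) y := by
    refine ⟨((lam q y).comp ((nab Γ (vhat q Y) (extChartAt (𝓡 k) q y)).comp (kap q y))).toLinearMap,
      fun v z => ?_⟩
    rw [key, h.eq y hy hV]
    congr 2
    exact kap_lam hy _
  rw [leviCivita, dif_pos hex]
  refine h.nondeg hV fun w => ?_
  have h1 := (hex.choose_spec v (lam q y w)).trans (key v _)
  rw [h.eq y hy hV, kap_lam hy] at h1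
  exact h1

lemma vhat_covField (h : MetricCoord g q V G Γ) {z : EuclideanSpace ℝ (Fin k)} (hz : z ∈ V)
    (hY : DifferentiableAt ℝ (vhat q Y) z) :
    vhat q (covField g X Y) z = nab Γ (vhat q Y) z (vhat q X z) := by
  have e := (extChartAt (𝓡 k) q).right_inv (h.sub hz)
  have := h.kap_leviCivita (Y := Y) ((extChartAt (𝓡 k) q).map_target (h.sub hz)) (by rwa [e])
    (by rwa [e]) (X ((extChartAt (𝓡 k) q).symm z))
  rw [e] at this
  exact this

lemma vhat_extendVec_eventuallyEq (h : MetricCoord g q V G Γ) {z : EuclideanSpace ℝ (Fin k)}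
    (hz : z ∈ V) (v : TangentSpace (𝓡 k) q) :
    vhat q (extendVec v) =ᶠ[𝓝 z] fun _ => kap q q v := by
  filter_upwards [h.lc.isOpen.mem_nhds hz] with z hz
  rw [vhat_extendVec (h.sub hz), kap_self]

lemma sm_vhat_extendVec (h : MetricCoord g q V G Γ) (v : TangentSpace (𝓡 k) q) :
    Sm V (vhat q (extendVec v)) := fun _ hz =>
  contDiffAt_const.congr_of_eventuallyEq (h.vhat_extendVec_eventuallyEq hz v)

lemma nab_vhat_extendVec (h : MetricCoord g q V G Γ) (w : TangentSpace (𝓡 k) q)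
    {z : EuclideanSpace ℝ (Fin k)} (hz : z ∈ V) :
    nab Γ (vhat q (extendVec w)) z = (Γ z).flip (kap q q w) := by
  have e := h.vhat_extendVec_eventuallyEq hz w
  rw [nab, e.fderiv_eq, e.eq_of_nhds]
  simp

lemma kap_leviCivita_extendVec (h : MetricCoord g q V G Γ) (hV : extChartAt (𝓡 k) q q ∈ V)
    (w v : TangentSpace (𝓡 k) q) :
    kap q q (leviCivita g (extendVec w) q v)
      = Γ (extChartAt (𝓡 k) q q) (kap q q v) (kap q q w) := by
  rw [h.kap_leviCivita (mem_extChartAt_source q) hV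
    (differentiableAt_vhat_extendVec (mem_extChartAt_source q) w), h.nab_vhat_extendVec w hV]
  rfl

lemma vhat_covField_extendVec (h : MetricCoord g q V G Γ) (hY : Sm V (vhat q Y))
    (v : TangentSpace (𝓡 k) q) {z : EuclideanSpace ℝ (Fin k)} (hz : z ∈ V) :
    vhat q (covField g (extendVec v) Y) z = nab Γ (vhat q Y) z (kap q q v) := by
  rw [h.vhat_covField hz (hY.diff hz), (h.vhat_extendVec_eventuallyEq hz v).eq_of_nhds]

lemma kap_leviCivita_covField (h : MetricCoord g q V G Γ) (hV : extChartAt (𝓡 k) q q ∈ V)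
    (hY : Sm V (vhat q Y)) (u v : TangentSpace (𝓡 k) q) :
    kap q q (leviCivita g (covField g (extendVec v) Y) q u)
      = fderiv ℝ (nab Γ (vhat q Y)) (extChartAt (𝓡 k) q q) (kap q q u) (kap q q v)
        + Γ (extChartAt (𝓡 k) q q) (kap q q u)
          (nab Γ (vhat q Y) (extChartAt (𝓡 k) q q) (kap q q v)) := by
  have e : vhat q (covField g (extendVec v) Y) =ᶠ[𝓝 (extChartAt (𝓡 k) q q)]
      fun z => nab Γ (vhat q Y) z (kap q q v) := by
    filter_upwards [h.lc.isOpen.mem_nhds hV] with z hz using h.vhat_covField_extendVec hY v hz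
  have hd := ((h.lc.sm_nab hY).diff hV).clm_apply (differentiableAt_const (c := kap q q v))
  rw [h.kap_leviCivita (mem_extChartAt_source q) hV (e.differentiableAt_iff.2 hd), nab_apply,
    e.fderiv_eq, e.eq_of_nhds]
  have := dd_clm_apply (a := kap q q u) (T := nab Γ (vhat q Y))
    ((h.lc.sm_nab hY).diff hV) (differentiableAt_const (c := kap q q v))
  rw [dd_const, map_zero, add_zero] at this
  exact congrArg (· + _) this

/-- At the chart centre the auxiliary extension of `v` is constant, so its covariant derivative is
just the Christoffel term subtracted in `nab2`. -/
theorem kap_cov2 (h : MetricCoord g q V G Γ) (hV : extChartAt (𝓡 k) q q ∈ V)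
    (hY : Sm V (vhat q Y)) (u v : TangentSpace (𝓡 k) q) :
    kap q q (cov2 g Y q u v)
      = nab2 Γ (vhat q Y) (extChartAt (𝓡 k) q q) (kap q q u) (kap q q v) := by
  rw [cov2, map_sub, h.kap_leviCivita_covField hV hY,
    h.kap_leviCivita (mem_extChartAt_source q) hV (hY.diff hV), h.kap_leviCivita_extendVec hV, nab2]

lemma fderiv_nab_extendVec (h : MetricCoord g q V G Γ) (u v : EuclideanSpace ℝ (Fin k))
    (w : TangentSpace (𝓡 k) q) {z : EuclideanSpace ℝ (Fin k)} (hz : z ∈ V) :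
    fderiv ℝ (nab Γ (vhat q (extendVec w))) z u v = fderiv ℝ Γ z u v (kap q q w) := by
  have h1 := dd_clm_apply (a := u) ((h.lc.sm_nab (h.sm_vhat_extendVec w)).diff hz)
    (differentiableAt_const (c := v))
  have h2 := dd_comp_apply₂ (a := u) (T := Γ) (f := fun z => z) (h.lc.smΓ.diff hz)
    differentiableAt_id (differentiableAt_const (c := v)) (differentiableAt_const (c := kap q q w))
  have h3 := dd_congr (a := u) h.lc.isOpen
    (u := fun z => nab Γ (vhat q (extendVec w)) z v) (v := fun z => Γ z v (kap q q w))
    (fun z hz => by rw [h.nab_vhat_extendVec w hz]; rfl) hz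
  rw [h3, h2] at h1
  simpa [dd_const, dd] using h1.symm

/-- The extensions have constant coordinates near the chart centre: their bracket vanishes and the
covariant derivatives reduce to `Γ` and its derivative. -/
theorem kap_curv (h : MetricCoord g q V G Γ) (hV : extChartAt (𝓡 k) q q ∈ V)
    (u v w : TangentSpace (𝓡 k) q) :
    kap q q (curv g q u v w)
      = Rm Γ (extChartAt (𝓡 k) q q) (kap q q u) (kap q q v) (kap q q w) := by
  have hb : VectorField.mlieBracket (𝓡 k) (extendVec u) (extendVec v) q = 0 := by
    have := kap_mlieBracket (mem_extChartAt_source q)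
      (differentiableAt_vhat_extendVec (mem_extChartAt_source q) u)
      (differentiableAt_vhat_extendVec (mem_extChartAt_source q) v)
    rw [(h.vhat_extendVec_eventuallyEq hV u).fderiv_eq,
      (h.vhat_extendVec_eventuallyEq hV v).fderiv_eq, fderiv_fun_const, fderiv_fun_const] at this
    simp only [Pi.zero_apply, zero_apply, sub_zero] at this
    rwa [kap_self] at this
  rw [curv, hb, map_zero, sub_zero, map_sub, h.kap_leviCivita_covField hV (h.sm_vhat_extendVec w),
    h.kap_leviCivita_covField hV (h.sm_vhat_extendVec w), h.fderiv_nab_extendVec _ _ w hV,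
    h.fderiv_nab_extendVec _ _ w hV, h.nab_vhat_extendVec w hV, Rm]
  simp only [ContinuousLinearMap.flip_apply]
  abel

lemma mvfderiv_extendVec {f : M → ℝ} (h : MetricCoord g q V G Γ)
    (hf : Sm V (fun z => f ((extChartAt (𝓡 k) q).symm z))) (w : TangentSpace (𝓡 k) q)
    {z : EuclideanSpace ℝ (Fin k)} (hz : z ∈ V) :
    mvfderiv (𝓡 k) f ((extChartAt (𝓡 k) q).symm z) (extendVec w ((extChartAt (𝓡 k) q).symm z))
      = fderiv ℝ (fun z => f ((extChartAt (𝓡 k) q).symm z)) z (kap q q w) := by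
  have e := (extChartAt (𝓡 k) q).right_inv (h.sub hz)
  have hs := (extChartAt (𝓡 k) q).map_target (h.sub hz)
  rw [mvfderiv_eq hs (by rw [e]; exact hf.diff hz), e]
  congr 1
  exact (h.vhat_extendVec_eventuallyEq hz w).eq_of_nhds

theorem hessian_eq {f : M → ℝ} (h : MetricCoord g q V G Γ) (hV : extChartAt (𝓡 k) q q ∈ V)
    (hf : Sm V (fun z => f ((extChartAt (𝓡 k) q).symm z))) (v w : TangentSpace (𝓡 k) q) :
    hessian g f q v w
      = dd (kap q q v) (dd (kap q q w)
          (fun z => f ((extChartAt (𝓡 k) q).symm z))) (extChartAt (𝓡 k) q q)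
        - fderiv ℝ (fun z => f ((extChartAt (𝓡 k) q).symm z)) (extChartAt (𝓡 k) q q)
          (Γ (extChartAt (𝓡 k) q q) (kap q q v) (kap q q w)) := by
  have hs := mem_extChartAt_source (I := 𝓡 k) q
  have e : (fun z => mvfderiv (𝓡 k) f ((extChartAt (𝓡 k) q).symm z)
      (extendVec w ((extChartAt (𝓡 k) q).symm z))) =ᶠ[𝓝 (extChartAt (𝓡 k) q q)]
      dd (kap q q w) (fun z => f ((extChartAt (𝓡 k) q).symm z)) := by
    filter_upwards [h.lc.isOpen.mem_nhds hV] with z hz using h.mvfderiv_extendVec hf w hz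
  rw [hessian, mvfderiv_eq hs (e.differentiableAt_iff.2 ((hf.dd _).diff hV)), e.fderiv_eq,
    mvfderiv_eq hs (hf.diff hV), h.kap_leviCivita_extendVec hV]
  rfl

/-- Differentiate df(w) = ⟨w, Z⟩ with `w` of constant coordinates: the term from ∇_v w cancels the
correction in the Hessian, and ⟨w, ∇_v Z⟩ remains. -/
theorem hessian_eq_nab {f : M → ℝ} (h : MetricCoord g q V G Γ)
    (hV : extChartAt (𝓡 k) q q ∈ V) (hf : Sm V (fun z => f ((extChartAt (𝓡 k) q).symm z)))
    {Z : EuclideanSpace ℝ (Fin k) → EuclideanSpace ℝ (Fin k)} (hZ : Sm V Z)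
    (hfZ : ∀ z ∈ V, ∀ w, fderiv ℝ (fun z => f ((extChartAt (𝓡 k) q).symm z)) z w = G z w (Z z))
    (v w : TangentSpace (𝓡 k) q) :
    hessian g f q v w
      = G (extChartAt (𝓡 k) q q) (kap q q w) (nab Γ Z (extChartAt (𝓡 k) q q) (kap q q v)) := by
  rw [h.hessian_eq hV hf, hfZ _ hV, dd_congr h.lc.isOpen
    (u := dd (kap q q w) (fun z => f ((extChartAt (𝓡 k) q).symm z))) (fun z hz => hfZ z hz _) hV]
  have h1 := h.lc.dd_ip (a := kap q q v) (f := fun z => z)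
    (p := extChartAt (𝓡 k) q q) hV differentiableAt_id
    (differentiableAt_const (c := kap q q w)) (hZ.diff hV)
  have did : dd (kap q q v) (fun z : EuclideanSpace ℝ (Fin k) => z)
    (extChartAt (𝓡 k) q q) = kap q q v := by simp [dd]
  simp only [covD, did, dd_const, zero_add] at h1
  rw [h1, nab_apply]
  simp only [add_sub_cancel_left]
  rfl

end MetricCoord
end MetricCoord

/-! ### Existence of the Levi-Civita connection on an open set of a vector space -/

section Existence

variable {E : Type*} [NormedAddCommGroup E] [NormedSpace ℝ E]
  {F : Type*} [NormedAddCommGroup F] [NormedSpace ℝ F]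
  {P : Type*} [NormedAddCommGroup P] [NormedSpace ℝ P] {O : Set P}
  {V : Set E} {G : E → E →L[ℝ] E →L[ℝ] ℝ} {Γ : E → E →L[ℝ] E →L[ℝ] E}

lemma IsLC.koszul (h : IsLC V G Γ) {z : E} (hz : z ∈ V) (u v w : E) :
    2 * G z (Γ z u v) w
      = fderiv ℝ G z u v w + fderiv ℝ G z v u w - fderiv ℝ G z w u v := by
  rw [h.compat z hz, h.compat z hz, h.compat z hz, h.symmΓ z hz v u, h.symmΓ z hz w u,
    h.symmΓ z hz w v, h.symmG z hz u, h.symmG z hz v]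
  ring

lemma sm_iff_contDiffOn (hO : IsOpen O) {u : P → F} : Sm O u ↔ ContDiffOn ℝ ∞ u O :=
  ⟨fun h p hp => (h p hp).contDiffWithinAt, fun h _ hp => h.contDiffAt (hO.mem_nhds hp)⟩

/-- In finite dimension smoothness of operator-valued maps may be tested on vectors, which reduces
metrics and Christoffel symbols to scalar functions. -/
lemma sm_clm [FiniteDimensional ℝ E] (hO : IsOpen O) {T : P → E →L[ℝ] F}
    (h : ∀ y, Sm O fun p => T p y) : Sm O T :=
  (sm_iff_contDiffOn hO).2 (contDiffOn_clm_apply.2 fun y => (sm_iff_contDiffOn hO).1 (h y))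

/-- The combination `(A + B - C ∘ B) / 2` of continuous linear maps. -/
def halfComb (A B : E →L[ℝ] F) (C : F →L[ℝ] F) : E →L[ℝ] F := (1 / 2 : ℝ) • (A + B - C.comp B)

lemma halfComb_apply (A B : E →L[ℝ] F) (C : F →L[ℝ] F) (u : E) :
    halfComb A B C u = (1 / 2 : ℝ) • (A u + B u - C (B u)) := rfl

set_option synthInstance.maxHeartbeats 200000 in
/-- The Christoffel symbols of the first kind of a metric with derivative `D`. -/
def christoffel (D : E →L[ℝ] E →L[ℝ] E →L[ℝ] ℝ) : E →L[ℝ] E →L[ℝ] E →L[ℝ] ℝ :=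
  halfComb (F := E →L[ℝ] E →L[ℝ] ℝ) D D.flip (ContinuousLinearMap.flipₗᵢ ℝ E E ℝ).toContinuousLinearEquiv

set_option synthInstance.maxHeartbeats 200000 in
lemma christoffel_apply (D : E →L[ℝ] E →L[ℝ] E →L[ℝ] ℝ) (u v w : E) :
    christoffel D u v w = (D u v w + D v u w - D w u v) / 2 := by
  rw [christoffel, halfComb_apply]
  simp only [smul_apply, sub_apply, add_apply, ContinuousLinearMap.flip_apply,
    ContinuousLinearEquiv.coe_coe, LinearIsometryEquiv.coe_toContinuousLinearEquiv,
    ContinuousLinearMap.coe_flipₗᵢ, smul_eq_mul]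
  ring

lemma isInvertible_of_pos [FiniteDimensional ℝ E] {B : E →L[ℝ] E →L[ℝ] ℝ}
    (hB : ∀ u, u ≠ 0 → 0 < B u u) : B.IsInvertible := by
  have hinj : Function.Injective B := by
    refine (injective_iff_map_eq_zero B).2 fun u hu => ?_
    by_contra hne
    have := hB u hne
    rw [hu] at this
    exact lt_irrefl _ this
  have hfin : Module.finrank ℝ E = Module.finrank ℝ (E →L[ℝ] ℝ) := by
    rw [← (LinearMap.toContinuousLinearMap (𝕜 := ℝ) (E := E) (F' := ℝ)).finrank_eq]
    exact (Subspace.dual_finrank_eq (K := ℝ) (V := E)).symm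
  have : FiniteDimensional ℝ (E →L[ℝ] ℝ) := inferInstance
  exact ⟨(LinearEquiv.ofInjectiveOfFinrankEq B.toLinearMap hinj hfin).toContinuousLinearEquiv,
    rfl⟩

lemma Sm.inverse [CompleteSpace E] {T : P → E →L[ℝ] F} (hT : Sm O T)
    (h : ∀ p ∈ O, (T p).IsInvertible) : Sm O fun p => (T p).inverse := fun p hp =>
  (ContinuousLinearMap.IsInvertible.contDiffAt_map_inverse (h p hp)).comp p (hT p hp)

-- The Christoffel symbols of the first kind are raised by the inverse of `G z`, which exists by
-- positivity and depends smoothly on z because inversion is smooth.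
set_option synthInstance.maxHeartbeats 200000 in
theorem exists_isLC [FiniteDimensional ℝ E] (hV : IsOpen V) (hG : Sm V G)
    (hs : ∀ z ∈ V, ∀ u v, G z u v = G z v u) (hpos : ∀ z ∈ V, ∀ u, u ≠ 0 → 0 < G z u u) :
    ∃ Γ, IsLC V G Γ := by
  have : CompleteSpace E := FiniteDimensional.complete ℝ E
  have hinv : ∀ z ∈ V, (G z).IsInvertible := fun z hz => isInvertible_of_pos (hpos z hz)
  have hDs : ∀ z ∈ V, ∀ u v w, fderiv ℝ G z u v w = fderiv ℝ G z u w v := fun z hz u v w => by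
    have hid : DifferentiableAt ℝ (fun z : E => z) z := differentiableAt_id
    have h1 := fun v w : E => dd_comp_apply₂ (a := u) (T := G) (f := fun z => z) (hG.diff hz) hid
      (differentiableAt_const (c := v)) (differentiableAt_const (c := w))
    have h2 := dd_congr (a := u) hV (fun z hz => hs z hz v w) hz
    rw [h1, h1] at h2
    simpa [dd_const, dd] using h2
  have hDG : ∀ u v w, Sm V fun z => fderiv ℝ G z u v w := fun u v w =>
    ((hG.fderiv.clm_apply fun _ _ => contDiffAt_const).clm_apply
      fun _ _ => contDiffAt_const).clm_apply fun _ _ => contDiffAt_const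
  have hc : ∀ u v, Sm V fun z => christoffel (fderiv ℝ G z) u v := fun u v =>
    sm_clm hV fun w => by
      simp only [christoffel_apply, div_eq_mul_inv]
      exact (((hDG u v w).add (hDG v u w)).sub (hDG w u v)).mul fun _ _ => contDiffAt_const
  let Γ : E → E →L[ℝ] E →L[ℝ] E := fun z =>
    (ContinuousLinearMap.compL ℝ E (E →L[ℝ] ℝ) E (G z).inverse).comp (christoffel (fderiv ℝ G z))
  have hΓ : ∀ z u v, Γ z u v = (G z).inverse (christoffel (fderiv ℝ G z) u v) := fun _ _ _ => rfl
  have hGΓ : ∀ z ∈ V, ∀ u v, G z (Γ z u v) = christoffel (fderiv ℝ G z) u v :=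
    fun z hz u v => by
      rw [hΓ]
      obtain ⟨e, he⟩ := hinv z hz
      rw [← he, ContinuousLinearMap.inverse_equiv]
      exact e.apply_symm_apply _
  refine ⟨Γ, hV, hG, ?_, hs, fun z hz u v => ?_, fun z hz u v w => ?_⟩
  · refine sm_clm hV fun u => sm_clm hV fun v => ?_
    simp only [hΓ]
    exact (hG.inverse hinv).clm_apply (hc u v)
  · rw [hΓ, hΓ]
    congr 1
    ext w
    rw [christoffel_apply, christoffel_apply, hDs z hz w u v]
    ring
  · rw [hs z hz v, hGΓ z hz, hGΓ z hz, christoffel_apply, christoffel_apply, hDs z hz u w v]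
    ring

end Existence

/-! ### Covariant derivatives along maps in an arbitrary chart -/

section CoordChange

variable {k : ℕ} {M : Type*} [TopologicalSpace M] [ChartedSpace (EuclideanSpace ℝ (Fin k)) M]
  [IsManifold (𝓡 k) ∞ M]

/-- The change of coordinates of tangent vectors from the chart at `p` to the chart at `q`. -/
def ccoord (p q y : M) : EuclideanSpace ℝ (Fin k) →L[ℝ] EuclideanSpace ℝ (Fin k) :=
  (kap q y).comp (lam p y)

lemma ccoord_kap {p q y : M} (hp : y ∈ (extChartAt (𝓡 k) p).source) (v : TangentSpace (𝓡 k) y) :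
    ccoord p q y (kap p y v) = kap q y v :=
  congrArg (kap q y) (lam_kap hp v)

lemma mdifferentiableAt_ccoord {p q y : M} (hp : y ∈ (extChartAt (𝓡 k) p).source)
    (hq : y ∈ (extChartAt (𝓡 k) q).source) :
    MDifferentiableAt (𝓡 k) 𝓘(ℝ, EuclideanSpace ℝ (Fin k) →L[ℝ] EuclideanSpace ℝ (Fin k))
      (ccoord (k := k) p q) y := by
  have h := mdifferentiableAt_coordChangeL (𝕜 := ℝ) (IB := 𝓡 k)
    (e := trivializationAt (EuclideanSpace ℝ (Fin k)) (TangentSpace (𝓡 k) (M := M)) p)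
    (e' := trivializationAt (EuclideanSpace ℝ (Fin k)) (TangentSpace (𝓡 k) (M := M)) q) (x := y)
    (by simpa using hp) (by simpa using hq)
  refine h.congr_of_eventuallyEq ?_
  filter_upwards [(isOpen_extChartAt_source p).mem_nhds hp,
    (isOpen_extChartAt_source q).mem_nhds hq] with x hx hx'
  ext1 u
  have e := Trivialization.coordChangeL_apply (R := ℝ)
    (trivializationAt (EuclideanSpace ℝ (Fin k)) (TangentSpace (𝓡 k) (M := M)) p)
    (trivializationAt (EuclideanSpace ℝ (Fin k)) (TangentSpace (𝓡 k) (M := M)) q) (b := x)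
    ⟨by simpa using hx, by simpa using hx'⟩ u
  refine Eq.trans ?_ e.symm
  rw [ccoord, ContinuousLinearMap.comp_apply, kap_eq_snd hx', lam]
  rw [Trivialization.symmL_apply (R := ℝ) _ (by simpa using hx)]

variable {m : ℕ} {N : Type*} [TopologicalSpace N] [ChartedSpace (EuclideanSpace ℝ (Fin m)) N]
  [IsManifold (𝓡 m) ∞ N]
  {g : MetricField k M} {q : M} {V : Set (EuclideanSpace ℝ (Fin k))}
  {G : EuclideanSpace ℝ (Fin k) →
      EuclideanSpace ℝ (Fin k) →L[ℝ] EuclideanSpace ℝ (Fin k) →L[ℝ] ℝ}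
  {Γ : EuclideanSpace ℝ (Fin k) →
      EuclideanSpace ℝ (Fin k) →L[ℝ] EuclideanSpace ℝ (Fin k) →L[ℝ] EuclideanSpace ℝ (Fin k)}

lemma kap_mfderiv {f : N → M} {x₀ x : N}
    (hx : x ∈ (extChartAt (𝓡 m) x₀).source) (hf : f x ∈ (extChartAt (𝓡 k) q).source)
    (hcont : ContinuousAt f x)
    (hfd : DifferentiableAt ℝ (fun w => extChartAt (𝓡 k) q (f ((extChartAt (𝓡 m) x₀).symm w)))
      (extChartAt (𝓡 m) x₀ x)) (v : TangentSpace (𝓡 m) x) :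
    kap q (f x) (mfderiv (𝓡 m) (𝓡 k) f x v)
      = fderiv ℝ (fun w => extChartAt (𝓡 k) q (f ((extChartAt (𝓡 m) x₀).symm w)))
          (extChartAt (𝓡 m) x₀ x) (kap x₀ x v) := by
  have hz := (extChartAt (𝓡 k) q).map_source hf
  have h1 : MDifferentiableAt (𝓡 m) 𝓘(ℝ, EuclideanSpace ℝ (Fin k))
      (fun y => extChartAt (𝓡 k) q (f y)) x := (mdifferentiableAt_iff_chart hx).2 hfd
  have h2 : MDifferentiableAt (𝓡 m) (𝓡 k) f x := by
    have h3 := (mdifferentiableOn_extChartAt_symm (I := 𝓡 k) (x := q) _ hz).mdifferentiableAt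
      ((isOpen_extChartAt_target q).mem_nhds hz)
    refine (MDifferentiableAt.comp (I' := 𝓘(ℝ, EuclideanSpace ℝ (Fin k))) x
      (g := (extChartAt (𝓡 k) q).symm) h3 h1).congr_of_eventuallyEq ?_
    filter_upwards [hcont.eventually_mem ((isOpen_extChartAt_source q).mem_nhds hf)] with y hy
    exact ((extChartAt (𝓡 k) q).left_inv hy).symm
  have h4 := mvfderiv_eq hx (u := fun y => extChartAt (𝓡 k) q (f y)) hfd v
  have h5 := ((hasMFDerivAt_chart hf).comp x h2.hasMFDerivAt).mfderiv
  rw [← h4, mvfderiv]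
  exact (congrArg (fun L => L v) h5).symm

/-- The definition uses the chart centred at f x, which moves with x; differentiating the mean
curvature needs one fixed chart at `q`. The formula is invariant: the derivative of the transition
map that appears in the product rule is exactly the derivative of the extended vector, whose
coordinates at `q` are not constant. -/
theorem MetricCoord.kap_covAlong (h : MetricCoord g q V G Γ) {f : N → M}
    {X : ∀ x : N, TangentSpace (𝓡 k) (f x)} {x₀ x : N}
    (hx : x ∈ (extChartAt (𝓡 m) x₀).source) (hf : f x ∈ (extChartAt (𝓡 k) q).source)
    (hV : extChartAt (𝓡 k) q (f x) ∈ V) (hcont : ContinuousAt f x)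
    (hfd : DifferentiableAt ℝ (fun w => extChartAt (𝓡 k) q (f ((extChartAt (𝓡 m) x₀).symm w)))
      (extChartAt (𝓡 m) x₀ x))
    (hXd : DifferentiableAt ℝ (fun w => kap q (f ((extChartAt (𝓡 m) x₀).symm w))
      (X ((extChartAt (𝓡 m) x₀).symm w))) (extChartAt (𝓡 m) x₀ x))
    (v : TangentSpace (𝓡 m) x) :
    kap q (f x) (covAlong g f X x v)
      = covD Γ (fun w => extChartAt (𝓡 k) q (f ((extChartAt (𝓡 m) x₀).symm w))) (kap x₀ x v)
          (fun w => kap q (f ((extChartAt (𝓡 m) x₀).symm w))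
            (X ((extChartAt (𝓡 m) x₀).symm w))) (extChartAt (𝓡 m) x₀ x) := by
  have hleft := (extChartAt (𝓡 m) x₀).left_inv hx
  have hxt := (extChartAt (𝓡 m) x₀).map_source hx
  have hp := mem_extChartAt_source (I := 𝓡 k) (f x)
  set ψ := extChartAt (𝓡 m) x₀ with hψ
  set φ := extChartAt (𝓡 k) q with hφ
  set fh : EuclideanSpace ℝ (Fin m) → EuclideanSpace ℝ (Fin k) := fun w => φ (f (ψ.symm w))
    with hfh
  set Xh : EuclideanSpace ℝ (Fin m) → EuclideanSpace ℝ (Fin k) :=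
    fun w => kap q (f (ψ.symm w)) (X (ψ.symm w)) with hXh
  have hsymm : ContinuousAt ψ.symm (ψ x) := by
    have := continuousAt_extChartAt_symm'' (I := 𝓡 m) hxt
    exact this
  have hc : ContinuousAt (fun w => f (ψ.symm w)) (ψ x) :=
    ContinuousAt.comp (by rwa [hleft]) hsymm
  have hnear : ∀ᶠ w in 𝓝 (ψ x), f (ψ.symm w) ∈ (extChartAt (𝓡 k) (f x)).source ∧
      f (ψ.symm w) ∈ φ.source :=
    (hc.eventually_mem ((isOpen_extChartAt_source (f x)).mem_nhds (by rwa [hleft]))).and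
      (hc.eventually_mem ((isOpen_extChartAt_source q).mem_nhds (by rwa [hleft])))
  -- the coordinate changes between the charts at `f x` and `q`, in the chart at `q`
  set c : EuclideanSpace ℝ (Fin k) → EuclideanSpace ℝ (Fin k) →L[ℝ] EuclideanSpace ℝ (Fin k) :=
    fun z => ccoord (f x) q (φ.symm z) with hcdef
  set c' : EuclideanSpace ℝ (Fin k) → EuclideanSpace ℝ (Fin k) →L[ℝ] EuclideanSpace ℝ (Fin k) :=
    fun z => ccoord q (f x) (φ.symm z) with hc'def
  have hcd : DifferentiableAt ℝ c (φ (f x)) :=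
    (mdifferentiableAt_iff_chart hf).1 (mdifferentiableAt_ccoord hp hf)
  have hcd' : DifferentiableAt ℝ c' (φ (f x)) :=
    (mdifferentiableAt_iff_chart hf).1 (mdifferentiableAt_ccoord hf hp)
  set wh : EuclideanSpace ℝ (Fin m) → EuclideanSpace ℝ (Fin k) :=
    fun w => kap (f x) (f (ψ.symm w)) (X (ψ.symm w)) with hwh
  have hfx : fh (ψ x) = φ (f x) := by simp only [hfh, hleft]
  have hwX : wh =ᶠ[𝓝 (ψ x)] fun w => c' (fh w) (Xh w) := by
    filter_upwards [hnear] with w hw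
    have e : c' (fh w) = ccoord q (f x) (f (ψ.symm w)) :=
      congrArg (ccoord q (f x)) (φ.left_inv hw.2)
    rw [e, ccoord_kap hw.2]
  have hXw : Xh =ᶠ[𝓝 (ψ x)] fun w => c (fh w) (wh w) := by
    filter_upwards [hnear] with w hw
    have e : c (fh w) = ccoord (f x) q (f (ψ.symm w)) :=
      congrArg (ccoord (f x) q) (φ.left_inv hw.2)
    rw [e, ccoord_kap hw.1]
  have hwd : DifferentiableAt ℝ wh (ψ x) := hwX.differentiableAt_iff.2
    ((DifferentiableAt.comp (ψ x) (g := c') (by rwa [hfx]) hfd).clm_apply hXd)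
  have e1 : kap q (f x) ((trivializationAt (EuclideanSpace ℝ (Fin k)) (TangentSpace (𝓡 k))
      (f x)).symm (f x) (mvfderiv (𝓡 m) (fun y => (trivializationAt (EuclideanSpace ℝ (Fin k))
        (TangentSpace (𝓡 k)) (f x) ⟨f y, X y⟩).2) x v))
      = c (φ (f x)) (fderiv ℝ wh (ψ x) (kap x₀ x v)) := by
    have e : (fun w => (trivializationAt (EuclideanSpace ℝ (Fin k)) (TangentSpace (𝓡 k)) (f x)
        ⟨f (ψ.symm w), X (ψ.symm w)⟩).2) =ᶠ[𝓝 (ψ x)] wh := by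
      filter_upwards [hnear] with w hw
      exact (kap_eq_snd hw.1 _).symm
    have ec : c (φ (f x)) = ccoord (f x) q (f x) := congrArg (ccoord (f x) q) (φ.left_inv hf)
    rw [mvfderiv_eq hx (e.differentiableAt_iff.2 hwd), e.fderiv_eq, ec, ccoord,
      ContinuousLinearMap.comp_apply, lam, Trivialization.symmL_apply (R := ℝ) _ (by simp)]
  have hwx : wh (ψ x) = kap (f x) (f x) (X x) := by
    have : ∀ y, y = x → kap (f x) (f y) (X y) = kap (f x) (f x) (X x) := fun y hy => by rw [hy]
    exact this _ hleft
  -- The extension has constant coordinates `wh (ψ x)` in the chart at f x, hence coordinates c(z)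
  -- applied to that vector in the chart at `q`. Its derivative is the term that `e3` has in excess.
  have e2 : vhat q (extendVec (X x)) =ᶠ[𝓝 (φ (f x))] fun z => c z (wh (ψ x)) := by
    have hcs : ContinuousAt φ.symm (φ (f x)) :=
      continuousAt_extChartAt_symm'' (I := 𝓡 k) (φ.map_source hf)
    filter_upwards [hcs.eventually_mem ((isOpen_extChartAt_source (f x)).mem_nhds
      (by rwa [φ.left_inv hf]))] with z hz
    rw [vhat, extendVec_eq_lam hz, hwx]
    rfl
  have hXx : Xh (ψ x) = c (φ (f x)) (wh (ψ x)) := by rw [hXw.eq_of_nhds, hfx]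
  have e3 : fderiv ℝ Xh (ψ x) (kap x₀ x v)
      = fderiv ℝ c (φ (f x)) (fderiv ℝ fh (ψ x) (kap x₀ x v)) (wh (ψ x))
        + c (φ (f x)) (fderiv ℝ wh (ψ x) (kap x₀ x v)) := by
    rw [hXw.fderiv_eq]
    have := dd_comp_apply (a := kap x₀ x v) (T := c) (f := fh) (u := wh) (p := ψ x)
      (by rwa [hfx]) hfd hwd
    rw [hfx] at this
    exact this
  have hcw : DifferentiableAt ℝ (fun z => c z (wh (ψ x))) (φ (f x)) :=
    hcd.clm_apply (differentiableAt_const _)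
  have e4 : fderiv ℝ (vhat q (extendVec (X x))) (φ (f x)) (fderiv ℝ fh (ψ x) (kap x₀ x v))
      = fderiv ℝ c (φ (f x)) (fderiv ℝ fh (ψ x) (kap x₀ x v)) (wh (ψ x)) := by
    rw [e2.fderiv_eq]
    have := dd_clm_apply (a := fderiv ℝ fh (ψ x) (kap x₀ x v)) (T := c) (p := φ (f x)) hcd
      (differentiableAt_const (c := wh (ψ x)))
    rw [dd_const, map_zero, add_zero] at this
    exact this
  rw [covAlong, map_add, e1, h.kap_leviCivita hf hV (e2.differentiableAt_iff.2 hcw),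
    kap_mfderiv hx hf hcont hfd, nab_apply, e4, e2.eq_of_nhds, covD]
  simp only [dd]
  rw [e3, hXx, hfx]
  abel

end CoordChange

/-! ### The ambient metric in a chart -/

section Ambient

variable {n : ℕ} {M : Type*} [MetricSpace M] [ChartedSpace (EuclideanSpace ℝ (Fin n)) M]
  [IsManifold (𝓡 n) ∞ M]

lemma contMDiffOn_lam (q : M) (u : EuclideanSpace ℝ (Fin n)) :
    ContMDiffOn (𝓡 n) (𝓡 n).tangent ∞ (fun y => (⟨y, lam q y u⟩ : TangentBundle (𝓡 n) M))
      (extChartAt (𝓡 n) q).source := by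
  refine ((trivializationAt (EuclideanSpace ℝ (Fin n)) (TangentSpace (𝓡 n) (M := M))
    q).contMDiffOn_section_iff (isOpen_extChartAt_source q) (fun y hy => by simpa using hy)).2 ?_
  refine (contMDiffOn_const (c := u)).congr fun y hy => ?_
  rw [← kap_eq_snd hy, kap_lam hy]

lemma sm_chart {F : Type*} [NormedAddCommGroup F] [NormedSpace ℝ F] {q : M} {u : M → F} {s : Set M}
    (hu : ContMDiffOn (𝓡 n) 𝓘(ℝ, F) ∞ u s) (hs : IsOpen s)
    {V : Set (EuclideanSpace ℝ (Fin n))} (hV : V ⊆ (extChartAt (𝓡 n) q).target)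
    (hVs : ∀ z ∈ V, (extChartAt (𝓡 n) q).symm z ∈ s) :
    Sm V fun z => u ((extChartAt (𝓡 n) q).symm z) := fun z hz =>
  ((hu.contMDiffAt (hs.mem_nhds (hVs z hz))).comp z
    ((contMDiffOn_extChartAt_symm (I := 𝓡 n) (n := ∞) q).contMDiffAt
      ((isOpen_extChartAt_target q).mem_nhds (hV hz)))).contDiffAt

variable [RiemannianBundle (fun x : M => TangentSpace (𝓡 n) x)]
  [IsContMDiffRiemannianBundle (𝓡 n) ∞ (EuclideanSpace ℝ (Fin n))
    (fun x : M => TangentSpace (𝓡 n) x)]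

-- Smoothness of the coefficients comes from the smooth Riemannian bundle structure applied to the
-- sections with constant coordinates; positivity then provides `Γ` through `exists_isLC`.
variable (n M) in
theorem exists_metricCoord (q : M) :
    ∃ G Γ, MetricCoord (ambientMetric n M) q (extChartAt (𝓡 n) q).target G Γ := by
  obtain ⟨g, -, hg⟩ := IsContMDiffRiemannianBundle.exists_contMDiff (IB := 𝓡 n) (n := ∞)
    (F := EuclideanSpace ℝ (Fin n)) (E := fun x : M => TangentSpace (𝓡 n) x)
  let G : EuclideanSpace ℝ (Fin n) →
      EuclideanSpace ℝ (Fin n) →L[ℝ] EuclideanSpace ℝ (Fin n) →L[ℝ] ℝ := fun z =>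
    (g ((extChartAt (𝓡 n) q).symm z)).bilinearComp (lam q ((extChartAt (𝓡 n) q).symm z))
      (lam q ((extChartAt (𝓡 n) q).symm z))
  have hG : ∀ z u v, G z u v = ambientMetric n M ((extChartAt (𝓡 n) q).symm z)
      (lam q _ u) (lam q _ v) := fun z u v => (hg _ _ _).symm
  have hpos : ∀ z ∈ (extChartAt (𝓡 n) q).target, ∀ u, u ≠ 0 → 0 < G z u u := fun z hz u hu => by
    rw [hG]
    refine real_inner_self_pos.2 fun h => hu ?_
    have := kap_lam ((extChartAt (𝓡 n) q).map_target hz) u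
    rw [h, map_zero] at this
    exact this.symm
  have hsm : Sm (extChartAt (𝓡 n) q).target G := by
    refine sm_clm (isOpen_extChartAt_target q) fun u => sm_clm (isOpen_extChartAt_target q)
      fun v => ?_
    simp only [hG]
    exact sm_chart (u := fun y => ambientMetric n M y (lam q y u) (lam q y v))
      (ContMDiffOn.inner_bundle (contMDiffOn_lam q u) (contMDiffOn_lam q v))
      (isOpen_extChartAt_source q) subset_rfl fun z hz => (extChartAt (𝓡 n) q).map_target hz
  obtain ⟨Γ, hΓ⟩ := exists_isLC (isOpen_extChartAt_target q) hsm
    (fun z _ u v => by rw [hG, hG]; exact real_inner_comm _ _) hpos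
  refine ⟨G, Γ, hΓ, subset_rfl, hpos, fun y hy _ u v => ?_⟩
  have h : ∀ y', y' = y → ambientMetric n M y' (lam q y' (kap q y u)) (lam q y' (kap q y v))
      = ambientMetric n M y u v := fun y' hy' => by
    subst hy'
    rw [lam_kap hy, lam_kap hy]
  rw [hG]
  exact (h _ ((extChartAt (𝓡 n) q).left_inv hy)).symm

end Ambient

/-! ### Traces, norms and gradients computed in a frame -/

section LinearAlgebra

variable {k : ℕ} {M : Type*} [TopologicalSpace M] [ChartedSpace (EuclideanSpace ℝ (Fin k)) M]
  [IsManifold (𝓡 k) ∞ M]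

lemma sum_kap_smul_tb {x : M} (v : TangentSpace (𝓡 k) x) : v = ∑ i, kap x x v i • tb x i := by
  rw [kap_self]
  have := (EuclideanSpace.basisFun (Fin k) ℝ).sum_repr (v : EuclideanSpace ℝ (Fin k))
  simp only [EuclideanSpace.basisFun_apply] at this
  exact this.symm

/-- The metric `g` is given at `x` by the symmetric bilinear form `B`, for which `e` is a frame
with `v = ∑ B(e_a, v) e_a`. -/
structure Frame (g : MetricField k M) (x : M)
    (B : TangentSpace (𝓡 k) x →ₗ[ℝ] TangentSpace (𝓡 k) x →ₗ[ℝ] ℝ) {ι : Type*} [Fintype ι]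
    (e : ι → TangentSpace (𝓡 k) x) : Prop where
  eq : ∀ u v, g x u v = B u v
  symm : ∀ u v, B u v = B v u
  span : ∀ v, v = ∑ a, B (e a) v • e a

namespace Frame

variable {g : MetricField k M} {x : M}
    {B : TangentSpace (𝓡 k) x →ₗ[ℝ] TangentSpace (𝓡 k) x →ₗ[ℝ] ℝ} {ι : Type*} [Fintype ι]
    {e : ι → TangentSpace (𝓡 k) x} {F : Type*} [AddCommGroup F] [Module ℝ F]

/-- Multiplying this matrix by the Gram matrix gives the identity, by the expansion of basis vectors
in the frame. Every contraction with g^ij thereby becomes a sum over the frame. -/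
lemma invGram_eq (h : Frame g x B e) (i j : Fin k) :
    invGram g x i j = ∑ a, kap x x (e a) i * kap x x (e a) j := by
  have key : (Matrix.of fun i j => g x (tb x i) (tb x j))
      * (Matrix.of fun i j => ∑ a, kap x x (e a) i * kap x x (e a) j) = 1 := by
    ext i l
    simp only [Matrix.mul_apply, Matrix.of_apply, h.eq]
    calc ∑ j, B (tb x i) (tb x j) * ∑ a, kap x x (e a) j * kap x x (e a) l
        = ∑ a, B (tb x i) (∑ j, kap x x (e a) j • tb x j) * kap x x (e a) l := by
          simp only [map_sum, map_smul, Finset.mul_sum, Finset.sum_mul, smul_eq_mul]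
          rw [Finset.sum_comm]
          exact Finset.sum_congr rfl fun _ _ => Finset.sum_congr rfl fun _ _ => by ring
      _ = ∑ a, B (e a) (tb x i) * kap x x (e a) l := by
          simp only [← sum_kap_smul_tb, h.symm (tb x i)]
      _ = kap x x (∑ a, B (e a) (tb x i) • e a) l := by
          simp [map_sum, map_smul]
      _ = (1 : Matrix (Fin k) (Fin k) ℝ) i l := by
          rw [← h.span, kap_self, tb, Matrix.one_apply]
          simp [eq_comm]
  rw [invGram, Matrix.inv_eq_right_inv key, Matrix.of_apply]

lemma sum_invGram (h : Frame g x B e)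
    (T : TangentSpace (𝓡 k) x →ₗ[ℝ] TangentSpace (𝓡 k) x →ₗ[ℝ] F) :
    ∑ i, ∑ j, invGram g x i j • T (tb x i) (tb x j) = ∑ a, T (e a) (e a) := by
  have e1 : ∀ a, T (e a) (e a)
      = ∑ i, ∑ j, (kap x x (e a) i * kap x x (e a) j) • T (tb x i) (tb x j) := fun a => by
    conv_lhs => rw [sum_kap_smul_tb (e a)]
    simp only [map_sum, map_smul, LinearMap.sum_apply, LinearMap.smul_apply, Finset.smul_sum,
      smul_smul]
    rw [Finset.sum_comm]
    exact Finset.sum_congr rfl fun _ _ => Finset.sum_congr rfl fun _ _ => by rw [mul_comm]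
  simp only [e1, h.invGram_eq, Finset.sum_smul]
  rw [Finset.sum_comm]
  refine (Finset.sum_congr rfl fun j _ => Finset.sum_comm).trans ?_
  rw [Finset.sum_comm]
  refine Finset.sum_congr rfl fun a _ => ?_
  rw [Finset.sum_comm]

theorem traceForm_eq (h : Frame g x B e)
    (T : TangentSpace (𝓡 k) x →ₗ[ℝ] TangentSpace (𝓡 k) x →ₗ[ℝ] ℝ) :
    traceForm g x (fun u v => T u v) = ∑ a, T (e a) (e a) :=
  h.sum_invGram T

/-- Two applications of `sum_invGram`, one in each slot, after reordering the four sums. -/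
lemma sum_invGram₂ (h : Frame g x B e)
    (T : TangentSpace (𝓡 k) x →ₗ[ℝ] TangentSpace (𝓡 k) x →ₗ[ℝ] F) (K : F →ₗ[ℝ] F →ₗ[ℝ] ℝ) :
    ∑ i, ∑ j, ∑ a, ∑ b, invGram g x i a * invGram g x j b *
      K (T (tb x i) (tb x j)) (T (tb x a) (tb x b)) = ∑ a, ∑ b, K (T (e a) (e b)) (T (e a) (e b)) := by
  have e1 : ∀ u v, ∑ i, ∑ a, invGram g x i a • K (T (tb x i) u) (T (tb x a) v)
      = ∑ c, K (T (e c) u) (T (e c) v) := fun u v =>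
    h.sum_invGram (K.compl₁₂ (T.flip u) (T.flip v))
  have e2 : ∀ c, ∑ j, ∑ b, invGram g x j b • K (T (e c) (tb x j)) (T (e c) (tb x b))
      = ∑ d, K (T (e c) (e d)) (T (e c) (e d)) := fun c =>
    h.sum_invGram (K.compl₁₂ (T (e c)) (T (e c)))
  simp only [← e2]
  rw [Finset.sum_comm, Finset.sum_comm (s := (Finset.univ : Finset ι))]
  refine Finset.sum_congr rfl fun j _ => ?_
  rw [Finset.sum_comm (s := (Finset.univ : Finset ι))]
  refine ((Finset.sum_congr rfl fun i _ => Finset.sum_comm).trans Finset.sum_comm).trans ?_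
  refine Finset.sum_congr rfl fun b _ => ?_
  rw [← Finset.smul_sum, ← e1, Finset.smul_sum]
  refine Finset.sum_congr rfl fun i _ => ?_
  rw [Finset.smul_sum]
  refine Finset.sum_congr rfl fun a _ => ?_
  simp only [smul_eq_mul]
  ring

lemma abs_le_normForm (h : Frame g x B e)
    (T : TangentSpace (𝓡 k) x →ₗ[ℝ] TangentSpace (𝓡 k) x →ₗ[ℝ] ℝ) (a b : ι) :
    |T (e a) (e b)| ≤ normForm g x fun u v => T u v := by
  refine Real.abs_le_sqrt ?_
  have := h.sum_invGram₂ T (LinearMap.mul ℝ ℝ)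
  simp only [LinearMap.mul_apply'] at this
  rw [this]
  refine le_trans ?_ (Finset.single_le_sum (f := fun a => ∑ b, T (e a) (e b) * T (e a) (e b))
    (fun a _ => Finset.sum_nonneg fun b _ => mul_self_nonneg _) (Finset.mem_univ a))
  rw [pow_two]
  exact Finset.single_le_sum (f := fun b => T (e a) (e b) * T (e a) (e b))
    (fun b _ => mul_self_nonneg _) (Finset.mem_univ b)

lemma sq_le (h : Frame g x B e) (a : ι) (v : TangentSpace (𝓡 k) x) : B (e a) v ^ 2 ≤ B v v := by
  have : B v v = ∑ a, B (e a) v ^ 2 := by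
    rw [show B v v = B v (∑ a, B (e a) v • e a) from congrArg (B v) (h.span v), map_sum]
    refine Finset.sum_congr rfl fun a _ => ?_
    rw [map_smul, h.symm v, smul_eq_mul, pow_two]
  rw [this]
  exact Finset.single_le_sum (f := fun a => B (e a) v ^ 2) (fun _ _ => sq_nonneg _)
    (Finset.mem_univ a)

lemma self_nonneg (h : Frame g x B e) (v : TangentSpace (𝓡 k) x) : 0 ≤ B v v := by
  by_cases hι : Nonempty ι
  · exact (sq_nonneg _).trans (h.sq_le hι.some v)
  · rw [not_nonempty_iff] at hι
    have := h.span v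
    rw [Finset.univ_eq_empty, Finset.sum_empty] at this
    rw [this, map_zero]

/-- A single component is bounded by the length of the vector T(e_a, e_b), whose square is one
summand of the squared Hilbert-Schmidt norm. -/
lemma abs_le_normVForm (h : Frame g x B e)
    (T : TangentSpace (𝓡 k) x →ₗ[ℝ] TangentSpace (𝓡 k) x →ₗ[ℝ] TangentSpace (𝓡 k) x) (a b c : ι) :
    |B (e c) (T (e a) (e b))| ≤ normVForm g x fun u v => T u v := by
  refine Real.abs_le_sqrt ?_
  simp only [h.eq]
  rw [h.sum_invGram₂ T B]
  refine (h.sq_le c _).trans ?_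
  refine le_trans ?_ (Finset.single_le_sum (f := fun a => ∑ b, B (T (e a) (e b)) (T (e a) (e b)))
    (fun a _ => Finset.sum_nonneg fun b _ => h.self_nonneg _) (Finset.mem_univ a))
  exact Finset.single_le_sum (f := fun b => B (T (e a) (e b)) (T (e a) (e b)))
    (fun b _ => h.self_nonneg _) (Finset.mem_univ b)

theorem grad_eq (h : Frame g x B e) (f : M → ℝ) (v : TangentSpace (𝓡 k) x) :
    B (grad g f x) v = mvfderiv (𝓡 k) f x v := by
  let T : TangentSpace (𝓡 k) x →ₗ[ℝ] TangentSpace (𝓡 k) x →ₗ[ℝ] TangentSpace (𝓡 k) x :=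
    LinearMap.mk₂ ℝ (fun u w => (mvfderiv (𝓡 k) f x w) • u) (fun u u' w => smul_add _ _ _)
      (fun c u w => smul_comm _ _ _) (fun u w w' => by rw [map_add, add_smul])
      (fun c u w => by rw [map_smul, smul_eq_mul, mul_smul])
  have h1 : grad g f x = ∑ a, mvfderiv (𝓡 k) f x (e a) • e a := by
    have := h.sum_invGram T
    simp only [T, LinearMap.mk₂_apply, smul_smul] at this
    exact this
  rw [h1]
  conv_rhs => rw [h.span v]
  rw [map_sum, LinearMap.sum_apply, map_sum]
  refine Finset.sum_congr rfl fun a _ => ?_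
  rw [map_smul, LinearMap.smul_apply, map_smul, smul_eq_mul, smul_eq_mul, mul_comm]

end Frame
end LinearAlgebra

/-! ### Orthonormal bases for a positive form -/

section Orthonormal

variable {E : Type*} [NormedAddCommGroup E] [NormedSpace ℝ E] [FiniteDimensional ℝ E]

/-- `B` is unrelated to the norm of `E`, so an orthogonal basis of the bilinear form is taken and
normalized. -/
theorem exists_orthonormal {B : E →L[ℝ] E →L[ℝ] ℝ} (hs : ∀ u v, B u v = B v u)
    (hpos : ∀ u, u ≠ 0 → 0 < B u u) {d : ℕ} (hd : Module.finrank ℝ E = d) :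
    ∃ e : Fin d → E, ∀ i j, B (e i) (e j) = if i = j then 1 else 0 := by
  subst hd
  let B' : LinearMap.BilinForm ℝ E := LinearMap.mk₂ ℝ (fun u v => B u v) (by simp) (by simp)
    (by simp) (by simp)
  obtain ⟨v, hv⟩ := LinearMap.BilinForm.exists_orthogonal_basis (B := B') ⟨fun u v => hs u v⟩
  have hp : ∀ i, 0 < B (v i) (v i) := fun i => hpos _ (v.ne_zero i)
  refine ⟨fun i => (√(B (v i) (v i)))⁻¹ • v i, fun i j => ?_⟩
  rw [map_smul, map_smul, smul_apply, smul_eq_mul, smul_eq_mul]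
  by_cases hij : i = j
  · subst hij
    rw [if_pos rfl]
    have := Real.mul_self_sqrt (hp i).le
    have hne := (Real.sqrt_pos.2 (hp i)).ne'
    field_simp
    rw [pow_two, this]
  · rw [if_neg hij]
    have : B (v i) (v j) = 0 := hv hij
    rw [this, mul_zero, mul_zero]

theorem span_of_orthonormal {B : E →L[ℝ] E →L[ℝ] ℝ} {ι : Type*} [Fintype ι] [DecidableEq ι]
    {e : ι → E} (ho : ∀ i j, B (e i) (e j) = if i = j then 1 else 0)
    (hc : Fintype.card ι = Module.finrank ℝ E) (v : E) : v = ∑ i, B (e i) v • e i := by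
  have key : ∀ (c : ι → ℝ) i, B (e i) (∑ j, c j • e j) = c i := fun c i => by
    simp [map_sum, ho]
  have hli : LinearIndependent ℝ e := by
    refine Fintype.linearIndependent_iff.2 fun c hc i => ?_
    rw [← key c i, hc, map_zero]
  by_cases hne : Nonempty ι
  · have hb := (basisOfLinearIndependentOfCardEqFinrank hli hc).sum_repr v
    simp only [coe_basisOfLinearIndependentOfCardEqFinrank] at hb
    conv_rhs => rw [← hb]
    simp only [key]
    exact hb.symm
  · rw [not_nonempty_iff] at hne
    rw [Fintype.card_eq_zero] at hc
    have := Module.finrank_zero_iff.1 hc.symm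
    exact Subsingleton.elim _ _

end Orthonormal

/-! ### Frames and gradients in a chart -/

section Frames

variable {k : ℕ} {M : Type*} [TopologicalSpace M] [ChartedSpace (EuclideanSpace ℝ (Fin k)) M]
  [IsManifold (𝓡 k) ∞ M] {g : MetricField k M} {q y : M} {V : Set (EuclideanSpace ℝ (Fin k))}
  {G : EuclideanSpace ℝ (Fin k) →
      EuclideanSpace ℝ (Fin k) →L[ℝ] EuclideanSpace ℝ (Fin k) →L[ℝ] ℝ}
  {Γ : EuclideanSpace ℝ (Fin k) →
      EuclideanSpace ℝ (Fin k) →L[ℝ] EuclideanSpace ℝ (Fin k) →L[ℝ] EuclideanSpace ℝ (Fin k)}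

/-- The bilinear form on `T_y M` with coordinate expression `T` in the chart at `q`. -/
def pullForm (q y : M) {F : Type*} [AddCommGroup F] [Module ℝ F]
    (T : EuclideanSpace ℝ (Fin k) →ₗ[ℝ] EuclideanSpace ℝ (Fin k) →ₗ[ℝ] F) :
    TangentSpace (𝓡 k) y →ₗ[ℝ] TangentSpace (𝓡 k) y →ₗ[ℝ] F :=
  T.compl₁₂ (kap q y).toLinearMap (kap q y).toLinearMap

/-- A continuous bilinear form as a bilinear form. -/
def bil {E : Type*} [NormedAddCommGroup E] [NormedSpace ℝ E] (B : E →L[ℝ] E →L[ℝ] ℝ) :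
    E →ₗ[ℝ] E →ₗ[ℝ] ℝ :=
  LinearMap.mk₂ ℝ (fun u v => B u v) (by simp) (by simp) (by simp) (by simp)

lemma bil_apply {E : Type*} [NormedAddCommGroup E] [NormedSpace ℝ E] (B : E →L[ℝ] E →L[ℝ] ℝ)
    (u v : E) : bil B u v = B u v := rfl

lemma pullForm_apply (q y : M) {F : Type*} [AddCommGroup F] [Module ℝ F]
    (T : EuclideanSpace ℝ (Fin k) →ₗ[ℝ] EuclideanSpace ℝ (Fin k) →ₗ[ℝ] F)
    (u v : TangentSpace (𝓡 k) y) : pullForm q y T u v = T (kap q y u) (kap q y v) := rfl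

namespace MetricCoord

lemma frame (h : MetricCoord g q V G Γ) (hy : y ∈ (extChartAt (𝓡 k) q).source)
    (hV : extChartAt (𝓡 k) q y ∈ V) {ι : Type*} [Fintype ι] {e : ι → EuclideanSpace ℝ (Fin k)}
    (he : ∀ v, v = ∑ a, G (extChartAt (𝓡 k) q y) (e a) v • e a) :
    Frame g y (pullForm q y (bil (G (extChartAt (𝓡 k) q y)))) fun a => lam q y (e a) := by
  refine ⟨fun u v => h.eq y hy hV u v, fun u v => h.lc.symmG _ hV _ _, fun v => ?_⟩
  simp only [pullForm_apply, bil_apply, kap_lam hy]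
  have := congrArg (lam q y) (he (kap q y v))
  rw [lam_kap hy] at this
  refine this.trans ?_
  simp only [map_sum, map_smul]

lemma exists_orthonormal (h : MetricCoord g q V G Γ) {z : EuclideanSpace ℝ (Fin k)} (hz : z ∈ V) :
    ∃ e : Fin k → EuclideanSpace ℝ (Fin k), (∀ i j, G z (e i) (e j) = if i = j then 1 else 0) ∧
      ∀ v, v = ∑ a, G z (e a) v • e a := by
  obtain ⟨e, he⟩ := IMCF.exists_orthonormal (B := G z) (h.lc.symmG z hz) (h.posG z hz)
    (d := k) (by simp)
  exact ⟨e, he, span_of_orthonormal he (by simp)⟩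

lemma exists_frame (h : MetricCoord g q V G Γ) (hy : y ∈ (extChartAt (𝓡 k) q).source)
    (hV : extChartAt (𝓡 k) q y ∈ V) :
    ∃ e : Fin k → TangentSpace (𝓡 k) y,
      Frame g y (pullForm q y (bil (G (extChartAt (𝓡 k) q y)))) e := by
  obtain ⟨e, -, he⟩ := h.exists_orthonormal hV
  exact ⟨_, h.frame hy hV he⟩

theorem kap_grad (h : MetricCoord g q V G Γ) {u : M → ℝ}
    (hu : Sm V (fun z => u ((extChartAt (𝓡 k) q).symm z)))
    {z : EuclideanSpace ℝ (Fin k)} (hz : z ∈ V) (w : EuclideanSpace ℝ (Fin k)) :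
    G z (vhat q (grad g u) z) w = fderiv ℝ (fun z => u ((extChartAt (𝓡 k) q).symm z)) z w := by
  have hs := (extChartAt (𝓡 k) q).map_target (h.sub hz)
  have e := (extChartAt (𝓡 k) q).right_inv (h.sub hz)
  obtain ⟨_, he⟩ := h.exists_frame hs (by rwa [e])
  have h1 := he.grad_eq u (lam q ((extChartAt (𝓡 k) q).symm z) w)
  rw [pullForm_apply, bil_apply, kap_lam hs, e, mvfderiv_eq hs (by rw [e]; exact hu.diff hz),
    kap_lam hs, e] at h1
  exact h1

/-- The coordinate gradient is the inverse metric applied to the differential, and both depend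
smoothly on the point. -/
lemma sm_vhat_grad (h : MetricCoord g q V G Γ) {u : M → ℝ}
    (hu : Sm V (fun z => u ((extChartAt (𝓡 k) q).symm z))) : Sm V (vhat q (grad g u)) := by
  refine ((h.lc.smG.inverse fun z hz => isInvertible_of_pos (h.posG z hz)).clm_apply
    hu.fderiv).congr h.lc.isOpen fun z hz => ?_
  obtain ⟨e, he⟩ := isInvertible_of_pos (h.posG z hz)
  have h1 : G z (vhat q (grad g u) z)
      = fderiv ℝ (fun z => u ((extChartAt (𝓡 k) q).symm z)) z := by
    ext w; exact h.kap_grad hu hz w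
  rw [← h1, ← he, ContinuousLinearMap.inverse_equiv]
  exact (e.symm_apply_apply _).symm

end MetricCoord
end Frames

/-! ### The eikonal equation |∇r| = 1 in the collar -/

section Eikonal

variable {n : ℕ} {M : Type*} [MetricSpace M] [ChartedSpace (EuclideanSpace ℝ (Fin n)) M]
  [IsManifold (𝓡 n) ∞ M] [RiemannianBundle (fun x : M => TangentSpace (𝓡 n) x)]

/-- The fundamental theorem of calculus for `u ∘ γ`, with the derivative bounded by `c` times the
speed. -/
lemma enorm_sub_le_pathELength {u : M → ℝ} {s : Set M} (hs : IsOpen s)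
    (hu : ContMDiffOn (𝓡 n) 𝓘(ℝ, ℝ) ∞ u s) {γ : ℝ → M} (hγ : ContMDiff 𝓘(ℝ, ℝ) (𝓡 n) 1 γ)
    {a b c : ℝ} (hab : a ≤ b) (hγs : ∀ t ∈ Icc a b, γ t ∈ s)
    (hc : ∀ t ∈ Icc a b, ∀ v : TangentSpace (𝓡 n) (γ t), |mvfderiv (𝓡 n) u (γ t) v| ≤ c * ‖v‖) :
    ‖u (γ b) - u (γ a)‖ₑ ≤ ENNReal.ofReal c * pathELength (𝓡 n) γ a b := by
  have hcd : ContDiffOn ℝ 1 (fun t => u (γ t)) (Icc a b) := by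
    intro t ht
    have h1 := (hu.contMDiffAt (hs.mem_nhds (hγs t ht))).of_le (show (1 : ℕ∞ω) ≤ ∞ by norm_cast)
    exact (h1.comp t (hγ t)).contDiffAt.contDiffWithinAt
  refine (enorm_sub_le_lintegral_deriv_of_contDiffOn_Icc hcd hab).trans ?_
  rw [pathELength_eq_lintegral_mfderiv_Icc, ← MeasureTheory.lintegral_const_mul' _ _ (by simp)]
  refine MeasureTheory.setLIntegral_mono' measurableSet_Icc fun t ht => ?_
  have h1 := ((hu.contMDiffAt (hs.mem_nhds (hγs t ht))).mdifferentiableAt (by simp)).hasMFDerivAt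
  have h2 := ((hγ t).mdifferentiableAt one_ne_zero).hasMFDerivAt
  have h3 : deriv (fun t => u (γ t)) t
      = mvfderiv (𝓡 n) u (γ t) (mfderiv 𝓘(ℝ, ℝ) (𝓡 n) γ t (1 : ℝ)) := by
    have h4 := (h1.comp t h2).mfderiv
    rw [mfderiv_eq_fderiv] at h4
    rw [← fderiv_apply_one_eq_deriv]
    exact congrArg (fun L => L (1 : ℝ)) h4
  rw [h3, ← ofReal_norm, ← ofReal_norm, Real.norm_eq_abs]
  by_cases h0 : 0 ≤ c
  · rw [← ENNReal.ofReal_mul h0]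
    exact ENNReal.ofReal_le_ofReal (hc t ht _)
  · have : |mvfderiv (𝓡 n) u (γ t) (mfderiv 𝓘(ℝ, ℝ) (𝓡 n) γ t (1 : ℝ))| ≤ 0 :=
      (hc t ht _).trans (mul_nonpos_of_nonpos_of_nonneg (not_le.1 h0).le (norm_nonneg _))
    rw [ENNReal.ofReal_of_nonpos this]
    exact bot_le

variable [IsContMDiffRiemannianBundle (𝓡 n) ∞ (EuclideanSpace ℝ (Fin n))
    (fun x : M => TangentSpace (𝓡 n) x)]

lemma inner_grad (u : M → ℝ) (y : M) (v : TangentSpace (𝓡 n) y) :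
    ambientMetric n M y (grad (ambientMetric n M) u y) v = mvfderiv (𝓡 n) u y v := by
  obtain ⟨G, Γ, h⟩ := exists_metricCoord n M y
  obtain ⟨e, he⟩ := h.exists_frame (mem_extChartAt_source y) (mem_extChartAt_target y)
  rw [he.eq]
  exact he.grad_eq u v

lemma abs_mvfderiv_le (u : M → ℝ) (y : M) (v : TangentSpace (𝓡 n) y) :
    |mvfderiv (𝓡 n) u y v| ≤ ‖grad (ambientMetric n M) u y‖ * ‖v‖ := by
  rw [← inner_grad]
  exact abs_real_inner_le_norm _ _

lemma ambientMetric_self (y : M) (v : TangentSpace (𝓡 n) y) :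
    ambientMetric n M y v v = ‖v‖ ^ 2 := real_inner_self_eq_norm_sq v

/-- The part of the chart at `q` that is mapped to `s`. -/
def chartSet (q : M) (s : Set M) : Set (EuclideanSpace ℝ (Fin n)) :=
  (extChartAt (𝓡 n) q).target ∩ (extChartAt (𝓡 n) q).symm ⁻¹' s

lemma isOpen_chartSet (q : M) {s : Set M} (hs : IsOpen s) : IsOpen (chartSet (n := n) q s) :=
  (continuousOn_extChartAt_symm q).isOpen_inter_preimage (isOpen_extChartAt_target q) hs

lemma mem_chartSet {q y : M} {s : Set M} (hy : y ∈ (extChartAt (𝓡 n) q).source) (hs : y ∈ s) :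
    extChartAt (𝓡 n) q y ∈ chartSet (n := n) q s :=
  ⟨(extChartAt (𝓡 n) q).map_source hy, by rwa [mem_preimage, (extChartAt (𝓡 n) q).left_inv hy]⟩

lemma IsLC.mono {E : Type*} [NormedAddCommGroup E] [NormedSpace ℝ E] {V V' : Set E}
    {G : E → E →L[ℝ] E →L[ℝ] ℝ} {Γ : E → E →L[ℝ] E →L[ℝ] E} (h : IsLC V G Γ) (hV' : IsOpen V')
    (hs : V' ⊆ V) : IsLC V' G Γ :=
  ⟨hV', h.smG.mono hs, h.smΓ.mono hs, fun z hz => h.symmG z (hs hz),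
    fun z hz => h.symmΓ z (hs hz), fun z hz => h.compat z (hs hz)⟩

variable (n M) in
theorem exists_metricCoord_chartSet (q : M) {s : Set M} (hs : IsOpen s) :
    ∃ G Γ, MetricCoord (ambientMetric n M) q (chartSet q s) G Γ := by
  obtain ⟨G, Γ, h⟩ := exists_metricCoord n M q
  exact ⟨G, Γ, h.lc.mono (isOpen_chartSet q hs) inter_subset_left, inter_subset_left,
    fun z hz => h.posG z hz.1, fun y hy hV => h.eq y hy hV.1⟩

lemma sm_chartSet {F : Type*} [NormedAddCommGroup F] [NormedSpace ℝ F] {q : M} {u : M → F}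
    {s : Set M} (hu : ContMDiffOn (𝓡 n) 𝓘(ℝ, F) ∞ u s) (hs : IsOpen s) :
    Sm (chartSet q s) fun z => u ((extChartAt (𝓡 n) q).symm z) :=
  sm_chart hu hs inter_subset_left fun _ hz => hz.2

/-- The norms live on varying tangent spaces, so continuity of |∇u|² is obtained from its expression
in a chart. -/
lemma eventually_norm_grad_lt {u : M → ℝ} {s : Set M} (hs : IsOpen s)
    (hu : ContMDiffOn (𝓡 n) 𝓘(ℝ, ℝ) ∞ u s) {y : M} (hy : y ∈ s) {c : ℝ} (hc0 : 0 ≤ c)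
    (hc : ‖grad (ambientMetric n M) u y‖ < c) :
    ∀ᶠ x in 𝓝 y, ‖grad (ambientMetric n M) u x‖ < c := by
  obtain ⟨G, Γ, h⟩ := exists_metricCoord_chartSet n M y hs
  have hys := mem_extChartAt_source (I := 𝓡 n) y
  have hZ := h.sm_vhat_grad (sm_chartSet hu hs)
  have hyV := mem_chartSet hys hy
  have e : ∀ x ∈ (extChartAt (𝓡 n) y).source, extChartAt (𝓡 n) y x ∈ chartSet y s →
      ‖grad (ambientMetric n M) u x‖ ^ 2 = G (extChartAt (𝓡 n) y x)
        (vhat y (grad (ambientMetric n M) u) (extChartAt (𝓡 n) y x))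
        (vhat y (grad (ambientMetric n M) u) (extChartAt (𝓡 n) y x)) := fun x hx hxV => by
    rw [← ambientMetric_self, h.eq x hx hxV, vhat_chart hx]
  have hcont : ContinuousAt (fun z => G z (vhat y (grad (ambientMetric n M) u) z)
      (vhat y (grad (ambientMetric n M) u) z)) (extChartAt (𝓡 n) y y) :=
    (((h.lc.smG.clm_apply hZ).clm_apply hZ).diff hyV).continuousAt
  have hlt : G (extChartAt (𝓡 n) y y) (vhat y (grad (ambientMetric n M) u) (extChartAt (𝓡 n) y y))
      (vhat y (grad (ambientMetric n M) u) (extChartAt (𝓡 n) y y)) < c ^ 2 := by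
    rw [← e y hys hyV]
    exact pow_lt_pow_left₀ hc (norm_nonneg _) two_ne_zero
  have h1 := (continuousAt_extChartAt (I := 𝓡 n) y).eventually (hcont.eventually_lt_const hlt)
  have h2 := (continuousAt_extChartAt (I := 𝓡 n) y).eventually_mem
    ((isOpen_chartSet y hs).mem_nhds hyV)
  filter_upwards [h1, h2, (isOpen_extChartAt_source (I := 𝓡 n) y).mem_nhds hys] with x hx1 hx2 hx3
  rw [← e x hx3 hx2] at hx1
  exact lt_of_pow_lt_pow_left₀ 2 hc0 hx1

variable [IsRiemannianManifold (𝓡 n) M]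

/-- A function which is locally `1`-Lipschitz has gradient of norm at most `1`. -/
theorem norm_grad_le_one {u : M → ℝ} {s : Set M} (hs : IsOpen s)
    (hu : ContMDiffOn (𝓡 n) 𝓘(ℝ, ℝ) ∞ u s) {y : M} (hy : y ∈ s)
    (hL : ∀ x ∈ s, u x - u y ≤ dist x y) : ‖grad (ambientMetric n M) u y‖ ≤ 1 := by
  by_contra hlt
  rw [not_le] at hlt
  obtain ⟨G, Γ, h⟩ := exists_metricCoord_chartSet n M y hs
  have hys := mem_extChartAt_source (I := 𝓡 n) y
  have hus := sm_chartSet (q := y) hu hs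
  have hyV := mem_chartSet hys hy
  set Z := grad (ambientMetric n M) u y with hZ
  set z := extChartAt (𝓡 n) y y with hz
  set w := kap y y Z with hw
  have hsq : ‖Z‖ < ‖Z‖ ^ 2 := by nlinarith
  -- Along the coordinate line in the direction of the gradient, u grows at initial rate ‖Z‖², while
  -- the speed starts at ‖Z‖ and stays below m. Then u would grow faster than the distance.
  obtain ⟨m, hm1, hm2⟩ := exists_between hsq
  have hm0 : 0 ≤ m := (norm_nonneg _).trans hm1.le
  have hGw : G z w w = ‖Z‖ ^ 2 := by rw [← ambientMetric_self, h.eq y hys hyV]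
  have hline : Continuous fun t : ℝ => z + t • w := by fun_prop
  have hcont : ContinuousAt (fun t : ℝ => G (z + t • w) w w) 0 := by
    have h1 : ContinuousAt (fun z => G z w w) (z + (0 : ℝ) • w) := by
      rw [zero_smul, add_zero]
      exact (((h.lc.smG.diff hyV).clm_apply (differentiableAt_const w)).clm_apply
        (differentiableAt_const w)).continuousAt
    exact ContinuousAt.comp (f := fun t : ℝ => z + t • w) h1 hline.continuousAt
  have hev1 : ∀ᶠ t in 𝓝 (0 : ℝ), G (z + t • w) w w < m ^ 2 := by
    refine hcont.eventually_lt_const ?_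
    simp only [zero_smul, add_zero, hGw]
    exact pow_lt_pow_left₀ hm1 (norm_nonneg _) two_ne_zero
  have hev2 : ∀ᶠ t in 𝓝 (0 : ℝ), z + t • w ∈ chartSet y s :=
    hline.continuousAt.eventually_mem ((isOpen_chartSet y hs).mem_nhds (by simpa using hyV))
  obtain ⟨δ, hδ, hball⟩ := Metric.nhds_basis_ball.eventually_iff.1 (hev1.and hev2)
  have hδ' : ∀ t ∈ Ico 0 δ, ∀ r ∈ Icc 0 t, r ∈ Metric.ball (0 : ℝ) δ := fun t ht r hr => by
    rw [Metric.mem_ball, dist_zero_right, Real.norm_eq_abs, abs_of_nonneg hr.1]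
    exact hr.2.trans_lt ht.2
  set c : ℝ → M := fun t => (extChartAt (𝓡 n) y).symm (z + t • w) with hc
  have hc0 : c 0 = y := by
    simp only [hc, zero_smul, add_zero]
    exact (extChartAt (𝓡 n) y).left_inv hys
  have hspeed : ∀ t ∈ Metric.ball (0 : ℝ) δ,
      ‖mfderiv 𝓘(ℝ, ℝ) (𝓡 n) c t (1 : ℝ)‖ ≤ m := fun t ht => by
    obtain ⟨ht1, ht2⟩ := hball ht
    have h1 : HasMFDerivAt 𝓘(ℝ, EuclideanSpace ℝ (Fin n)) (𝓡 n) (extChartAt (𝓡 n) y).symm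
        (z + t • w) (lam y ((extChartAt (𝓡 n) y).symm (z + t • w))) := by
      rw [← mfderiv_chart_symm ht2.1]
      exact ((mdifferentiableOn_extChartAt_symm (I := 𝓡 n) (x := y) _ ht2.1).mdifferentiableAt
        ((isOpen_extChartAt_target y).mem_nhds ht2.1)).hasMFDerivAt
    have h2 : HasFDerivAt (fun t : ℝ => z + t • w)
        (ContinuousLinearMap.toSpanSingleton ℝ w) t := by
      have := ((hasDerivAt_id t).smul_const w).const_add z
      rw [one_smul] at this
      exact this.hasFDerivAt
    have h3 : mfderiv 𝓘(ℝ, ℝ) (𝓡 n) c t (1 : ℝ) = lam y (c t) w := by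
      have := congrArg (fun L => L (1 : ℝ)) ((h1.comp t h2.hasMFDerivAt).mfderiv)
      refine this.trans ?_
      change lam y (c t) ((1 : ℝ) • w) = lam y (c t) w
      rw [one_smul]
    have h4 := h.eq _ ((extChartAt (𝓡 n) y).map_target ht2.1)
      (by rwa [(extChartAt (𝓡 n) y).right_inv ht2.1]) (lam y (c t) w) (lam y (c t) w)
    rw [kap_lam ((extChartAt (𝓡 n) y).map_target ht2.1), (extChartAt (𝓡 n) y).right_inv ht2.1,
      ambientMetric_self] at h4
    rw [h3]
    refine le_of_lt (lt_of_pow_lt_pow_left₀ 2 hm0 ?_)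
    exact h4.trans_lt ht1
  have hdist : ∀ t ∈ Ico 0 δ, dist (c t) y ≤ t * m := fun t ht => by
    have hmem := hδ' t ht
    have hcm : ContMDiffOn 𝓘(ℝ, ℝ) (𝓡 n) 1 c (Icc 0 t) := by
      refine (contMDiffOn_extChartAt_symm (I := 𝓡 n) (n := 1) y).comp (t := _)
        (f := fun t : ℝ => z + t • w) (ContDiff.contMDiff (by fun_prop)).contMDiffOn ?_
      exact fun r hr => (hball (hmem r hr)).2.1
    have h1 := riemannianEDist_le_pathELength (I := 𝓡 n) hcm hc0 rfl ht.1
    rw [← IsRiemannianManifold.out, edist_dist, dist_comm,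
      pathELength_eq_lintegral_mfderiv_Icc] at h1
    have h2 : ∫⁻ r in Icc 0 t, ‖mfderiv 𝓘(ℝ, ℝ) (𝓡 n) c r (1 : ℝ)‖ₑ
        ≤ ∫⁻ _ in Icc 0 t, ENNReal.ofReal m := by
      refine MeasureTheory.setLIntegral_mono' measurableSet_Icc fun r hr => ?_
      rw [← ofReal_norm]
      exact ENNReal.ofReal_le_ofReal (hspeed r (hmem r hr))
    rw [MeasureTheory.setLIntegral_const, Real.volume_Icc, sub_zero, ← ENNReal.ofReal_mul hm0,
      mul_comm] at h2
    exact (ENNReal.ofReal_le_ofReal_iff (mul_nonneg ht.1 hm0)).1 (h1.trans h2)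
  have hder : HasDerivAt (fun t : ℝ => u (c t)) (‖Z‖ ^ 2) 0 := by
    have h1 : HasFDerivAt (fun z => u ((extChartAt (𝓡 n) y).symm z)) (fderiv ℝ (fun z => u
      ((extChartAt (𝓡 n) y).symm z)) z) (z + (0 : ℝ) • w) := by
      rw [zero_smul, add_zero]
      exact (hus.diff hyV).hasFDerivAt
    have h2 : HasDerivAt (fun t : ℝ => z + t • w) w 0 := by
      have := ((hasDerivAt_id (0 : ℝ)).smul_const w).const_add z
      rwa [one_smul] at this
    have h3 := h1.comp_hasDerivAt (0 : ℝ) h2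
    rw [← h.kap_grad hus hyV, vhat_chart hys, ← hZ, ← hw, hGw] at h3
    exact h3
  have hlim := hder.tendsto_slope_zero_right
  have hle := le_of_tendsto hlim (b := m) <| by
    filter_upwards [Ioo_mem_nhdsGT hδ] with t ht
    have h1 := hL _ (hball (hδ' t ⟨ht.1.le, ht.2⟩ t ⟨ht.1.le, le_rfl⟩)).2.2
    have h2 := h1.trans (hdist t ⟨ht.1.le, ht.2⟩)
    rw [zero_add, hc0, smul_eq_mul, inv_mul_le_iff₀ ht.1]
    exact h2
  exact absurd hle (not_le.2 hm2)

/-- The distance function to a closed set has gradient of norm at least `1` where it is smooth. -/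
theorem one_le_norm_grad {u : M → ℝ} {s K : Set M} (hs : IsOpen s)
    (hne : K.Nonempty) (hsK : Disjoint s K) (hu : ContMDiffOn (𝓡 n) 𝓘(ℝ, ℝ) ∞ u s)
    (huK : ∀ x ∈ s, u x = - Metric.infDist x K) {y : M} (hy : y ∈ s) :
    1 ≤ ‖grad (ambientMetric n M) u y‖ := by
  by_contra hlt
  rw [not_le] at hlt
  obtain ⟨c, hc1, hc2⟩ := exists_between hlt
  have hc0 : 0 ≤ c := (norm_nonneg _).trans hc1.le
  obtain ⟨ρ, hρ, hball⟩ := Metric.nhds_basis_closedBall.eventually_iff.1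
    ((eventually_norm_grad_lt hs hu hy hc0 hc1).and (hs.mem_nhds hy))
  -- No nearest point of `K` need exist; a point and a path within (1 - c)ρ of the infimum suffice,
  -- where |∇u| < c on the closed ball of radius ρ.
  obtain ⟨z, hzK, hz⟩ := (Metric.infDist_lt_iff hne).1
    (lt_add_of_pos_right (Metric.infDist y K) (mul_pos (sub_pos.2 hc2) hρ))
  have hed : riemannianEDist (𝓡 n) y z
      < ENNReal.ofReal (Metric.infDist y K + (1 - c) * ρ) := by
    rw [← IsRiemannianManifold.out, edist_dist]
    exact (ENNReal.ofReal_lt_ofReal_iff_of_nonneg dist_nonneg).2 hz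
  obtain ⟨γ, hγ0, hγ1, hγ, hlen, -, -⟩ :=
    exists_lt_locally_constant_of_riemannianEDist_lt hed zero_lt_one
  have hcontγ : Continuous fun t => dist (γ t) y := hγ.continuous.dist continuous_const
  have hzρ : ρ ≤ dist z y := by
    by_contra hzρ
    exact disjoint_left.1 hsK (hball (Metric.mem_closedBall.2 (not_le.1 hzρ).le)).2 hzK
  -- the first time at which the path leaves the ball
  have hclosed : IsClosed (Icc (0 : ℝ) 1 ∩ {t | ρ ≤ dist (γ t) y}) :=
    isClosed_Icc.inter (isClosed_le continuous_const hcontγ)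
  have hnon : (Icc (0 : ℝ) 1 ∩ {t | ρ ≤ dist (γ t) y}).Nonempty :=
    ⟨1, ⟨zero_le_one, le_rfl⟩, by rwa [mem_ofPred_eq, hγ1]⟩
  have hbdd : BddBelow (Icc (0 : ℝ) 1 ∩ {t | ρ ≤ dist (γ t) y}) := ⟨0, fun t ht => ht.1.1⟩
  set T := sInf (Icc (0 : ℝ) 1 ∩ {t | ρ ≤ dist (γ t) y}) with hT
  obtain ⟨⟨hT0, hT1⟩, hTρ⟩ : T ∈ Icc (0 : ℝ) 1 ∩ {t | ρ ≤ dist (γ t) y} :=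
    hclosed.csInf_mem hnon hbdd
  have hlt : ∀ t ∈ Ico 0 T, dist (γ t) y < ρ := fun t ht => by
    by_contra hcon
    exact (not_lt.2 (csInf_le hbdd ⟨⟨ht.1, ht.2.le.trans hT1⟩, not_lt.1 hcon⟩)) ht.2
  have hTpos : 0 < T := by
    rcases hT0.lt_or_eq with h | h
    · exact h
    · rw [← h, mem_ofPred_eq, hγ0, dist_self] at hTρ
      exact absurd hTρ (not_le.2 hρ)
  have hle : ∀ t ∈ Icc 0 T, γ t ∈ Metric.closedBall y ρ := by
    have hcl : IsClosed {t | dist (γ t) y ≤ ρ} := isClosed_le hcontγ continuous_const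
    have hsub : Icc 0 T ⊆ {t | dist (γ t) y ≤ ρ} := by
      rw [← closure_Ico hTpos.ne]
      exact hcl.closure_subset_iff.2 fun t ht => (hlt t ht).le
    exact fun t ht => hsub ht
  set L := pathELength (𝓡 n) γ 0 T with hL
  have hadd := pathELength_add (I := 𝓡 n) (γ := γ) hT0 hT1
  have hLfin : L ≠ ⊤ := by
    intro htop
    rw [← hL, htop, top_add] at hadd
    rw [← hadd] at hlen
    exact not_top_lt hlen
  have h1 : ENNReal.ofReal ρ ≤ L := by
    refine le_trans ?_ (riemannianEDist_le_pathELength (I := 𝓡 n) (x := γ 0) (y := γ T)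
      hγ.contMDiffOn rfl rfl hT0)
    rw [← IsRiemannianManifold.out, edist_dist, hγ0, dist_comm]
    exact ENNReal.ofReal_le_ofReal hTρ
  have h2 : ENNReal.ofReal (Metric.infDist (γ T) K) ≤ pathELength (𝓡 n) γ T 1 := by
    refine le_trans ?_ (riemannianEDist_le_pathELength (I := 𝓡 n) (x := γ T) (y := γ 1)
      hγ.contMDiffOn rfl rfl hT1)
    rw [← IsRiemannianManifold.out, edist_dist]
    refine ENNReal.ofReal_le_ofReal (Metric.infDist_le_dist_of_mem ?_)
    rwa [hγ1]
  have h3 := enorm_sub_le_pathELength (c := c) hs hu hγ hT0 (fun t ht => (hball (hle t ht)).2)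
    fun t ht v => (abs_mvfderiv_le u _ v).trans
      (mul_le_mul_of_nonneg_right (hball (hle t ht)).1.le (norm_nonneg _))
  have hTs : γ T ∈ s := (hball (hle T ⟨hT0, le_rfl⟩)).2
  rw [hγ0, huK _ hTs, huK y hy, ← hL, ← ofReal_norm, ← ENNReal.ofReal_toReal hLfin,
    ← ENNReal.ofReal_mul hc0, ENNReal.ofReal_le_ofReal_iff (by positivity), Real.norm_eq_abs] at h3
  rw [← ENNReal.ofReal_toReal hLfin, ENNReal.ofReal_le_ofReal_iff (by positivity)] at h1
  have h4 : ENNReal.ofReal (L.toReal + Metric.infDist (γ T) K)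
      < ENNReal.ofReal (Metric.infDist y K + (1 - c) * ρ) := by
    rw [ENNReal.ofReal_add (by positivity) Metric.infDist_nonneg, ENNReal.ofReal_toReal hLfin]
    refine lt_of_le_of_lt ?_ hlen
    rw [← hadd]
    exact add_le_add le_rfl h2
  have h5 := (ENNReal.ofReal_lt_ofReal_iff_of_nonneg
    (add_nonneg (by positivity) Metric.infDist_nonneg)).1 h4
  have h6 := abs_le.1 h3
  -- Up to the exit time the path has length L ≥ ρ but u changes by at most cL, so the distance to
  -- `K` drops by at most cL. The total length is therefore at least infDist + (1 - c)ρ, against the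
  -- choice of the path.
  nlinarith [h6.1, h6.2]

variable {Ω : Set M} {r₀ : ℝ} {y : M}

lemma isOpen_collar (h : IsSmoothObstacle n Ω r₀) : IsOpen (collar Ω r₀) :=
  h.domain.1.sdiff isClosed_closure

lemma signedDist_of_mem_collar (hy : y ∈ collar Ω r₀) :
    signedDist Ω y = - Metric.infDist y (frontier Ω) := if_pos hy.1

lemma signedDist_nonpos (hy : y ∈ collar Ω r₀) : signedDist Ω y ≤ 0 := by
  rw [signedDist_of_mem_collar hy, neg_nonpos]
  exact Metric.infDist_nonneg

lemma neg_le_signedDist (hy : y ∈ collar Ω r₀) : -r₀ ≤ signedDist Ω y := by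
  by_contra hlt
  exact hy.2 (subset_closure (not_le.1 hlt))

/-- `Metric.infDist` to the empty set is 0, so without boundary the signed distance would vanish
identically and so would its gradient. -/
lemma frontier_nonempty_of_radial_ne_zero (hy : radial n Ω y ≠ 0) : (frontier Ω).Nonempty := by
  by_contra hne
  rw [not_nonempty_iff_eq_empty] at hne
  refine hy ?_
  have h0 : signedDist Ω = fun _ : M => (0 : ℝ) := by
    funext x
    simp [signedDist, hne]
  have h1 : ∀ u : M → ℝ, u = (fun _ : M => (0 : ℝ)) →
      ∀ v : TangentSpace (𝓡 n) y, mvfderiv (𝓡 n) u y v = 0 := fun u hu v => by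
    subst hu
    simp [mvfderiv, mfderiv_const]
  simp only [radial, grad, h1 _ h0, mul_zero, zero_smul, Finset.sum_const_zero]

theorem norm_radial (h : IsSmoothObstacle n Ω r₀) (hne : (frontier Ω).Nonempty)
    (hy : y ∈ collar Ω r₀) : ambientMetric n M y (radial n Ω y) (radial n Ω y) = 1 := by
  have h1 : ‖radial n Ω y‖ ≤ 1 := norm_grad_le_one (isOpen_collar h) h.smooth hy fun x hx => by
    rw [signedDist_of_mem_collar hx, signedDist_of_mem_collar hy]
    have := Metric.infDist_le_infDist_add_dist (s := frontier Ω) (x := y) (y := x)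
    rw [dist_comm] at this
    linarith
  have h2 : 1 ≤ ‖radial n Ω y‖ := one_le_norm_grad (isOpen_collar h) hne
    (disjoint_left.2 fun x hx hxf => by
      rw [h.domain.1.frontier_eq] at hxf
      exact hxf.2 hx.1) h.smooth (fun x hx => signedDist_of_mem_collar hx) hy
  rw [ambientMetric_self, le_antisymm h1 h2, one_pow]

end Eikonal

/-! ### Bounds on the ambient tensors in the frame of the hypersurface -/

section PointBounds

lemma Frame.self_eq_sum {k : ℕ} {M : Type*} [TopologicalSpace M]
    [ChartedSpace (EuclideanSpace ℝ (Fin k)) M] [IsManifold (𝓡 k) ∞ M] {g : MetricField k M} {x : M}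
    {B : TangentSpace (𝓡 k) x →ₗ[ℝ] TangentSpace (𝓡 k) x →ₗ[ℝ] ℝ} {ι : Type*} [Fintype ι]
    {e : ι → TangentSpace (𝓡 k) x} (h : Frame g x B e) (v : TangentSpace (𝓡 k) x) :
    B v v = ∑ a, B (e a) v ^ 2 := by
  rw [show B v v = B v (∑ a, B (e a) v • e a) from congrArg (B v) (h.span v), map_sum]
  refine Finset.sum_congr rfl fun a _ => ?_
  rw [map_smul, h.symm v, smul_eq_mul, pow_two]

variable {n : ℕ} {M : Type*} [MetricSpace M] [ChartedSpace (EuclideanSpace ℝ (Fin n)) M]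
  [IsManifold (𝓡 n) ∞ M] [RiemannianBundle (fun x : M => TangentSpace (𝓡 n) x)]
  [IsContMDiffRiemannianBundle (𝓡 n) ∞ (EuclideanSpace ℝ (Fin n))
    (fun x : M => TangentSpace (𝓡 n) x)] [IsRiemannianManifold (𝓡 n) M]
  {Ω : Set M} {r₀ : ℝ} {q : M} {G : EuclideanSpace ℝ (Fin n) →
      EuclideanSpace ℝ (Fin n) →L[ℝ] EuclideanSpace ℝ (Fin n) →L[ℝ] ℝ}
  {Γ : EuclideanSpace ℝ (Fin n) →
      EuclideanSpace ℝ (Fin n) →L[ℝ] EuclideanSpace ℝ (Fin n) →L[ℝ] EuclideanSpace ℝ (Fin n)}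
  {P ι : Type*} [NormedAddCommGroup P] [NormedSpace ℝ P] [Fintype ι] [DecidableEq ι]
  {f ν : P → EuclideanSpace ℝ (Fin n)} {e : ι → P} {p : P}

section Tensors

variable {E κ : Type*} [NormedAddCommGroup E] [NormedSpace ℝ E] [Fintype κ]
  (B : E →L[ℝ] E →L[ℝ] ℝ) (Γ : E → E →L[ℝ] E →L[ℝ] E) (z : E)

set_option synthInstance.maxHeartbeats 200000 in
lemma Rm_add_left (u u' v w : E) : Rm Γ z (u + u') v w = Rm Γ z u v w + Rm Γ z u' v w := by
  simp only [Rm, map_add, add_apply]; abel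

lemma Rm_add_mid (u v v' w : E) : Rm Γ z u (v + v') w = Rm Γ z u v w + Rm Γ z u v' w := by
  rw [Rm_antisymm, Rm_add_left, Rm_antisymm Γ z v, Rm_antisymm Γ z v']; abel

lemma Rm_smul_mid (c : ℝ) (u v w : E) : Rm Γ z u (c • v) w = c • Rm Γ z u v w := by
  rw [Rm_antisymm, Rm_smul_left, Rm_antisymm Γ z v, smul_neg, neg_neg]

lemma Rm_add_right (u v w w' : E) : Rm Γ z u v (w + w') = Rm Γ z u v w + Rm Γ z u v w' := by
  simp only [Rm, map_add]; abel

lemma Rm_smul_right (c : ℝ) (u v w : E) : Rm Γ z u v (c • w) = c • Rm Γ z u v w := by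
  simp only [Rm, map_smul, smul_add, smul_sub]

/-- The Ricci curvature in coordinates, with respect to the frame `e`. -/
def ricForm (e : κ → E) : E →ₗ[ℝ] E →ₗ[ℝ] ℝ :=
  LinearMap.mk₂ ℝ (fun v w => ∑ a, B (Rm Γ z (e a) v w) (e a))
    (fun u v w => by simp only [Rm_add_mid, map_add, add_apply, Finset.sum_add_distrib])
    (fun c v w => by simp only [Rm_smul_mid, map_smul, smul_apply, Finset.smul_sum])
    (fun u v w => by simp only [Rm_add_right, map_add, add_apply, Finset.sum_add_distrib])
    (fun c v w => by simp only [Rm_smul_right, map_smul, smul_apply, Finset.smul_sum])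

/-- The curvature contracted with the metric, in coordinates. -/
def rmForm (v w : E) : E →ₗ[ℝ] E →ₗ[ℝ] ℝ :=
  LinearMap.mk₂ ℝ (fun u x => B (Rm Γ z u v w) x)
    (fun u u' x => by rw [Rm_add_left, map_add, add_apply])
    (fun c u x => by rw [Rm_smul_left, map_smul, smul_apply])
    (fun u x y => by rw [map_add]) (fun c u x => by rw [map_smul])

end Tensors

/-- The second covariant derivative in coordinates as a bilinear map. -/
def nab2Form {E : Type*} [NormedAddCommGroup E] [NormedSpace ℝ E]
    (Γ : E → E →L[ℝ] E →L[ℝ] E) (Y : E → E) (z : E) : E →ₗ[ℝ] E →ₗ[ℝ] E :=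
  LinearMap.mk₂ ℝ (fun u v => nab2 Γ Y z u v)
    (fun u u' x => by simp only [nab2, map_add, add_apply]; abel)
    (fun c u x => by simp only [nab2, map_smul, smul_apply, smul_add, smul_sub])
    (fun u x y => by simp only [nab2, map_add]; abel)
    (fun c u x => by simp only [nab2, map_smul, smul_add, smul_sub])

/-- Adding ν to the tangent directions gives an orthonormal frame of the ambient space. Each
required component is then dominated by a Hilbert-Schmidt norm, and the unit length of Y is the
eikonal equation. -/
theorem flowBounds_of_obstacle (h : IsSmoothObstacle n Ω r₀) (hne : (frontier Ω).Nonempty)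
    (hq : q ∈ collar Ω r₀)
    (mc : MetricCoord (ambientMetric n M) q (chartSet q (collar Ω r₀)) G Γ)
    (hf : f p = extChartAt (𝓡 n) q q) (ho : OrthoAt G f ν e p)
    (half : 1 / 2 ≤ G (f p) (ν p) (vhat q (radial n Ω) (f p))) :
    FlowBounds G Γ f ν e (vhat q (radial n Ω)) r₀ p := by
  have hqs := mem_extChartAt_source (I := 𝓡 n) q
  have hV := mem_chartSet hqs hq
  have hr := sm_chartSet (q := q) h.smooth (isOpen_collar h)
  have hY : Sm (chartSet q (collar Ω r₀)) (vhat q (radial n Ω)) := mc.sm_vhat_grad hr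
  have hrY : ∀ z ∈ chartSet q (collar Ω r₀), ∀ w, fderiv ℝ
      (fun z => signedDist Ω ((extChartAt (𝓡 n) q).symm z)) z w
        = G z w (vhat q (radial n Ω) z) := fun z hz w => by
    rw [← mc.kap_grad hr hz, mc.lc.symmG z hz]; rfl
  set Y := vhat q (radial n Ω) with hYdef
  set z := extChartAt (𝓡 n) q q with hz
  obtain ⟨ho1, ho2⟩ := ho
  rw [hf] at ho1 ho2 half
  let fr : Option ι → EuclideanSpace ℝ (Fin n) := fun o => o.elim (ν p) fun i => dd (e i) f p
  have hfr : ∀ v, v = ∑ a, G z (fr a) v • fr a := fun v => by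
    rw [Fintype.sum_option, add_comm]; exact ho2 v
  have F := mc.frame hqs hV hfr
  have hk : ∀ a, kap q q (lam q q (fr a)) = fr a := fun a => kap_lam hqs _
  -- Ricci curvature
  have ric : ∀ a b, |∑ c, G z (Rm Γ z (fr c) (fr a) (fr b)) (fr c)| ≤ (r₀ ^ 2)⁻¹ := fun a b => by
    refine le_trans ?_ (h.ricci_le q hq)
    have e1 : ∀ v w, ricci (ambientMetric n M) q v w
        = pullForm q q (ricForm (G z) Γ z fr) v w := fun v w => by
      have e2 : (fun u x => ambientMetric n M q (curv (ambientMetric n M) q u v w) x)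
          = fun u x => pullForm q q (rmForm (G z) Γ z (kap q q v) (kap q q w)) u x := by
        funext u x
        rw [mc.eq q hqs hV, mc.kap_curv hV]
        rfl
      rw [ricci, e2, F.traceForm_eq]
      simp only [pullForm_apply, hk]
      rfl
    have e3 : ricci (ambientMetric n M) q = fun v w => pullForm q q (ricForm (G z) Γ z fr) v w := by
      funext v w; exact e1 v w
    rw [e3]
    have := F.abs_le_normForm (pullForm q q (ricForm (G z) Γ z fr)) a b
    rw [pullForm_apply, hk, hk] at this
    exact this
  have ric' : ∀ a, |∑ i, G z (dd (e i) f p) (Rm Γ z (dd (e i) f p) (fr a) (ν p))|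
      ≤ (r₀ ^ 2)⁻¹ := fun a => by
    have h1 := ric a none
    rw [Fintype.sum_option] at h1
    -- The term of the Ricci trace with ν in the first slot vanishes, so the hypersurface trace is a
    -- full Ricci component.
    have h2 : G z (Rm Γ z (fr none) (fr a) (fr none)) (fr none) = 0 := mc.lc.Rm_self hV _ _ _
    rw [h2, zero_add] at h1
    simp only [mc.lc.symmG z hV (dd _ f p)]
    exact h1
  -- Hessian
  have hess : ∀ a b, |G z (fr b) (nab Γ Y z (fr a))| ≤ r₀⁻¹ := fun a b => by
    refine le_trans ?_ (h.hess_le q hq)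
    have e3 : hessian (ambientMetric n M) (signedDist Ω) q
        = fun v w => pullForm q q ((bil (G z)).flip.comp (nab Γ Y z).toLinearMap) v w := by
      funext v w
      rw [mc.hessian_eq_nab hV hr hY hrY]
      rfl
    rw [e3]
    have := F.abs_le_normForm
      (pullForm q q ((bil (G z)).flip.comp (nab Γ Y z).toLinearMap)) a b
    rw [pullForm_apply, hk, hk] at this
    exact this
  have cov : ∀ a, |G z (ν p) (nab2 Γ Y z (fr a) (fr a))| ≤ (r₀ ^ 2)⁻¹ := fun a => by
    refine le_trans ?_ (h.cov2_le q hq)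
    have e3 : cov2 (ambientMetric n M) (radial n Ω) q
        = fun v w => ((pullForm q q (nab2Form Γ Y z)).compr₂ (lam q q).toLinearMap) v w := by
      funext v w
      have := congrArg (lam q q) (mc.kap_cov2 hV hY v w)
      rw [lam_kap hqs] at this
      exact this
    rw [e3]
    have := F.abs_le_normVForm
      ((pullForm q q (nab2Form Γ Y z)).compr₂ (lam q q).toLinearMap) a a none
    simp only [LinearMap.compr₂_apply, pullForm_apply, hk, bil_apply,
      ContinuousLinearMap.coe_coe] at this
    rw [kap_lam hqs] at this
    exact this
  refine ⟨h.pos, by rwa [hf], ?_, fun l => ?_, ?_, fun k i => ?_, fun i => ?_, ?_, fun i => ?_⟩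
  all_goals rw [hf]
  · have h1 := F.self_eq_sum (radial n Ω q)
    rw [← F.eq, norm_radial h hne hq, Fintype.sum_option] at h1
    simp only [pullForm_apply, bil_apply, hk] at h1
    rw [add_comm, hYdef, hz, vhat_chart hqs]
    exact h1.symm
  · exact ric' (some l)
  · exact ric' none
  · exact hess (some i) (some k)
  · exact hess (some i) none
  · exact hess none none
  · exact cov (some i)

end PointBounds

/-! ### Fundamental forms of a family of hypersurfaces in coordinates -/

section HypCoord

variable {W E : Type*} [NormedAddCommGroup W] [NormedSpace ℝ W] [NormedAddCommGroup E]
  [NormedSpace ℝ E] {F : Type*} [NormedAddCommGroup F] [NormedSpace ℝ F]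

lemma hasFDerivAt_slice {u : ℝ × W → F} {p : ℝ × W} (hu : DifferentiableAt ℝ u p) :
    HasFDerivAt (fun w => u (p.1, w)) ((fderiv ℝ u p).comp (ContinuousLinearMap.inr ℝ ℝ W)) p.2 :=
  HasFDerivAt.comp (g := u) p.2 (f := fun w => (p.1, w)) hu.hasFDerivAt
    (hasFDerivAt_prodMk_right p.1 p.2)

lemma dd_slice {u : ℝ × W → F} {p : ℝ × W} (hu : DifferentiableAt ℝ u p) (v : W) :
    dd v (fun w => u (p.1, w)) p.2 = dd (0, v) u p := by
  rw [dd, (hasFDerivAt_slice hu).fderiv]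
  rfl

lemma deriv_slice {u : ℝ × W → ℝ} {p : ℝ × W} (hu : DifferentiableAt ℝ u p) :
    deriv (fun s => u (s, p.2)) p.1 = dd (1, 0) u p := by
  have := HasFDerivAt.comp (g := u) p.1 (f := fun s => (s, p.2)) hu.hasFDerivAt
    (hasFDerivAt_prodMk_left p.1 p.2)
  rw [← fderiv_apply_one_eq_deriv]
  exact congrArg (fun L => L (1 : ℝ)) this.fderiv

/-- The differential of `f` in the space directions. -/
def tang (f : ℝ × W → E) (p : ℝ × W) : W →L[ℝ] E :=
  (fderiv ℝ f p).comp (ContinuousLinearMap.inr ℝ ℝ W)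

/-- The covariant differential of `ν` in the space directions. -/
def covTang (Γ : E → E →L[ℝ] E →L[ℝ] E) (f ν : ℝ × W → E) (p : ℝ × W) : W →L[ℝ] E :=
  (fderiv ℝ ν p + ((Γ (f p)).flip (ν p)).comp (fderiv ℝ f p)).comp (ContinuousLinearMap.inr ℝ ℝ W)

/-- The first fundamental form. -/
def hform (G : E → E →L[ℝ] E →L[ℝ] ℝ) (f : ℝ × W → E) (p : ℝ × W) : W →L[ℝ] W →L[ℝ] ℝ :=
  (G (f p)).bilinearComp (tang f p) (tang f p)

/-- The second fundamental form. -/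
def aform (G : E → E →L[ℝ] E →L[ℝ] ℝ) (Γ : E → E →L[ℝ] E →L[ℝ] E) (f ν : ℝ × W → E)
    (p : ℝ × W) : W →L[ℝ] W →L[ℝ] ℝ :=
  (G (f p)).bilinearComp (covTang Γ f ν p) (tang f p)

/-- The shape operator. -/
def shapeOp (G : E → E →L[ℝ] E →L[ℝ] ℝ) (Γ : E → E →L[ℝ] E →L[ℝ] E) (f ν : ℝ × W → E)
    (p : ℝ × W) : W →L[ℝ] W :=
  (hform G f p).inverse.comp (aform G Γ f ν p)

variable (V : Set E) (G : E → E →L[ℝ] E →L[ℝ] ℝ) (Γ : E → E →L[ℝ] E →L[ℝ] E)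
  (O : Set (ℝ × W)) (f ν : ℝ × W → E)

/-- A smooth family `f` of immersed hypersurfaces with unit normal `ν`. -/
structure HypCoord : Prop where
  lc : IsLC V G Γ
  pos : ∀ z ∈ V, ∀ u, u ≠ 0 → 0 < G z u u
  isOpen : IsOpen O
  smf : Sm O f
  smν : Sm O ν
  mem : ∀ p ∈ O, f p ∈ V
  inj : ∀ p ∈ O, ∀ v : W, dd (0, v) f p = 0 → v = 0
  unit : ∀ p ∈ O, G (f p) (ν p) (ν p) = 1
  normal : ∀ p ∈ O, ∀ v : W, G (f p) (ν p) (dd (0, v) f p) = 0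

variable {V G Γ O f ν} {p : ℝ × W}

lemma tang_apply (v : W) : tang f p v = dd (0, v) f p := rfl

lemma hform_apply (u v : W) : hform G f p u v = G (f p) (dd (0, u) f p) (dd (0, v) f p) := rfl

lemma aform_apply (u v : W) :
    aform G Γ f ν p u v = G (f p) (covD Γ f (0, u) ν p) (dd (0, v) f p) := rfl

/-- The trace of an operator may be computed in the frame of any form; this compares the frame fixed
at `p₀` with frames adapted to other points. -/
lemma sum_trace {ι κ : Type*} [Fintype ι] [Fintype κ] {B B' : W →L[ℝ] W →L[ℝ] ℝ} {e : ι → W}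
    {e' : κ → W} (he : ∀ v, v = ∑ a, B (e a) v • e a) (he' : ∀ v, v = ∑ a, B' (e' a) v • e' a)
    (L : W →L[ℝ] W) : ∑ a, B (e a) (L (e a)) = ∑ a, B' (e' a) (L (e' a)) := by
  have e1 : ∀ b, B' (e' b) (L (e' b)) = ∑ a, B (e a) (e' b) * B' (e' b) (L (e a)) := fun b => by
    have := congrArg (fun v => B' (e' b) (L v)) (he (e' b))
    simpa only [map_sum, map_smul, smul_eq_mul] using this
  have e2 : ∀ a, B (e a) (L (e a)) = ∑ b, B (e a) (e' b) * B' (e' b) (L (e a)) := fun a => by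
    have := congrArg (fun v => B (e a) v) (he' (L (e a)))
    simp only [map_sum, map_smul, smul_eq_mul] at this
    rw [this]
    exact Finset.sum_congr rfl fun _ _ => mul_comm _ _
  simp only [e1, e2]
  exact Finset.sum_comm

namespace HypCoord

variable (h : HypCoord V G Γ O f ν)
include h

lemma hform_symm (hp : p ∈ O) (u v : W) : hform G f p u v = hform G f p v u :=
  h.lc.symmG _ (h.mem p hp) _ _

lemma hform_pos (hp : p ∈ O) (u : W) (hu : u ≠ 0) : 0 < hform G f p u u :=
  h.pos _ (h.mem p hp) _ fun h0 => hu (h.inj p hp u h0)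

lemma ip_covD_normal (hp : p ∈ O) (a : ℝ × W) : G (f p) (covD Γ f a ν p) (ν p) = 0 := by
  have h1 := h.lc.dd_ip (a := a) (h.mem p hp) (h.smf.diff hp) (h.smν.diff hp) (h.smν.diff hp)
  rw [dd_congr h.isOpen h.unit hp, dd_const, h.lc.symmG _ (h.mem p hp) (ν p)] at h1
  linarith

variable [FiniteDimensional ℝ W] [FiniteDimensional ℝ E]

lemma sm_hform : Sm O (hform G f) :=
  sm_clm h.isOpen fun u => sm_clm h.isOpen fun v =>
    h.lc.sm_ip h.smf h.mem (h.smf.dd (0, u)) (h.smf.dd (0, v))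

lemma sm_aform : Sm O (aform G Γ f ν) :=
  sm_clm h.isOpen fun u => sm_clm h.isOpen fun v =>
    h.lc.sm_ip h.smf h.mem (h.lc.sm_covD h.smf h.mem h.smν (0, u)) (h.smf.dd (0, v))

lemma isInvertible_hform (hp : p ∈ O) : (hform G f p).IsInvertible :=
  isInvertible_of_pos (h.hform_pos hp)

lemma sm_shapeOp (u : W) : Sm O fun p => shapeOp G Γ f ν p u :=
  have : CompleteSpace W := FiniteDimensional.complete ℝ W
  (h.sm_hform.inverse fun _ hp => h.isInvertible_hform hp).clm_apply
    (h.sm_aform.clm_apply fun _ _ => contDiffAt_const)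

lemma hform_shapeOp (hp : p ∈ O) (u v : W) :
    hform G f p (shapeOp G Γ f ν p u) v = aform G Γ f ν p u v := by
  obtain ⟨e, he⟩ := h.isInvertible_hform hp
  rw [shapeOp, ← he, ContinuousLinearMap.inverse_equiv]
  exact congrArg (fun L => L v) (e.apply_symm_apply _)

variable (hd : Module.finrank ℝ E = Module.finrank ℝ W + 1)
include hd

lemma orthoAt {ι : Type*} [Fintype ι] [DecidableEq ι] (hp : p ∈ O) {e : ι → W}
    (he : ∀ i j, hform G f p (e i) (e j) = if i = j then 1 else 0)
    (hc : Fintype.card ι = Module.finrank ℝ W) : OrthoAt G f ν (fun i => ((0 : ℝ), e i)) p := by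
  refine ⟨he, ?_⟩
  let fr : Option ι → E := fun o => o.elim (ν p) fun i => dd (0, e i) f p
  have ho : ∀ a b, G (f p) (fr a) (fr b) = if a = b then 1 else 0 := by
    rintro (_ | i) (_ | j)
    · exact (h.unit p hp).trans (by simp)
    · exact (h.normal p hp _).trans (by simp)
    · exact ((h.lc.symmG _ (h.mem p hp) _ _).trans (h.normal p hp (e i))).trans (by simp)
    · exact (he i j).trans (by simp)
  intro v
  have := span_of_orthonormal ho (by rw [Fintype.card_option, hc, hd]) v
  rw [Fintype.sum_option, add_comm] at this
  exact this

/-- D_u ν is tangential because |ν| = 1, and its products with tangent vectors are those of the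
shape operator by construction. -/
lemma weingarten (hp : p ∈ O) (u : W) :
    covD Γ f (0, u) ν p = dd (0, shapeOp G Γ f ν p u) f p := by
  obtain ⟨e, he⟩ := IMCF.exists_orthonormal (h.hform_symm hp) (h.hform_pos hp) rfl
  have ho := h.orthoAt hd hp he (by simp)
  refine sub_eq_zero.1 ((ho.span _).trans ?_)
  have hs := h.lc.symmG _ (h.mem p hp)
  have e1 : G (f p) (ν p) (covD Γ f (0, u) ν p - dd (0, shapeOp G Γ f ν p u) f p) = 0 := by
    rw [map_sub, h.normal p hp, hs, h.ip_covD_normal hp, sub_zero]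
  have e2 : ∀ i, G (f p) (dd (0, e i) f p)
      (covD Γ f (0, u) ν p - dd (0, shapeOp G Γ f ν p u) f p) = 0 := fun i => by
    rw [map_sub, hs, hs _ (dd (0, shapeOp G Γ f ν p u) f p), ← aform_apply, ← hform_apply,
      h.hform_shapeOp hp, sub_self]
  simp only [e1, e2, zero_smul, Finset.sum_const_zero, add_zero]

/-- The frame `e` is constant and adapted only to `p₀`. By `he`, pairing with `e k` in the form at
`p₀` is a coefficient functional on all of `W`, so these entries represent the shape operator
smoothly at every point. Its trace is `H` there by `sum_trace`. -/
theorem coreFlow {ι : Type*} [Fintype ι] [DecidableEq ι] {p₀ : ℝ × W} {e : ι → W}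
    (he : ∀ v, v = ∑ i, hform G f p₀ (e i) v • e i)
    {H : ℝ × W → ℝ}
    (hH : ∀ p ∈ O, ∀ e' : Fin (Module.finrank ℝ W) → W,
      (∀ v, v = ∑ i, hform G f p (e' i) v • e' i) → H p = ∑ i, aform G Γ f ν p (e' i) (e' i))
    (hpos : ∀ p ∈ O, 0 < H p) (hev : ∀ p ∈ O, dd (1, 0) f p = (H p)⁻¹ • ν p) :
    CoreFlow V G Γ O f ν (fun i => ((0 : ℝ), e i)) (1, 0)
      (fun k j p => hform G f p₀ (e k) (shapeOp G Γ f ν p (e j))) H := by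
  refine ⟨h.lc, h.isOpen, h.smf, h.smν, fun k j => ?_, h.mem, fun p hp j => ?_, h.unit,
    fun p hp j => h.normal p hp _, fun p hp => ?_, hpos, hev⟩
  · exact Sm.clm_apply (fun _ _ => contDiffAt_const) (h.sm_shapeOp (e j))
  · rw [h.weingarten hd hp]
    conv_lhs => rw [he (shapeOp G Γ f ν p (e j))]
    simp only [← tang_apply, map_sum, map_smul]
  · obtain ⟨e', he'⟩ := IMCF.exists_orthonormal (h.hform_symm hp) (h.hform_pos hp) rfl
    have hs := span_of_orthonormal he' (by simp)
    rw [hH p hp e' hs, sum_trace he hs]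
    refine Finset.sum_congr rfl fun i _ => ?_
    rw [h.hform_symm hp, h.hform_shapeOp hp]

omit hd in
/-- The induced connection is the tangential part of the ambient connection. -/
lemma hform_christoffel {t : ℝ} {Γn : W → W →L[ℝ] W →L[ℝ] W}
    (hn : IsLC {w | (t, w) ∈ O} (fun w => hform G f (t, w)) Γn) {w : W} (hw : (t, w) ∈ O)
    (u v x : W) : hform G f (t, w) (Γn w u v) x
      = G (f (t, w)) (covD Γ f (0, u) (dd (0, v) f) (t, w)) (dd (0, x) f (t, w)) := by
  have e1 : ∀ u v x : W, fderiv ℝ (fun w => hform G f (t, w)) w u v x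
      = G (f (t, w)) (covD Γ f (0, u) (dd (0, v) f) (t, w)) (dd (0, x) f (t, w))
        + G (f (t, w)) (dd (0, v) f (t, w)) (covD Γ f (0, u) (dd (0, x) f) (t, w)) :=
    fun u v x => by
      have hd1 : DifferentiableAt ℝ (fun w => hform G f (t, w)) w := hn.smG.diff hw
      have h1 := dd_comp_apply₂ (a := u) (T := fun w => hform G f (t, w)) (f := fun w => w)
        (p := w) hd1 differentiableAt_id (differentiableAt_const (c := v))
        (differentiableAt_const (c := x))
      have did : dd u (fun w : W => w) w = u := by simp [dd]
      rw [did, dd_const, dd_const, map_zero, zero_apply, map_zero, add_zero, add_zero] at h1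
      have hsm : Sm O fun p => G (f p) (dd (0, v) f p) (dd (0, x) f p) :=
        h.lc.sm_ip h.smf h.mem (h.smf.dd _) (h.smf.dd _)
      have h2 := dd_slice (p := (t, w)) (hsm.diff hw) u
      rw [h.lc.dd_ip (h.mem _ hw) (h.smf.diff hw) ((h.smf.dd _).diff hw) ((h.smf.dd _).diff hw)]
        at h2
      exact h1.symm.trans h2
  have hk := hn.koszul hw u v x
  rw [e1, e1, e1] at hk
  have hs := h.lc.symmG _ (h.mem _ hw)
  have ht : ∀ u v : W, covD Γ f (0, u) (dd (0, v) f) (t, w) = covD Γ f (0, v) (dd (0, u) f) (t, w) :=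
    fun u v => h.lc.torsion h.smf h.mem hw
  rw [ht v u, ht x u, ht x v] at hk
  have h1 := hs (dd (0, v) f (t, w)) (covD Γ f (0, u) (dd (0, x) f) (t, w))
  have h2 := hs (dd (0, x) f (t, w)) (covD Γ f (0, u) (dd (0, v) f) (t, w))
  have h3 := hs (dd (0, u) f (t, w)) (covD Γ f (0, v) (dd (0, x) f) (t, w))
  linarith

omit hd in
-- The intrinsic Christoffel symbols are the tangential part of the ambient derivative
-- (`hform_christoffel`), so the correction terms of the two Laplacians agree.
theorem lapE_eq {ι : Type*} [Fintype ι] {t : ℝ} {Γn : W → W →L[ℝ] W →L[ℝ] W}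
    (hn : IsLC {w | (t, w) ∈ O} (fun w => hform G f (t, w)) Γn) {w : W} (hw : (t, w) ∈ O)
    {e : ι → W} (he : ∀ v, v = ∑ i, hform G f (t, w) (e i) v • e i) {u : ℝ × W → ℝ}
    (hu : Sm O u) :
    lapE G Γ f (fun i => ((0 : ℝ), e i)) u (t, w)
      = ∑ i, (dd (e i) (dd (e i) fun w => u (t, w)) w
        - fderiv ℝ (fun w => u (t, w)) w (Γn w (e i) (e i))) := by
  refine Finset.sum_congr rfl fun i _ => ?_
  have e1 : dd (e i) (dd (e i) fun w => u (t, w)) w = dd (0, e i) (dd (0, e i) u) (t, w) := by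
    rw [dd_congr hn.isOpen (u := dd (e i) fun w => u (t, w))
      (v := fun w => dd (0, e i) u (t, w)) (fun w hw => dd_slice (p := (t, w)) (hu.diff hw) _) hw]
    exact dd_slice (p := (t, w)) ((hu.dd _).diff hw) _
  have e2 : fderiv ℝ (fun w => u (t, w)) w (Γn w (e i) (e i))
      = ∑ k, G (f (t, w)) (dd (0, e k) f (t, w))
          (covD Γ f (0, e i) (dd (0, e i) f) (t, w)) * dd (0, e k) u (t, w) := by
    conv_lhs => rw [he (Γn w (e i) (e i))]
    rw [map_sum]
    refine Finset.sum_congr rfl fun k _ => ?_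
    rw [map_smul, smul_eq_mul, h.hform_symm hw, h.hform_christoffel hn hw,
      h.lc.symmG _ (h.mem _ hw)]
    exact congrArg _ (dd_slice (p := (t, w)) (hu.diff hw) (e k))
  rw [e1, e2]

end HypCoord
end HypCoord

lemma Frame.of_kap {k : ℕ} {M : Type*} [TopologicalSpace M]
    [ChartedSpace (EuclideanSpace ℝ (Fin k)) M] [IsManifold (𝓡 k) ∞ M] {g : MetricField k M}
    {q y : M} (hy : y ∈ (extChartAt (𝓡 k) q).source)
    {B : EuclideanSpace ℝ (Fin k) →L[ℝ] EuclideanSpace ℝ (Fin k) →L[ℝ] ℝ}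
    (hB : ∀ u v, g y u v = B (kap q y u) (kap q y v)) (hs : ∀ u v, B u v = B v u)
    {ι : Type*} [Fintype ι] {e : ι → EuclideanSpace ℝ (Fin k)}
    (he : ∀ v, v = ∑ a, B (e a) v • e a) :
    Frame g y (pullForm q y (bil B)) fun a => lam q y (e a) := by
  refine ⟨hB, fun u v => hs _ _, fun v => ?_⟩
  simp only [pullForm_apply, bil_apply, kap_lam hy]
  have := congrArg (lam q y) (he (kap q y v))
  rw [lam_kap hy] at this
  refine this.trans ?_
  simp only [map_sum, map_smul]

/-! ### The flow read in charts of the two manifolds -/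

section FlowCoord

variable {n : ℕ} {M : Type*} [MetricSpace M] [ChartedSpace (EuclideanSpace ℝ (Fin n)) M]
  [IsManifold (𝓡 n) ∞ M]
  {N : Type*} [TopologicalSpace N] [ChartedSpace (EuclideanSpace ℝ (Fin (n - 1))) N]
  [IsManifold (𝓡 (n - 1)) ∞ N]

/-- The parametrization of `ℝ × N` by the chart at `x₀`. -/
def slab (x₀ : N) (p : ℝ × EuclideanSpace ℝ (Fin (n - 1))) : ℝ × N :=
  (p.1, (extChartAt (𝓡 (n - 1)) x₀).symm p.2)

/-- The flow in the charts at `x₀` and `q`. -/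
def fhat (q : M) (x₀ : N) (Φ : ℝ → N → M) (p : ℝ × EuclideanSpace ℝ (Fin (n - 1))) :
    EuclideanSpace ℝ (Fin n) :=
  extChartAt (𝓡 n) q (Φ p.1 ((extChartAt (𝓡 (n - 1)) x₀).symm p.2))

/-- The normal of the flow in the charts at `x₀` and `q`. -/
def nhat (q : M) (x₀ : N) (Φ : ℝ → N → M) (ν : ∀ t x, TangentSpace (𝓡 n) (Φ t x))
    (p : ℝ × EuclideanSpace ℝ (Fin (n - 1))) : EuclideanSpace ℝ (Fin n) :=
  kap q (Φ p.1 ((extChartAt (𝓡 (n - 1)) x₀).symm p.2))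
    (ν p.1 ((extChartAt (𝓡 (n - 1)) x₀).symm p.2))

/-- The domain on which the flow is described by the charts at `x₀` and `q`. -/
def flowDom (q : M) (x₀ : N) (U : Set (ℝ × N)) (Φ : ℝ → N → M) :
    Set (ℝ × EuclideanSpace ℝ (Fin (n - 1))) :=
  {p | p.2 ∈ (extChartAt (𝓡 (n - 1)) x₀).target ∧
    (p.1, (extChartAt (𝓡 (n - 1)) x₀).symm p.2) ∈ U ∧
    Φ p.1 ((extChartAt (𝓡 (n - 1)) x₀).symm p.2) ∈ (extChartAt (𝓡 n) q).source}

lemma contMDiffAt_slab {x₀ : N} {p : ℝ × EuclideanSpace ℝ (Fin (n - 1))}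
    (hp : p.2 ∈ (extChartAt (𝓡 (n - 1)) x₀).target) :
    ContMDiffAt 𝓘(ℝ, ℝ × EuclideanSpace ℝ (Fin (n - 1))) (𝓘(ℝ, ℝ).prod (𝓡 (n - 1))) ∞
      (slab x₀) p :=
  (contDiff_fst.contMDiff.contMDiffAt (x := p)).prodMk
    (((contMDiffOn_extChartAt_symm (I := 𝓡 (n - 1)) (n := ∞) x₀).contMDiffAt
      ((isOpen_extChartAt_target x₀).mem_nhds hp)).comp p contDiff_snd.contMDiff.contMDiffAt)

variable [RiemannianBundle (fun x : M => TangentSpace (𝓡 n) x)]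
  {U : Set (ℝ × N)} {Φ : ℝ → N → M} {ν : ∀ t x, TangentSpace (𝓡 n) (Φ t x)} {q : M} {x₀ : N}
  {p : ℝ × EuclideanSpace ℝ (Fin (n - 1))} {V : Set (EuclideanSpace ℝ (Fin n))}
  {G : EuclideanSpace ℝ (Fin n) →
      EuclideanSpace ℝ (Fin n) →L[ℝ] EuclideanSpace ℝ (Fin n) →L[ℝ] ℝ}
  {Γ : EuclideanSpace ℝ (Fin n) →
      EuclideanSpace ℝ (Fin n) →L[ℝ] EuclideanSpace ℝ (Fin n) →L[ℝ] EuclideanSpace ℝ (Fin n)}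

lemma map_mem_of_mem_flowDom {s : Set M} (hs : ∀ t x, (t, x) ∈ U → Φ t x ∈ s)
    (hp : p ∈ flowDom q x₀ U Φ) : fhat q x₀ Φ p ∈ chartSet q s :=
  ⟨(extChartAt (𝓡 n) q).map_source hp.2.2, by
    rw [fhat, mem_preimage, (extChartAt (𝓡 n) q).left_inv hp.2.2]; exact hs _ _ hp.2.1⟩

namespace IsSmoothIMCF

variable (h : IsSmoothIMCF U Φ ν)
include h

lemma isOpen_flowDom : IsOpen (flowDom (n := n) q x₀ U Φ) := by
  have h1 : IsOpen (U ∩ (fun r : ℝ × N => Φ r.1 r.2) ⁻¹' (extChartAt (𝓡 n) q).source) :=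
    h.smooth.continuousOn.isOpen_inter_preimage h.isOpen (isOpen_extChartAt_source q)
  have h2 : ContinuousOn (slab (n := n) x₀) (Prod.snd ⁻¹' (extChartAt (𝓡 (n - 1)) x₀).target) :=
    fun p hp => (contMDiffAt_slab hp).continuousAt.continuousWithinAt
  exact h2.isOpen_inter_preimage ((isOpen_extChartAt_target x₀).preimage continuous_snd) h1

lemma sm_fhat : Sm (flowDom (n := n) q x₀ U Φ) (fhat q x₀ Φ) := fun p hp => by
  have h1 := h.smooth.contMDiffAt (h.isOpen.mem_nhds hp.2.1)
  exact ((contMDiffAt_extChartAt' (I := 𝓡 n) (n := ∞) (x := q)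
    (by rw [← extChartAt_source (𝓡 n)]; exact hp.2.2)).comp p
    (h1.comp p (contMDiffAt_slab hp.1))).contDiffAt

lemma sm_nhat : Sm (flowDom (n := n) q x₀ U Φ) (nhat q x₀ Φ ν) := fun p hp => by
  have h1 := (h.smooth_normal.contMDiffAt (h.isOpen.mem_nhds hp.2.1)).comp p
    (contMDiffAt_slab hp.1)
  have h2 := (((trivializationAt (EuclideanSpace ℝ (Fin n)) (TangentSpace (𝓡 n) (M := M))
    q).contMDiffAt_iff ((Trivialization.mem_source _).2
      (by rw [TangentBundle.trivializationAt_baseSet, ← extChartAt_source (𝓡 n)]; exact hp.2.2))).1 h1).2.contDiffAt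
  refine h2.congr_of_eventuallyEq ?_
  filter_upwards [h.isOpen_flowDom.mem_nhds hp] with p' hp'
  exact kap_eq_snd hp'.2.2 _

lemma continuousAt_slice {t : ℝ} {x : N} (hx : (t, x) ∈ U) : ContinuousAt (Φ t) x :=
  ContinuousAt.comp (g := fun r : ℝ × N => Φ r.1 r.2)
    (h.smooth.continuousOn.continuousAt (h.isOpen.mem_nhds hx))
    (Continuous.prodMk_right t).continuousAt

lemma kap_mfderiv_slice (hp : p ∈ flowDom q x₀ U Φ)
    (v : TangentSpace (𝓡 (n - 1)) ((extChartAt (𝓡 (n - 1)) x₀).symm p.2)) :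
    kap q _ (mfderiv (𝓡 (n - 1)) (𝓡 n) (Φ p.1) ((extChartAt (𝓡 (n - 1)) x₀).symm p.2) v)
      = dd (0, kap x₀ _ v) (fhat q x₀ Φ) p := by
  have e := (extChartAt (𝓡 (n - 1)) x₀).right_inv hp.1
  have hd := h.sm_fhat.diff hp
  rw [kap_mfderiv ((extChartAt (𝓡 (n - 1)) x₀).map_target hp.1) hp.2.2
    (h.continuousAt_slice hp.2.1)
    (by rw [e]; exact (hasFDerivAt_slice hd).differentiableAt) v, e]
  exact dd_slice hd _

lemma kap_covAlong_slice (mc : MetricCoord (ambientMetric n M) q V G Γ)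
    (hp : p ∈ flowDom q x₀ U Φ) (hV : fhat q x₀ Φ p ∈ V)
    (v : TangentSpace (𝓡 (n - 1)) ((extChartAt (𝓡 (n - 1)) x₀).symm p.2)) :
    kap q _ (covAlong (ambientMetric n M) (Φ p.1) (ν p.1) _ v)
      = covD Γ (fhat q x₀ Φ) (0, kap x₀ _ v) (nhat q x₀ Φ ν) p := by
  have e := (extChartAt (𝓡 (n - 1)) x₀).right_inv hp.1
  have hd := h.sm_fhat.diff hp
  have hd' := h.sm_nhat.diff hp
  rw [mc.kap_covAlong ((extChartAt (𝓡 (n - 1)) x₀).map_target hp.1) hp.2.2 hV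
    (h.continuousAt_slice hp.2.1)
    (by rw [e]; exact (hasFDerivAt_slice hd).differentiableAt)
    (by rw [e]; exact (hasFDerivAt_slice hd').differentiableAt) v, e]
  have e1 := dd_slice hd (kap x₀ _ v)
  have e2 := dd_slice hd' (kap x₀ _ v)
  rw [covD, covD, ← e1, ← e2]
  rfl

lemma kap_velocity (hp : p ∈ flowDom q x₀ U Φ) :
    kap q _ (mfderiv 𝓘(ℝ, ℝ) (𝓡 n) (fun s => Φ s ((extChartAt (𝓡 (n - 1)) x₀).symm p.2)) p.1
      (1 : ℝ)) = dd (1, 0) (fhat q x₀ Φ) p := by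
  have h1 : MDifferentiableAt 𝓘(ℝ, ℝ) (𝓡 n)
      (fun s => Φ s ((extChartAt (𝓡 (n - 1)) x₀).symm p.2)) p.1 :=
    MDifferentiableAt.comp (I' := 𝓘(ℝ, ℝ).prod (𝓡 (n - 1))) p.1
      (g := fun r : ℝ × N => Φ r.1 r.2)
      ((h.smooth.contMDiffAt (h.isOpen.mem_nhds hp.2.1)).mdifferentiableAt (by simp))
      (mdifferentiableAt_id.prodMk mdifferentiableAt_const)
  have h2 := ((hasMFDerivAt_chart hp.2.2).comp p.1 h1.hasMFDerivAt).mfderiv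
  have h3 := HasFDerivAt.comp (g := fhat q x₀ Φ) p.1 (f := fun s => (s, p.2))
    (h.sm_fhat.diff hp).hasFDerivAt (hasFDerivAt_prodMk_left p.1 p.2)
  have h4 := h2.symm.trans h3.hasMFDerivAt.mfderiv
  exact congrArg (fun L => L (1 : ℝ)) h4

variable (mc : MetricCoord (ambientMetric n M) q V G Γ)
include mc

lemma flowMetric_eq (hp : p ∈ flowDom q x₀ U Φ) (hV : fhat q x₀ Φ p ∈ V)
    (u v : TangentSpace (𝓡 (n - 1)) ((extChartAt (𝓡 (n - 1)) x₀).symm p.2)) :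
    flowMetric n Φ p.1 _ u v = hform G (fhat q x₀ Φ) p (kap x₀ _ u) (kap x₀ _ v) := by
  rw [flowMetric, inducedMetric, mc.eq _ hp.2.2 hV, h.kap_mfderiv_slice hp,
    h.kap_mfderiv_slice hp, hform_apply]
  rfl

lemma secondFF_eq (hp : p ∈ flowDom q x₀ U Φ) (hV : fhat q x₀ Φ p ∈ V)
    (u v : TangentSpace (𝓡 (n - 1)) ((extChartAt (𝓡 (n - 1)) x₀).symm p.2)) :
    secondFF (ambientMetric n M) (Φ p.1) (ν p.1) _ u v
      = aform G Γ (fhat q x₀ Φ) (nhat q x₀ Φ ν) p (kap x₀ _ u) (kap x₀ _ v) := by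
  rw [secondFF, mc.eq _ hp.2.2 hV, h.kap_covAlong_slice mc hp hV,
    h.kap_mfderiv_slice hp, aform_apply]
  rfl

theorem hypCoord (hV : ∀ p ∈ flowDom q x₀ U Φ, fhat q x₀ Φ p ∈ V) :
    HypCoord V G Γ (flowDom q x₀ U Φ) (fhat q x₀ Φ) (nhat q x₀ Φ ν) := by
  refine ⟨mc.lc, mc.posG, h.isOpen_flowDom, h.sm_fhat, h.sm_nhat, hV, fun p hp v hv => ?_,
    fun p hp => ?_, fun p hp v => ?_⟩
  · have hx := (extChartAt (𝓡 (n - 1)) x₀).map_target hp.1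
    have h1 := h.kap_mfderiv_slice hp (lam x₀ _ v)
    rw [kap_lam hx, hv] at h1
    have h2 := congrArg (lam q (Φ p.1 ((extChartAt (𝓡 (n - 1)) x₀).symm p.2))) h1
    rw [lam_kap hp.2.2, map_zero] at h2
    have h3 := h.immersion _ _ hp.2.1 (h2.trans (map_zero _).symm)
    rw [← kap_lam hx v, h3, map_zero]
  · have := h.unit _ _ hp.2.1
    rw [mc.eq _ hp.2.2 (hV p hp)] at this
    exact this
  · have hx := (extChartAt (𝓡 (n - 1)) x₀).map_target hp.1
    have := h.normal _ _ hp.2.1 (lam x₀ _ v)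
    rw [mc.eq _ hp.2.2 (hV p hp), h.kap_mfderiv_slice hp, kap_lam hx] at this
    exact this

variable (hV : ∀ p ∈ flowDom q x₀ U Φ, fhat q x₀ Φ p ∈ V) (hp : p ∈ flowDom q x₀ U Φ)
include hV hp

lemma frame {ι : Type*} [Fintype ι] {e : ι → EuclideanSpace ℝ (Fin (n - 1))}
    (he : ∀ v, v = ∑ a, hform G (fhat q x₀ Φ) p (e a) v • e a) :
    Frame (flowMetric n Φ p.1) ((extChartAt (𝓡 (n - 1)) x₀).symm p.2)
      (pullForm x₀ _ (bil (hform G (fhat q x₀ Φ) p))) fun a => lam x₀ _ (e a) :=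
  Frame.of_kap ((extChartAt (𝓡 (n - 1)) x₀).map_target hp.1)
    (fun u v => h.flowMetric_eq mc hp (hV p hp) u v) ((h.hypCoord mc hV).hform_symm hp) he

/-- This holds at every point of the chart domain, not only at the centre, so that the mean
curvature can be differentiated. -/
theorem flowH_eq {ι : Type*} [Fintype ι] {e : ι → EuclideanSpace ℝ (Fin (n - 1))}
    (he : ∀ v, v = ∑ a, hform G (fhat q x₀ Φ) p (e a) v • e a) :
    flowH Φ ν p.1 ((extChartAt (𝓡 (n - 1)) x₀).symm p.2)
      = ∑ a, aform G Γ (fhat q x₀ Φ) (nhat q x₀ Φ ν) p (e a) (e a) := by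
  have e3 : secondFF (ambientMetric n M) (Φ p.1) (ν p.1)
      ((extChartAt (𝓡 (n - 1)) x₀).symm p.2) = fun u v =>
        pullForm x₀ _ (bil (aform G Γ (fhat q x₀ Φ) (nhat q x₀ Φ ν) p)) u v := by
    funext u v
    exact h.secondFF_eq mc hp (hV p hp) u v
  have F := h.frame mc hV hp he
  have h1 := F.traceForm_eq (pullForm x₀ _ (bil (aform G Γ (fhat q x₀ Φ) (nhat q x₀ Φ ν) p)))
  simp only [pullForm_apply, bil_apply,
    kap_lam ((extChartAt (𝓡 (n - 1)) x₀).map_target hp.1)] at h1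
  rw [flowH, meanCurv, e3]
  exact h1

-- The first fundamental form of the time slice is a metric with its own connection `Γn`. The point
-- is the centre of the chart at `x₀`, so the Hessian has the coordinate form `hessian_eq`, and
-- `lapE_eq` passes to the ambient connection.
omit hp in
theorem box_eq {t : ℝ} (hp : (t, extChartAt (𝓡 (n - 1)) x₀ x₀) ∈ flowDom q x₀ U Φ)
    {ι : Type*} [Fintype ι] {e : ι → EuclideanSpace ℝ (Fin (n - 1))}
    (he : ∀ v, v = ∑ a, hform G (fhat q x₀ Φ) (t, extChartAt (𝓡 (n - 1)) x₀ x₀) (e a) v • e a)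
    {u : ℝ → N → ℝ} {uh H : ℝ × EuclideanSpace ℝ (Fin (n - 1)) → ℝ}
    (hu : Sm (flowDom q x₀ U Φ) uh)
    (huh : ∀ p ∈ flowDom q x₀ U Φ, u p.1 ((extChartAt (𝓡 (n - 1)) x₀).symm p.2) = uh p)
    (hH : flowH Φ ν t x₀ = H (t, extChartAt (𝓡 (n - 1)) x₀ x₀)) :
    box Φ ν u t x₀ = boxE G Γ (fhat q x₀ Φ) (fun i => ((0 : ℝ), e i)) (1, 0) H uh
      (t, extChartAt (𝓡 (n - 1)) x₀ x₀) := by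
  have hc := h.hypCoord mc hV
  have hO : IsOpen {w | (t, w) ∈ flowDom q x₀ U Φ} :=
    h.isOpen_flowDom.preimage (Continuous.prodMk_right t)
  have hx := mem_extChartAt_source (I := 𝓡 (n - 1)) x₀
  have hl := (extChartAt (𝓡 (n - 1)) x₀).left_inv hx
  have hG : Sm {w | (t, w) ∈ flowDom q x₀ U Φ} fun w => hform G (fhat q x₀ Φ) (t, w) :=
    fun w hw => ContDiffAt.comp (g := hform G (fhat q x₀ Φ)) w (hc.sm_hform _ hw)
      (contDiff_prodMk_right t).contDiffAt
  obtain ⟨Γn, hn⟩ := exists_isLC hO hG (fun w hw => hc.hform_symm hw)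
    (fun w hw => hc.hform_pos hw)
  have mn : MetricCoord (flowMetric n Φ t) x₀ {w | (t, w) ∈ flowDom q x₀ U Φ}
      (fun w => hform G (fhat q x₀ Φ) (t, w)) Γn := by
    refine ⟨hn, fun w hw => hw.1, fun w hw => hc.hform_pos hw, fun y hy hw => ?_⟩
    -- The tangent space depends on the point, so the formula at the chart inverse of the chart
    -- value is transported along the equality with `y`.
    have key : ∀ y', y' = y →
        (∀ u v, flowMetric n Φ t y' u v
          = hform G (fhat q x₀ Φ) (t, extChartAt (𝓡 (n - 1)) x₀ y) (kap x₀ y' u) (kap x₀ y' v)) →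
        ∀ u v, flowMetric n Φ t y u v
          = hform G (fhat q x₀ Φ) (t, extChartAt (𝓡 (n - 1)) x₀ y) (kap x₀ y u) (kap x₀ y v) :=
      fun y' hy' hh => by subst hy'; exact hh
    exact key _ ((extChartAt (𝓡 (n - 1)) x₀).left_inv hy)
      fun u v => h.flowMetric_eq mc hw (hV _ hw) u v
  have hux : Sm {w | (t, w) ∈ flowDom q x₀ U Φ}
      fun w => u t ((extChartAt (𝓡 (n - 1)) x₀).symm w) :=
    Sm.congr hO (fun w hw => ContDiffAt.comp (g := uh) w (hu _ hw)
      (contDiff_prodMk_right t).contDiffAt) fun w hw => huh (t, w) hw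
  have F := mn.frame hx hp he
  have e1 : laplacian (flowMetric n Φ t) (u t) x₀
      = lapE G Γ (fhat q x₀ Φ) (fun i => ((0 : ℝ), e i)) uh (t, extChartAt (𝓡 (n - 1)) x₀ x₀) := by
    set z := extChartAt (𝓡 (n - 1)) x₀ x₀ with hz
    set g := fun w => u t ((extChartAt (𝓡 (n - 1)) x₀).symm w) with hg
    let T : EuclideanSpace ℝ (Fin (n - 1)) →ₗ[ℝ] EuclideanSpace ℝ (Fin (n - 1)) →ₗ[ℝ] ℝ :=
      LinearMap.mk₂ ℝ (fun v w => fderiv ℝ (fderiv ℝ g) z v w - fderiv ℝ g z (Γn z v w))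
        (fun u v w => by simp only [map_add, add_apply]; ring)
        (fun c v w => by simp only [map_smul, smul_apply, smul_eq_mul]; ring)
        (fun u v w => by simp only [map_add]; ring)
        (fun c v w => by simp only [map_smul, smul_eq_mul]; ring)
    have hT : ∀ v w, T v w = dd v (dd w g) z - fderiv ℝ g z (Γn z v w) := fun v w => by
      have h1 := dd_clm_apply (a := v) (T := fderiv ℝ g) (p := z) (hux.fderiv.diff hp)
        (differentiableAt_const (c := w))
      rw [dd_const, map_zero, add_zero] at h1
      exact congrArg (· - fderiv ℝ g z (Γn z v w)) h1.symm
    have h2 : hessian (flowMetric n Φ t) (u t) x₀ = fun v w => pullForm x₀ x₀ T v w := by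
      funext v w
      rw [mn.hessian_eq hp hux, pullForm_apply, hT]
    have hgu : ∀ w ∈ {w | (t, w) ∈ flowDom q x₀ U Φ}, g w = uh (t, w) := fun w hw =>
      huh (t, w) hw
    rw [laplacian, h2, F.traceForm_eq, hc.lapE_eq hn hp he hu]
    refine Finset.sum_congr rfl fun i _ => ?_
    rw [pullForm_apply, kap_lam hx, hT, dd_congr hO (fun w hw => dd_congr hO hgu hw) hp]
    exact congrArg _ (dd_congr hO hgu hp)
  have e2 : deriv (fun s => u s x₀) t = dd (1, 0) uh (t, extChartAt (𝓡 (n - 1)) x₀ x₀) := by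
    rw [← deriv_slice (hu.diff hp)]
    refine Filter.EventuallyEq.deriv_eq ?_
    filter_upwards [(h.isOpen_flowDom.preimage
      (Continuous.prodMk_left (extChartAt (𝓡 (n - 1)) x₀ x₀))).mem_nhds hp] with s hs
    have := huh _ hs
    rwa [hl] at this
  rw [box, boxE, e1, e2, hH]

end IsSmoothIMCF
end FlowCoord

/-! ### Local description of obstacle flows -/

section ObstacleFlow

variable {n : ℕ} {M : Type*} [MetricSpace M] [ChartedSpace (EuclideanSpace ℝ (Fin n)) M]
  [IsManifold (𝓡 n) ∞ M] [RiemannianBundle (fun x : M => TangentSpace (𝓡 n) x)]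
  {N : Type*} [TopologicalSpace N] [ChartedSpace (EuclideanSpace ℝ (Fin (n - 1))) N]
  [IsManifold (𝓡 (n - 1)) ∞ N] {U : Set (ℝ × N)} {Φ : ℝ → N → M}
  {ν : ∀ t x, TangentSpace (𝓡 n) (Φ t x)}

lemma isSmoothTangent_zero : IsSmoothTangent n U (fun _ _ => 0 : ℝ → VField (n - 1) N) :=
  ((Bundle.contMDiff_zeroSection ℝ (TangentSpace (𝓡 (n - 1)) (M := N))).comp
    contMDiff_snd).contMDiffOn

lemma gradInner_zero (f : ℝ → N → ℝ) (t : ℝ) (x : N) :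
    gradInner n Φ f (fun _ _ => 0) t x = 0 := by
  rw [gradInner, flowMetric, inducedMetric, map_zero]
  exact inner_zero_right _

variable [IsContMDiffRiemannianBundle (𝓡 n) ∞ (EuclideanSpace ℝ (Fin n))
    (fun x : M => TangentSpace (𝓡 n) x)] [IsRiemannianManifold (𝓡 n) M]
  {Ω : Set M} {r₀ : ℝ} {t : ℝ} {x : N}

/-- The signed distance in the chart at `q`. -/
def rhat (q : M) (Ω : Set M) (z : EuclideanSpace ℝ (Fin n)) : ℝ :=
  signedDist Ω ((extChartAt (𝓡 n) q).symm z)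

/-- The mean curvature in the chart at `x₀`. -/
def Hhat (x₀ : N) (Φ : ℝ → N → M) (ν : ∀ t x, TangentSpace (𝓡 n) (Φ t x))
    (p : ℝ × EuclideanSpace ℝ (Fin (n - 1))) : ℝ :=
  flowH Φ ν p.1 ((extChartAt (𝓡 (n - 1)) x₀).symm p.2)

/-- Near `(t, x)`, in the charts at `x` and `q = Φ t x`, an obstacle flow is given by a
`CoreFlow`, and the geometry at `(t, x)` is controlled. -/
structure LocalFlow (Ω : Set M) (r₀ : ℝ) (U : Set (ℝ × N)) (Φ : ℝ → N → M)
    (ν : ∀ t x, TangentSpace (𝓡 n) (Φ t x)) (t : ℝ) (x : N) (q : M)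
    (V : Set (EuclideanSpace ℝ (Fin n)))
    (G : EuclideanSpace ℝ (Fin n) →
      EuclideanSpace ℝ (Fin n) →L[ℝ] EuclideanSpace ℝ (Fin n) →L[ℝ] ℝ)
    (Γ : EuclideanSpace ℝ (Fin n) →
      EuclideanSpace ℝ (Fin n) →L[ℝ] EuclideanSpace ℝ (Fin n) →L[ℝ] EuclideanSpace ℝ (Fin n))
    (e : Fin (n - 1) → ℝ × EuclideanSpace ℝ (Fin (n - 1)))
    (S : Fin (n - 1) → Fin (n - 1) → ℝ × EuclideanSpace ℝ (Fin (n - 1)) → ℝ) : Prop where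
  mem : (t, extChartAt (𝓡 (n - 1)) x x) ∈ flowDom q x U Φ
  core : CoreFlow V G Γ (flowDom q x U Φ) (fhat q x Φ) (nhat q x Φ ν) e (1, 0) S (Hhat x Φ ν)
  ortho : OrthoAt G (fhat q x Φ) (nhat q x Φ ν) e (t, extChartAt (𝓡 (n - 1)) x x)
  bounds : FlowBounds G Γ (fhat q x Φ) (nhat q x Φ ν) e (vhat q (radial n Ω)) r₀
    (t, extChartAt (𝓡 (n - 1)) x x)
  smr : Sm V (rhat q Ω)
  smY : Sm V (vhat q (radial n Ω))
  grad_r : ∀ z ∈ V, ∀ v, fderiv ℝ (rhat q Ω) z v = G z v (vhat q (radial n Ω) z)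
  flowR_eq : ∀ p ∈ flowDom q x U Φ, flowR Ω Φ p.1 ((extChartAt (𝓡 (n - 1)) x).symm p.2)
    = rhat q Ω (fhat q x Φ p)
  flowP_eq : ∀ p ∈ flowDom q x U Φ, flowP Ω Φ ν p.1 ((extChartAt (𝓡 (n - 1)) x).symm p.2)
    = G (fhat q x Φ p) (nhat q x Φ ν p) (vhat q (radial n Ω) (fhat q x Φ p))
  box_eq : ∀ (u : ℝ → N → ℝ) (uh : ℝ × EuclideanSpace ℝ (Fin (n - 1)) → ℝ),
    Sm (flowDom (n := n) q x U Φ) uh →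
    (∀ p ∈ flowDom q x U Φ, u p.1 ((extChartAt (𝓡 (n - 1)) x).symm p.2) = uh p) →
    box Φ ν u t x = boxE G Γ (fhat q x Φ) e (1, 0) (Hhat x Φ ν) uh
      (t, extChartAt (𝓡 (n - 1)) x x)

/-- The ambient chart is centred at Φ t x and the hypersurface chart at x, so that curvature, ∇²∂_r
and the intrinsic Hessian are all evaluated at chart centres; the frame is orthonormal for the first
fundamental form at (t, x). -/
theorem IsObstacleFlow.exists_localFlow (h : IsObstacleFlow n Ω r₀ U Φ ν) (hn : 2 ≤ n)
    (hx : (t, x) ∈ U) : ∃ V G Γ e S, LocalFlow Ω r₀ U Φ ν t x (Φ t x) V G Γ e S := by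
  set q := Φ t x with hq
  have hqc : q ∈ collar Ω r₀ := h.mem_collar t x hx
  have hco := isOpen_collar h.obstacle
  obtain ⟨G, Γ, mc⟩ := exists_metricCoord_chartSet n M q hco
  have hV : ∀ p ∈ flowDom (n := n) q x U Φ, fhat q x Φ p ∈ chartSet q (collar Ω r₀) := fun p hp =>
    map_mem_of_mem_flowDom h.mem_collar hp
  have hl := (extChartAt (𝓡 (n - 1)) x).left_inv (mem_extChartAt_source x)
  have hp : (t, extChartAt (𝓡 (n - 1)) x x) ∈ flowDom q x U Φ := by
    refine ⟨mem_extChartAt_target x, ?_, ?_⟩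
    · rw [hl]; exact hx
    · rw [hl]; exact mem_extChartAt_source q
  have hc := h.flow.hypCoord mc hV
  have hd : Module.finrank ℝ (EuclideanSpace ℝ (Fin n))
      = Module.finrank ℝ (EuclideanSpace ℝ (Fin (n - 1))) + 1 := by
    simp only [finrank_euclideanSpace, Fintype.card_fin]; omega
  obtain ⟨e, he⟩ := exists_orthonormal (hc.hform_symm hp) (hc.hform_pos hp) (d := n - 1) (by simp)
  have hs := span_of_orthonormal he (by simp)
  have core := hc.coreFlow hd hs (H := Hhat x Φ ν)
    (fun p hp e' he' => h.flow.flowH_eq mc hV hp he')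
    (fun p hp => h.flow.meanConvex _ _ hp.2.1)
    (fun p hp => by
      rw [← h.flow.kap_velocity hp, h.flow.evolution _ _ hp.2.1, map_smul]
      rfl)
  have ho := hc.orthoAt hd hp he (by simp)
  have hr : Sm (chartSet q (collar Ω r₀)) (rhat q Ω) := sm_chartSet h.obstacle.smooth hco
  have hP : ∀ p ∈ flowDom q x U Φ, flowP Ω Φ ν p.1 ((extChartAt (𝓡 (n - 1)) x).symm p.2)
      = G (fhat q x Φ p) (nhat q x Φ ν p) (vhat q (radial n Ω) (fhat q x Φ p)) := fun p hp => by
    rw [flowP, mc.eq _ hp.2.2 (hV p hp), fhat, vhat_chart hp.2.2]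
    rfl
  -- An empty boundary would force ∂_r = 0 and p = 0, contrary to p ≥ 1/2.
  have hne : (frontier Ω).Nonempty := by
    refine frontier_nonempty_of_radial_ne_zero (n := n) (y := q) fun h0 => ?_
    have h1 := h.half_le t x hx
    have h2 : flowP Ω Φ ν t x = 0 :=
      (congrArg (ambientMetric n M q (ν t x)) h0).trans (inner_zero_right _)
    rw [h2] at h1
    norm_num at h1
  refine ⟨_, G, Γ, _, _, hp, core, ho, ?_, hr, mc.sm_vhat_grad hr, fun z hz v => ?_,
    fun p hp => ?_, hP, fun u uh hu huh => ?_⟩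
  · refine flowBounds_of_obstacle h.obstacle hne hqc mc ?_ ho ?_
    · rw [fhat, hl]
    · rw [← hP _ hp]
      exact h.half_le _ _ hp.2.1
  · rw [← mc.lc.symmG z hz]
    exact (mc.kap_grad hr hz v).symm
  · rw [rhat, fhat, (extChartAt (𝓡 n) q).left_inv hp.2.2]
    rfl
  · exact h.flow.box_eq mc hV hp hs hu huh (by rw [Hhat, hl])

section

variable {q : M} {V : Set (EuclideanSpace ℝ (Fin n))}
  {G : EuclideanSpace ℝ (Fin n) →
      EuclideanSpace ℝ (Fin n) →L[ℝ] EuclideanSpace ℝ (Fin n) →L[ℝ] ℝ}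
  {Γ : EuclideanSpace ℝ (Fin n) →
      EuclideanSpace ℝ (Fin n) →L[ℝ] EuclideanSpace ℝ (Fin n) →L[ℝ] EuclideanSpace ℝ (Fin n)}
  {e : Fin (n - 1) → ℝ × EuclideanSpace ℝ (Fin (n - 1))}
  {S : Fin (n - 1) → Fin (n - 1) → ℝ × EuclideanSpace ℝ (Fin (n - 1)) → ℝ} {b γ : ℝ}

namespace LocalFlow

variable (L : LocalFlow Ω r₀ U Φ ν t x q V G Γ e S)
include L

lemma flowR_self : flowR Ω Φ t x = rhat q Ω (fhat q x Φ (t, extChartAt (𝓡 (n - 1)) x x)) := by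
  have := L.flowR_eq _ L.mem
  rwa [(extChartAt (𝓡 (n - 1)) x).left_inv (mem_extChartAt_source x)] at this

lemma flowP_self : flowP Ω Φ ν t x = G (fhat q x Φ (t, extChartAt (𝓡 (n - 1)) x x))
    (nhat q x Φ ν (t, extChartAt (𝓡 (n - 1)) x x))
    (vhat q (radial n Ω) (fhat q x Φ (t, extChartAt (𝓡 (n - 1)) x x))) := by
  have := L.flowP_eq _ L.mem
  rwa [(extChartAt (𝓡 (n - 1)) x).left_inv (mem_extChartAt_source x)] at this

lemma flowH_self : flowH Φ ν t x = Hhat x Φ ν (t, extChartAt (𝓡 (n - 1)) x x) := by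
  rw [Hhat, (extChartAt (𝓡 (n - 1)) x).left_inv (mem_extChartAt_source x)]

variable (h : ∀ t x, (t, x) ∈ U → Φ t x ∈ collar Ω r₀) (hb : 0 < b)
include h

lemma rhat_nonpos {p : ℝ × EuclideanSpace ℝ (Fin (n - 1))} (hp : p ∈ flowDom q x U Φ) :
    rhat q Ω (fhat q x Φ p) ≤ 0 := by
  rw [← L.flowR_eq p hp]
  exact signedDist_nonpos (h _ _ hp.2.1)

include hb

lemma sm_rpow (a : ℝ) :
    Sm (flowDom (n := n) q x U Φ) fun p => (b - rhat q Ω (fhat q x Φ p) / r₀) ^ a := fun p hp => by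
  have h1 : rhat q Ω (fhat q x Φ p) / r₀ ≤ 0 :=
    div_nonpos_of_nonpos_of_nonneg (L.rhat_nonpos h hp) L.bounds.pos.le
  exact (contDiffAt_const.sub ((L.smr.comp L.core.smf L.core.mem p hp).div_const
    _)).rpow_const_of_ne (by linarith)

theorem flowF_le (hn : 2 ≤ n) (hγ : 0 < γ) (hγ2 : γ < 1 / 2)
    (hγN : 100 * ((n - 1 : ℕ) : ℝ) ≤ 1 / γ) :
    (1 - flowP Ω Φ ν t x) ^ (2 / γ - 1) * flowH Φ ν t x ^ 2
        * box Φ ν (flowF Ω r₀ b γ Φ ν) t x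
      ≤ γ / 2 / r₀ ^ 2 * (-(flowF Ω r₀ b γ Φ ν t x ^ ((γ + 2) / γ))
        + 2 / γ * ((34 * ((n - 1 : ℕ) : ℝ) ^ 2 + 5 * ((n - 1 : ℕ) : ℝ) ^ 2 * γ)
          * (2 + 6 * ((n - 1 : ℕ) : ℝ) + 68 * ((n - 1 : ℕ) : ℝ) ^ 2 / γ))) := by
  have sP := L.core.lc.sm_ip L.core.smf L.core.mem L.core.smν
    (L.smY.comp L.core.smf L.core.mem)
  have key := L.core.boxE_F_le L.ortho L.mem L.bounds L.smr L.smY L.grad_r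
    (fun p hp => L.rhat_nonpos h hp) hb (γ := γ) (by rw [Fintype.card_fin]; omega) hγ hγ2
    (by rwa [Fintype.card_fin])
  rw [Fintype.card_fin] at key
  rw [L.box_eq _ _ ((Sm.sub (fun _ _ => contDiffAt_const) sP).mul (L.sm_rpow h hb (-γ)))
    fun p hp => by rw [flowF, L.flowP_eq p hp, L.flowR_eq p hp], flowF, L.flowP_self,
    L.flowR_self, L.flowH_self]
  exact key

theorem flowG_le (hn : 2 ≤ n) (hγ : 0 < γ) (hγ2 : γ < 1 / 2) (hb2 : b < 1 / 2) {K C : ℝ}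
    (hrb : flowR Ω Φ t x < -(b * r₀))
    (hK : 1 - flowP Ω Φ ν t x ≤ K * (b - flowR Ω Φ t x / r₀) ^ γ) (hC : 4 * n + 6 * K ≤ C) :
    box Φ ν (flowG Ω r₀ b γ Φ ν) t x
      ≤ -(flowG Ω r₀ b γ Φ ν t x) / n + 4 * n / flowG Ω r₀ b γ Φ ν t x
        + 1 / 2 * (b - flowR Ω Φ t x / r₀) ^ (-γ) * (C / flowG Ω r₀ b γ Φ ν t x - 1) := by
  rw [L.flowR_self] at hrb
  rw [L.flowP_self, L.flowR_self] at hK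
  have key := L.core.boxE_G_le L.ortho L.mem L.bounds L.smr L.smY L.grad_r
    (fun p hp => L.rhat_nonpos h hp) hb (by rw [Fintype.card_fin]; omega)
    (by rw [Fintype.card_fin]; omega) hγ hγ2 hb2
    (by
      rw [← L.flowR_eq _ L.mem]
      exact neg_le_signedDist (h _ _ L.mem.2.1)) hrb hK hC
  rw [L.box_eq _ _ ((Sm.mul (fun _ _ => contDiffAt_const) L.core.smH).mul
    (Sm.sub (L.sm_rpow h hb (1 - γ)) fun _ _ => contDiffAt_const))
    fun p hp => by rw [flowG, L.flowR_eq p hp]; rfl, flowG, L.flowR_self, L.flowH_self]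
  exact key

end LocalFlow
end

end ObstacleFlow

end

end IMCF

/-! ### The theorem -/

theorem mainTheorem9 (n : ℕ) (hn : 2 ≤ n) :
    (∃ γ ∈ Ioo (0 : ℝ) (1 / 2), ∃ C₁ > (0 : ℝ), ∃ C₂ > (0 : ℝ),
      ∀ (M : Type*) [MetricSpace M] [ChartedSpace (EuclideanSpace ℝ (Fin n)) M]
        [IsManifold (𝓡 n) ∞ M] [RiemannianBundle (fun x : M => TangentSpace (𝓡 n) x)]
        [IsContMDiffRiemannianBundle (𝓡 n) ∞ (EuclideanSpace ℝ (Fin n))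
          (fun x : M => TangentSpace (𝓡 n) x)]
        [IsRiemannianManifold (𝓡 n) M]
        (N : Type*) [TopologicalSpace N] [ChartedSpace (EuclideanSpace ℝ (Fin (n - 1))) N]
        [IsManifold (𝓡 (n - 1)) ∞ N]
        (Ω : Set M) (r₀ : ℝ) (U : Set (ℝ × N)) (Φ : ℝ → N → M)
        (ν : ∀ t x, TangentSpace (𝓡 n) (Φ t x)),
        IsObstacleFlow n Ω r₀ U Φ ν →
        ∀ b ∈ Ioc (0 : ℝ) 1,
          ∃ X : ℝ → VField (n - 1) N, IsSmoothTangent n U X ∧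
            ∀ t x, (t, x) ∈ U →
              (1 - flowP Ω Φ ν t x) ^ (2 / γ - 1) * flowH Φ ν t x ^ 2
                    * box Φ ν (flowF Ω r₀ b γ Φ ν) t x
                  + gradInner n Φ (flowF Ω r₀ b γ Φ ν) X t x
                ≤ C₁ / r₀ ^ 2 * (-(flowF Ω r₀ b γ Φ ν t x ^ ((γ + 2) / γ)) + C₂)) ∧
    (∀ C₃ : ℝ, ∃ C₄ > (0 : ℝ), ∃ C₅ > (0 : ℝ),
      ∀ b ∈ Ioo (0 : ℝ) (1 / 2), ∀ γ ∈ Ioo (0 : ℝ) (1 / 2),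
      ∀ (M : Type*) [MetricSpace M] [ChartedSpace (EuclideanSpace ℝ (Fin n)) M]
        [IsManifold (𝓡 n) ∞ M] [RiemannianBundle (fun x : M => TangentSpace (𝓡 n) x)]
        [IsContMDiffRiemannianBundle (𝓡 n) ∞ (EuclideanSpace ℝ (Fin n))
          (fun x : M => TangentSpace (𝓡 n) x)]
        [IsRiemannianManifold (𝓡 n) M]
        (N : Type*) [TopologicalSpace N] [ChartedSpace (EuclideanSpace ℝ (Fin (n - 1))) N]
        [IsManifold (𝓡 (n - 1)) ∞ N]
        (Ω : Set M) (r₀ : ℝ) (U : Set (ℝ × N)) (Φ : ℝ → N → M)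
        (ν : ∀ t x, TangentSpace (𝓡 n) (Φ t x)),
        IsObstacleFlow n Ω r₀ U Φ ν →
        (∀ t x, (t, x) ∈ U → 1 - flowP Ω Φ ν t x ≤ C₃ * (b - flowR Ω Φ t x / r₀) ^ γ) →
          ∃ X : ℝ → VField (n - 1) N, IsSmoothTangent n U X ∧
            ∀ t x, (t, x) ∈ U → flowR Ω Φ t x < -(b * r₀) →
              box Φ ν (flowG Ω r₀ b γ Φ ν) t x + gradInner n Φ (flowG Ω r₀ b γ Φ ν) X t x
                ≤ -(flowG Ω r₀ b γ Φ ν t x) / n + 4 * n / flowG Ω r₀ b γ Φ ν t x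
                  + C₄ * (b - flowR Ω Φ t x / r₀) ^ (-γ)
                    * (C₅ / flowG Ω r₀ b γ Φ ν t x - 1)) := by
  have hN : (1 : ℝ) ≤ ((n - 1 : ℕ) : ℝ) := by exact_mod_cast (by omega : 1 ≤ n - 1)
  constructor
  · obtain ⟨γ, hγ, hγ2, hγN⟩ : ∃ γ : ℝ, 0 < γ ∧ γ < 1 / 2 ∧
        100 * ((n - 1 : ℕ) : ℝ) ≤ 1 / γ :=
      -- The largest γ allowed by `reaction_F_le`; it lies below 1/2 since n - 1 ≥ 1.
      ⟨1 / (100 * ((n - 1 : ℕ) : ℝ)), by positivity,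
        one_div_lt_one_div_of_lt (by norm_num) (by linarith), (one_div_one_div _).ge⟩
    refine ⟨γ, ⟨hγ, hγ2⟩, γ / 2, half_pos hγ,
      2 / γ * ((34 * ((n - 1 : ℕ) : ℝ) ^ 2 + 5 * ((n - 1 : ℕ) : ℝ) ^ 2 * γ)
        * (2 + 6 * ((n - 1 : ℕ) : ℝ) + 68 * ((n - 1 : ℕ) : ℝ) ^ 2 / γ)), by positivity,
      fun M _ _ _ _ _ _ N _ _ _ Ω r₀ U Φ ν h b hb =>
      ⟨fun _ _ => 0, isSmoothTangent_zero, fun t x hx => ?_⟩⟩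
    obtain ⟨V, G, Γ, e, S, L⟩ := h.exists_localFlow hn hx
    rw [gradInner_zero, add_zero]
    exact L.flowF_le h.mem_collar hb.1 hn hγ hγ2 hγN
  -- `C₃` may be negative; its absolute value keeps C₅ positive and only weakens the bound on 1 - p.
  · refine fun C₃ => ⟨1 / 2, by norm_num, 4 * n + 6 * |C₃|, by positivity,
      fun b hb γ hγ M _ _ _ _ _ _ N _ _ _ Ω r₀ U Φ ν h hC =>
        ⟨fun _ _ => 0, isSmoothTangent_zero, fun t x hx hr => ?_⟩⟩
    obtain ⟨V, G, Γ, e, S, L⟩ := h.exists_localFlow hn hx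
    rw [gradInner_zero, add_zero]
    refine L.flowG_le h.mem_collar hb.1 hn hγ.1 hγ.2 hb.2 hr ((hC t x hx).trans ?_) le_rfl
    have h1 : flowR Ω Φ t x / r₀ ≤ 0 :=
      div_nonpos_of_nonpos_of_nonneg (signedDist_nonpos (h.mem_collar t x hx)) h.obstacle.pos.le
    have h2 : 0 < b - flowR Ω Φ t x / r₀ := by linarith [hb.1]
    exact mul_le_mul_of_nonneg_right (le_abs_self C₃) (Real.rpow_nonneg h2.le γ)
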